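/- Let $n\ge 2$ and let $(M,g)$ be a compact $n$-dimensional Riemannian manifold with piecewise smooth boundary $\partial M\neq\emptyset$; that is, $M$ is a compact subset of a smooth Riemannian $n$-manifold $(N,g)$ without boundary, $\partial M$ is its topological boundary, and around each point of $\partial M$ the set $M$ is carried, in a smooth chart of $N$, to a half-space of $\mathbb{R}^n$ by a homeomorphism between open sets which, together with its inverse, is piecewise smooth (a continuous map that at each point takes the value of one of finitely many smooth maps). For $p\in\partial M$ and $\varepsilon>0$ let $b_p(\varepsilon)\subset\partial M$ be the open $\varepsilon$-ball around $p$ for the intrinsic distance of $\partial M$ (the infimum of the lengths of curves in $\partial M$). For $A\subset\partial M$ let $H^1_A(M)=\{f\in H^1(M): f|_A=0 \text{ in the sense of traces}\}$, where $H^1(M)$ is the completion of the smooth functions in the $H^1$-norm. An eigenvalue of the Laplacian on $M$ with Dirichlet conditions on $A$ and Neumann conditions on $\partial M\setminus A$ is a number $\lambda$ for which there is a nonzero $u\in H^1_A(M)$ with $$\int_M\langle\nabla u,\nabla v\rangle\,\mathrm{d}V_g=\lambda\int_M uv\,\mathrm{d}V_g\qquad\text{for all } v\in H^1_A(M).$$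 For $A=\partial M$ (the Dirichlet Laplacian), and for $A=\partial M\setminus b_p(\varepsilon)$ with any $\varepsilon>0$ (Dirichlet on $\partial M\setminus b_p(\varepsilon)$, Neumann on $b_p(\varepsilon)$), there is a complete orthonormal system of eigenfunctions in $L^2(M)$ whose eigenvalues form a nondecreasing sequence tending to infinity. Denote these sequences by $\lambda^{\mathcal D}_1(M)\le\lambda^{\mathcal D}_2(M)\le\cdots$ and $\lambda^{\varepsilon}_1(M)\le\lambda^{\varepsilon}_2(M)\le\cdots$ respectively. Then, for every integer $k\ge 1$, $$\lim_{\varepsilon\to 0^+}\lambda^{\varepsilon}_k(M)=\lambda^{\mathcal D}_k(M).$$ -/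

import Mathlib

open Set Filter Topology MeasureTheory Bundle Manifold
open scoped ENNReal ContDiff

noncomputable section

namespace MixedSpectrum

/-! ### Piecewise smooth boundaries

A compact manifold with piecewise smooth boundary is a compact subset `M` of a smooth Riemannian
manifold `N` without boundary (of the same dimension `n`), such that near each boundary point a
piecewise smooth homeomorphism with piecewise smooth inverse turns `M` into a half-space. -/

/-- `f` is piecewise smooth on `U`: it is continuous there, and at each point of `U` it takes the
value of one of finitely many smooth maps. -/
def PiecewiseSmoothOn {n : ℕ} (f : EuclideanSpace ℝ (Fin n) → EuclideanSpace ℝ (Fin n))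
    (U : Set (EuclideanSpace ℝ (Fin n))) : Prop :=
  ContinuousOn f U ∧
    ∃ (m : ℕ) (F : Fin m → EuclideanSpace ℝ (Fin n) → EuclideanSpace ℝ (Fin n)),
      (∀ i, ContDiffOn ℝ ∞ (F i) U) ∧ ∀ y ∈ U, ∃ i, f y = F i y

/-- The boundary of the subset `M` of the `n`-manifold `N` is piecewise smooth: around each point
`x` of it, `M`, read in a smooth chart, is carried to the half-space `{z | 0 ≤ zᵢ}` by a homeomorphism
`Φ` between open sets such that both `Φ` and its inverse are piecewise smooth. Smooth boundaries,
corners of the form `[0,∞)^k × ℝ^(n-k)` and reentrant corners are included; cusps are not. -/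
def HasPiecewiseSmoothBoundary (n : ℕ) {N : Type*} [TopologicalSpace N]
    [ChartedSpace (EuclideanSpace ℝ (Fin n)) N] (M : Set N) : Prop :=
  ∀ x ∈ frontier M,
    ∃ (Φ : OpenPartialHomeomorph (EuclideanSpace ℝ (Fin n)) (EuclideanSpace ℝ (Fin n)))
      (i : Fin n),
      extChartAt (𝓡 n) x x ∈ Φ.source ∧
      Φ.source ⊆ (extChartAt (𝓡 n) x).target ∧
      PiecewiseSmoothOn Φ Φ.source ∧
      PiecewiseSmoothOn Φ.symm Φ.target ∧
      ∀ y ∈ Φ.source, (extChartAt (𝓡 n) x).symm y ∈ M ↔ 0 ≤ Φ y i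

/-! ### Geodesic balls of the boundary -/

/-- The intrinsic distance of a subset `S` of a metric space: the infimum of the lengths of the
curves in `S` from `p` to `q` (it is `∞` if there is no such curve of finite length). -/
def intrinsicEDist {N : Type*} [EMetricSpace N] (S : Set N) (p q : N) : ℝ≥0∞ :=
  ⨅ (γ : ℝ → N) (_ : ContinuousOn γ (Icc 0 1) ∧ MapsTo γ (Icc 0 1) S ∧ γ 0 = p ∧ γ 1 = q),
    eVariationOn γ (Icc 0 1)

/-- The geodesic ball `b_p(ε)` of radius `ε` around `p` in the boundary of `M`. -/
def boundaryBall {N : Type*} [EMetricSpace N] (M : Set N) (p : N) (ε : ℝ) : Set N :=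
  {q ∈ frontier M | intrinsicEDist (frontier M) p q < ENNReal.ofReal ε}

/-! ### Sobolev spaces and the Dirichlet integral

The Riemannian volume is the normalised `n`-dimensional Hausdorff measure `μHE[n]` of the
Riemannian distance, the surface measure of the boundary is `μHE[n - 1]`. -/

section Sobolev

variable (n : ℕ) {N : Type*} [EMetricSpace N] [MeasurableSpace N] [BorelSpace N]
  [ChartedSpace (EuclideanSpace ℝ (Fin n)) N] [IsManifold (𝓡 n) ∞ N]
  [RiemannianBundle (fun x : N => TangentSpace (𝓡 n) x)]

/-- The Riemannian gradient of `φ` at `x`: the vector representing the differential of `φ`. -/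
def riemannianGradient (φ : N → ℝ) (x : N) : TangentSpace (𝓡 n) x :=
  haveI : FiniteDimensional ℝ (TangentSpace (𝓡 n) x) :=
    inferInstanceAs (FiniteDimensional ℝ (EuclideanSpace ℝ (Fin n)))
  haveI : CompleteSpace (TangentSpace (𝓡 n) x) := FiniteDimensional.complete ℝ _
  (InnerProductSpace.toDual ℝ (TangentSpace (𝓡 n) x)).symm (mfderiv (𝓡 n) 𝓘(ℝ, ℝ) φ x)

/-- The real Hilbert space `L²(M)` with respect to the Riemannian volume. -/
abbrev L2 (M : Set N) : Type _ := Lp ℝ 2 ((μHE[n] : Measure N).restrict M)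

/-- The smooth functions `φ j` converge to `u` in `H¹(M)`: they converge to `u` in `L²(M)`, and
their gradients form a Cauchy sequence in `L²(M)`. -/
structure IsH1Approx (M : Set N) (u : L2 n M) (φ : ℕ → N → ℝ) : Prop where
  smooth : ∀ j, ContMDiff (𝓡 n) 𝓘(ℝ, ℝ) ∞ (φ j)
  tendsto_L2 : Tendsto (fun j => ∫⁻ x in M, ‖φ j x - u x‖ₑ ^ 2 ∂μHE[n]) atTop (𝓝 0)
  cauchy_gradient : Tendsto (fun ij : ℕ × ℕ => ∫⁻ x in M,
    ‖riemannianGradient n (φ ij.1) x - riemannianGradient n (φ ij.2) x‖ₑ ^ 2 ∂μHE[n])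
    atTop (𝓝 0)

/-- `{u ∈ H¹(M) | u = 0 on A}` for a subset `A` of the boundary of `M`. Here `H¹(M)` is the
completion of the smooth functions, and `u = 0` on `A` in the sense of traces: for smooth
functions `φ j` tending to `u` in `H¹(M)`, the restrictions of the `φ j` to `A` tend to `0` in
`L²(A)` with respect to the surface measure. -/
def H1Vanishing (M A : Set N) : Set (L2 n M) :=
  {u | ∃ φ : ℕ → N → ℝ, IsH1Approx n M u φ ∧
    Tendsto (fun j => ∫⁻ x in A, ‖φ j x‖ₑ ^ 2 ∂μHE[n - 1]) atTop (𝓝 0)}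

/-- `q(u, v) = c`, where `q(u, v) = ∫_M ⟨∇u, ∇v⟩ dV` is the Dirichlet integral, extended from
smooth functions to `H¹(M)` by continuity. -/
def DirichletIntegralEq (M : Set N) (u v : L2 n M) (c : ℝ) : Prop :=
  ∃ φ ψ : ℕ → N → ℝ, IsH1Approx n M u φ ∧ IsH1Approx n M v ψ ∧
    Tendsto (fun j => ∫ x in M,
      inner ℝ (riemannianGradient n (φ j) x) (riemannianGradient n (ψ j) x) ∂μHE[n])
      atTop (𝓝 c)

/-- `u` is an eigenfunction with eigenvalue `t` of the (positive) Laplacian on `M` with Dirichlet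
conditions on the part `A` of the boundary and Neumann conditions on the rest of it, that is, of
the self-adjoint operator associated with the Dirichlet integral on `H1Vanishing n M A`. -/
def IsEigenfunction (M A : Set N) (u : L2 n M) (t : ℝ) : Prop :=
  u ≠ 0 ∧ u ∈ H1Vanishing n M A ∧
    ∀ v ∈ H1Vanishing n M A, DirichletIntegralEq n M u v (t * inner ℝ u v)

/-- `lam 0 ≤ lam 1 ≤ ...` are the eigenvalues, repeated according to multiplicity, of the
Laplacian on `M` with Dirichlet conditions on `A` and Neumann conditions on the rest of the
boundary: they tend to infinity and belong to a complete orthonormal system of eigenfunctions in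
`L²(M)`. The `k`-th eigenvalue, `k ≥ 1`, is `lam (k - 1)`. -/
def IsEigenvalueSequence (M A : Set N) (lam : ℕ → ℝ) : Prop :=
  Monotone lam ∧ Tendsto lam atTop atTop ∧
    ∃ b : HilbertBasis ℕ ℝ (L2 n M), ∀ k, IsEigenfunction n M A (b k) (lam k)

end Sobolev

end MixedSpectrum

end

/-! ### Hilbert space background: weak limits and compact positive operators. -/

namespace MixedSpectrum

set_option linter.unusedSectionVars false

section Hilbert

variable {W H : Type*} [NormedAddCommGroup W] [InnerProductSpace ℝ W] [CompleteSpace W]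
  [NormedAddCommGroup H] [InnerProductSpace ℝ H] [CompleteSpace H]

/-! ### Weak limits -/

/-! Let `W` be the completion of the smooth functions in the `H¹` norm and `J : W → L²(M)` the
canonical map. The elements of `W` with vanishing trace on `A` form a closed subspace `V_A`,
consisting of the limits of smooth functions whose `L²(A)` norms tend to zero. No bounded trace
operator is needed. Since the inner product of `W` is the `L²` product plus the Dirichlet integral,
`λ` is an eigenvalue for `A` exactly when `λ + 1` is an eigenvalue of the form `⟪·, ·⟫` on `V_A`
relative to `L²(M)`.

Two analytic facts make this a discrete spectral problem. First, `J` is injective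
(`IsFormCompletion.injective`): the gradient is closable, by integration by parts inside `M`, and
the boundary is null. Second, `J` is compact (`IsFormCompletion.isCompactOperator`): `M` is covered
by finitely many bi-Lipschitz images of convex sets, and the Poincaré inequality on small convex
pieces bounds the `L²` norm by a small multiple of the gradient plus finitely many functionals.

Put `A_ε = ∂M \ b_p(ε)`. As `ε` decreases, `V_{A_ε}` shrinks and always contains `V_{∂M}`, so by the
min-max principle the `k`-th eigenvalue increases and stays below the Dirichlet one. If it stayed
below some `c`, the first eigenvectors would be bounded in `W`. By compactness of `J` they would
have weak limits, still orthonormal in `L²`, lying in every `V_{A_ε}` and spanning a space on which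
the form is at most `c` times the `L²` norm squared. Hence the limit is the Dirichlet eigenvalue as
soon as the intersection of all `V_{A_ε}` is `V_{∂M}`; this is `tendsto_eigenvalue`.

That identity (`IsFormCompletion.mem_vanishingSubspace_frontier`) says that a point has no capacity
when `n ≥ 2`. Cutoffs `η_m` vanishing near `p`, with transition at scale `δ`, have Dirichlet
integral of order `δ^(n-2)`, which is merely bounded for `n = 2`; but boundedness suffices for weak
limits. If `φ_m → w` have small trace off a ball on which `η_m` vanishes, then `η_m · k sin(φ_m /
k)` has small trace on all of `∂M`. It is bounded in `W`, because the truncation is bounded by `k`,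
and it converges in `L²` to `k sin(w / k)`, which therefore lies in `V_{∂M}`. As `k → ∞` these
truncations stay bounded in `W` and tend to `w` in `L²`, so `w` is their weak limit and lies in
`V_{∂M}`. -/

theorem tendsto_inner_of_dense {S : Submodule ℝ W} (hS : Dense (S : Set W)) {u : ℕ → W} {C : ℝ}
    (hu : ∀ m, ‖u m‖ ≤ C) (h : ∀ v ∈ S, CauchySeq fun m => inner ℝ (u m) v) (v : W) :
    CauchySeq fun m => inner ℝ (u m) v := by
  have hC : 0 ≤ C := (norm_nonneg _).trans (hu 0)
  rw [Metric.cauchySeq_iff']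
  intro ε hε
  obtain ⟨s, hs, hvs⟩ := Metric.mem_closure_iff.1 (hS v) (ε / (4 * (C + 1))) (by positivity)
  obtain ⟨N, hN⟩ := Metric.cauchySeq_iff'.1 (h s hs) (ε / 2) (by positivity)
  refine ⟨N, fun m hm => ?_⟩
  have h1 := hN m hm
  have key : ∀ k, |inner ℝ (u k) v - inner ℝ (u k) s| ≤ ε / 4 := by
    intro k
    rw [← inner_sub_right]
    calc |inner ℝ (u k) (v - s)| ≤ ‖u k‖ * ‖v - s‖ := abs_real_inner_le_norm _ _
      _ ≤ C * (ε / (4 * (C + 1))) := by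
          gcongr
          · exact hu k
          · rw [← dist_eq_norm]; exact hvs.le
      _ ≤ (C + 1) * (ε / (4 * (C + 1))) := by gcongr; linarith
      _ = ε / 4 := by field_simp
  have k1 := abs_le.1 (key m)
  have k2 := abs_le.1 (key N)
  rw [Real.dist_eq, abs_lt] at *
  constructor <;> linarith [k1.1, k1.2, k2.1, k2.2, h1.1, h1.2]

/-- Injectivity of `J` makes the range of its adjoint dense, and `⟪u m, J* y⟫ = ⟪J (u m), y⟫`
converges for every `y`. So the whole bounded sequence converges weakly, without passing to a
subsequence. -/
theorem exists_weak_limit {J : W →L[ℝ] H} (hJ : Function.Injective J) {u : ℕ → W} {C : ℝ}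
    (hu : ∀ m, ‖u m‖ ≤ C) {h : H} (hh : Tendsto (fun m => J (u m)) atTop (𝓝 h)) :
    ∃ w : W, J w = h ∧ ‖w‖ ≤ C ∧
      ∀ v, Tendsto (fun m => inner ℝ (u m) v) atTop (𝓝 (inner ℝ w v)) := by
  have hC : 0 ≤ C := (norm_nonneg _).trans (hu 0)
  set Ja := ContinuousLinearMap.adjoint J
  have hdense : Dense ((LinearMap.range (Ja : H →ₗ[ℝ] W) : Submodule ℝ W) : Set W) := by
    rw [← Submodule.dense_iff_topologicalClosure_eq_top.symm]
    rw [Submodule.topologicalClosure_eq_top_iff, Submodule.eq_bot_iff]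
    intro x hx
    apply hJ
    rw [map_zero]
    have := (Submodule.mem_orthogonal _ _).1 hx (Ja (J x)) ⟨J x, rfl⟩
    rwa [ContinuousLinearMap.adjoint_inner_left, inner_self_eq_zero] at this
  have hin : ∀ y, Tendsto (fun m => inner ℝ (u m) (Ja y)) atTop (𝓝 (inner ℝ h y)) := by
    intro y
    simp_rw [Ja, ContinuousLinearMap.adjoint_inner_right]
    exact hh.inner tendsto_const_nhds
  have hcau := fun v => tendsto_inner_of_dense hdense hu
    (by rintro _ ⟨y, rfl⟩; exact (hin y).cauchySeq) v
  choose ℓ hℓ using fun v => cauchySeq_tendsto_of_complete (hcau v)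
  let L : W →ₗ[ℝ] ℝ :=
    { toFun := ℓ
      map_add' := fun x y => tendsto_nhds_unique (hℓ (x + y))
        (by simp_rw [inner_add_right]; exact (hℓ x).add (hℓ y))
      map_smul' := fun c x => tendsto_nhds_unique (hℓ (c • x))
        (by simp_rw [inner_smul_right]; exact (hℓ x).const_mul c) }
  have hL : ∀ v, ‖L v‖ ≤ C * ‖v‖ := fun v =>
    le_of_tendsto (hℓ v).norm (Eventually.of_forall fun m =>
      (norm_inner_le_norm _ _).trans (by gcongr; exact hu m))
  let L' := L.mkContinuous C hL
  let w := (InnerProductSpace.toDual ℝ W).symm L'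
  have hw : ∀ v, inner ℝ w v = ℓ v := fun v => InnerProductSpace.toDual_symm_apply
  refine ⟨w, ?_, ?_, fun v => by rw [hw]; exact hℓ v⟩
  · refine ext_inner_right ℝ fun y => ?_
    rw [← ContinuousLinearMap.adjoint_inner_right, hw]
    exact tendsto_nhds_unique (hℓ _) (hin y)
  · rw [LinearIsometryEquiv.norm_map]
    exact LinearMap.mkContinuous_norm_le _ hC _

/-- Closed convex sets are weakly closed. If `c` is the point of `K` nearest to `w`, the inequality
`⟪w - c, u m - c⟫ ≤ 0` passes to the limit and gives `w = c`. -/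
theorem mem_of_weak_limit {K : Set W} (hK : IsClosed K) (hconv : Convex ℝ K) {u : ℕ → W} {w : W}
    (hu : ∀ᶠ m in atTop, u m ∈ K)
    (hw : ∀ v, Tendsto (fun m => inner ℝ (u m) v) atTop (𝓝 (inner ℝ w v))) : w ∈ K := by
  obtain ⟨m, hm⟩ := hu.exists
  obtain ⟨c, hc, hcw⟩ := exists_norm_eq_iInf_of_complete_convex ⟨_, hm⟩ hK.isComplete hconv w
  have h := (norm_eq_iInf_iff_real_inner_le_zero hconv hc).1 hcw
  have h2 : inner ℝ (w - c) (w - c) ≤ 0 := by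
    have ht : Tendsto (fun m => inner ℝ (w - c) (u m - c)) atTop (𝓝 (inner ℝ (w - c) (w - c))) := by
      simp_rw [inner_sub_right (w - c), real_inner_comm _ (w - c)]
      exact (hw _).sub_const _
    exact le_of_tendsto ht (hu.mono fun m hm => h _ hm)
  rw [real_inner_self_eq_norm_sq] at h2
  have h3 : ‖w - c‖ = 0 := by
    have := sq_nonneg ‖w - c‖
    exact pow_eq_zero_iff two_ne_zero |>.1 (le_antisymm h2 this)
  rw [sub_eq_zero.1 (norm_eq_zero.1 h3)]
  exact hc

/-! ### The spectral theorem with ordered eigenvalues -/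

/-- For a positive symmetric operator the norm is the supremum of the Rayleigh quotient. Were `‖T‖`
in the resolvent set, that supremum would be strictly smaller; hence `‖T‖` is in the spectrum and,
by compactness, is an eigenvalue. -/
theorem exists_unit_max_eigenvector {T : H →L[ℝ] H} (hT : IsCompactOperator T)
    (hsymm : T.IsSymmetric) (hpos : ∀ x, 0 ≤ inner ℝ (T x) x) (hne : ∀ x, T x = 0 → x = 0)
    [Nontrivial H] :
    ∃ (e : H) (ν : ℝ), ‖e‖ = 1 ∧ T e = ν • e ∧ ∀ x, inner ℝ (T x) x ≤ ν * ‖x‖ ^ 2 := by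
  have hT0 : ‖T‖ ≠ 0 := by
    obtain ⟨x, hx⟩ := exists_ne (0 : H)
    intro h
    exact hx (hne x (by rw [norm_eq_zero.1 h]; rfl))
  have hmem : ‖T‖ ∈ spectrum ℝ T := by
    by_contra hcon
    have hres : algebraMap ℝ ℝ ‖T‖ ∈ resolventSet ℝ T := by
      simpa [spectrum] using hcon
    obtain ⟨ε, hε, hle⟩ := T.rayleighQuotient_le_of_norm_mem_resolventSet hres
    have h1 : ‖T‖ ≤ ‖T‖ - ε := by
      conv_lhs => rw [T.norm_eq_iSup_rayleighQuotient hsymm]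
      refine ciSup_le fun x => ?_
      rw [abs_of_nonneg]
      · exact hle x
      · rw [ContinuousLinearMap.rayleighQuotient, ContinuousLinearMap.reApplyInnerSelf_apply]
        exact div_nonneg (hpos x) (by positivity)
    linarith
  have hev : Module.End.HasEigenvalue (T : Module.End ℝ H) ‖T‖ :=
    (hT.hasEigenvalue_iff_mem_spectrum hT0).2 hmem
  obtain ⟨v, hv, hv0⟩ := hev.exists_hasEigenvector
  have hv1 : T v = ‖T‖ • v := Module.End.mem_eigenspace_iff.1 hv
  refine ⟨‖v‖⁻¹ • v, ‖T‖, ?_, ?_, fun x => ?_⟩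
  · rw [norm_smul, norm_inv, norm_norm, inv_mul_cancel₀ (norm_ne_zero_iff.2 hv0)]
  · rw [map_smul, hv1, smul_comm]
  · calc inner ℝ (T x) x ≤ ‖T x‖ * ‖x‖ := real_inner_le_norm _ _
      _ ≤ ‖T‖ * ‖x‖ * ‖x‖ := by gcongr; exact T.le_opNorm x
      _ = _ := by ring

theorem exists_unit_max_eigenvector_orthogonal {T : H →L[ℝ] H} (hT : IsCompactOperator T)
    (hsymm : T.IsSymmetric) (hpos : ∀ x, 0 ≤ inner ℝ (T x) x) (hne : ∀ x, T x = 0 → x = 0)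
    (hinf : ¬ FiniteDimensional ℝ H) (S : Submodule ℝ H) [FiniteDimensional ℝ S]
    (hS : ∀ x ∈ S, T x ∈ S) :
    ∃ (e : H) (ν : ℝ), e ∈ Sᗮ ∧ ‖e‖ = 1 ∧ T e = ν • e ∧
      ∀ x ∈ Sᗮ, inner ℝ (T x) x ≤ ν * ‖x‖ ^ 2 := by
  have hinv : ∀ x ∈ Sᗮ, T x ∈ Sᗮ := by
    intro x hx
    rw [Submodule.mem_orthogonal] at hx ⊢
    intro y hy
    have := hsymm y x
    simp only [ContinuousLinearMap.coe_coe] at this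
    rw [← this]
    exact hx _ (hS y hy)
  have hnt : Nontrivial Sᗮ := by
    rw [Submodule.nontrivial_iff_ne_bot]
    intro h
    rw [Submodule.orthogonal_eq_bot_iff] at h
    apply hinf
    have hfin : FiniteDimensional ℝ S := inferInstance
    rw [h] at hfin
    exact Module.Finite.equiv (Submodule.topEquiv (R := ℝ) (M := H))
  let T' : Sᗮ →L[ℝ] Sᗮ := T.restrict hinv
  have hT' : IsCompactOperator T' := hT.restrict' hinv
  obtain ⟨e, ν, h1, h2, h3⟩ := exists_unit_max_eigenvector hT' (hsymm.restrict_invariant hinv)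
    (fun x => hpos x) (fun x hx => Subtype.ext (hne x (congrArg Subtype.val hx)))
  exact ⟨e, ν, e.2, h1, congrArg Subtype.val h2, fun x hx => h3 ⟨x, hx⟩⟩

/-- Eigenvectors of maximal eigenvalue are split off one at a time, each in the orthogonal
complement of its predecessors, which orders the eigenvalues. If these stayed above `c > 0`, the
vectors `T e_k` would be at mutual distance at least `c`, against compactness. A vector `x`
orthogonal to all of them has `⟪T x, x⟫ ≤ ν_k ‖x‖²` for every `k`, so it vanishes by positivity. -/
theorem exists_ordered_eigenbasis {T : H →L[ℝ] H} (hT : IsCompactOperator T)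
    (hsymm : T.IsSymmetric) (hpos : ∀ x, x ≠ 0 → 0 < inner ℝ (T x) x)
    (hinf : ¬ FiniteDimensional ℝ H) :
    ∃ (b : HilbertBasis ℕ ℝ H) (ν : ℕ → ℝ), (∀ k, T (b k) = ν k • b k) ∧ (∀ k, 0 < ν k) ∧
      Antitone ν ∧ Tendsto ν atTop (𝓝 0) := by
  have hne : ∀ x, T x = 0 → x = 0 := by
    intro x hx
    by_contra h
    have := hpos x h
    rw [hx, inner_zero_left] at this
    exact lt_irrefl _ this
  have hpos' : ∀ x, 0 ≤ inner ℝ (T x) x := by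
    intro x
    by_cases h : x = 0
    · simp [h]
    · exact (hpos x h).le
  -- The choice is made for every submodule, with value `0` where the construction does not apply,
  -- so that the recursion can be written before finite dimension and invariance are known.
  have step : ∀ S : Submodule ℝ H, ∃ (e : H) (ν : ℝ),
      FiniteDimensional ℝ S → (∀ x ∈ S, T x ∈ S) → e ∈ Sᗮ ∧ ‖e‖ = 1 ∧ T e = ν • e ∧
      ∀ x ∈ Sᗮ, inner ℝ (T x) x ≤ ν * ‖x‖ ^ 2 := by
    intro S
    by_cases h : FiniteDimensional ℝ S ∧ ∀ x ∈ S, T x ∈ S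
    · have := h.1
      obtain ⟨e, ν, h1⟩ := exists_unit_max_eigenvector_orthogonal hT hsymm hpos' hne hinf S h.2
      exact ⟨e, ν, fun _ _ => h1⟩
    · exact ⟨0, 0, fun h1 h2 => (h ⟨h1, h2⟩).elim⟩
  choose e ν hstep using step
  obtain ⟨S, hS0, hSs⟩ : ∃ S : ℕ → Submodule ℝ H, S 0 = ⊥ ∧
      ∀ k, S (k + 1) = S k ⊔ Submodule.span ℝ {e (S k)} :=
    ⟨fun k => Nat.rec ⊥ (fun _ S => S ⊔ Submodule.span ℝ {e S}) k, rfl, fun _ => rfl⟩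
  have hS : ∀ k : ℕ, FiniteDimensional ℝ ↥(S k) ∧ ∀ x ∈ S k, T x ∈ S k := by
    intro k
    induction k with
    | zero =>
      rw [hS0]
      refine ⟨inferInstance, ?_⟩
      intro x hx
      rw [(Submodule.mem_bot ℝ).1 hx, map_zero]
      exact Submodule.zero_mem _
    | succ k ih =>
      obtain ⟨i1, i2⟩ := ih
      refine ⟨by rw [hSs]; infer_instance, ?_⟩
      intro x hx
      rw [hSs, Submodule.mem_sup] at hx ⊢
      obtain ⟨y, hy, z, hz, rfl⟩ := hx
      obtain ⟨c, rfl⟩ := Submodule.mem_span_singleton.1 hz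
      refine ⟨T y, i2 y hy, T (c • e (S k)), ?_, (map_add _ _ _).symm⟩
      rw [map_smul, (hstep (S k) i1 i2).2.2.1]
      exact Submodule.smul_mem _ _ (Submodule.smul_mem _ _ (Submodule.mem_span_singleton_self _))
  have hSmono : Monotone S := monotone_nat_of_le_succ fun k => by rw [hSs]; exact le_sup_left
  have he := fun k => hstep (S k) (hS k).1 (hS k).2
  have hemem : ∀ i j, i < j → e (S i) ∈ S j := fun i j hij =>
    hSmono (Nat.succ_le_of_lt hij) (by
      rw [Nat.succ_eq_add_one, hSs]
      exact (le_sup_right : _ ≤ S i ⊔ _) (Submodule.mem_span_singleton_self _))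
  have horth : ∀ i j, i < j → inner ℝ (e (S i)) (e (S j)) = (0 : ℝ) := fun i j hij =>
    (Submodule.mem_orthogonal _ _).1 (he j).1 _ (hemem i j hij)
  have hon : Orthonormal ℝ fun k => e (S k) := by
    refine ⟨fun k => (he k).2.1, fun i j hij => ?_⟩
    rcases lt_or_gt_of_ne hij with h | h
    · exact horth i j h
    · rw [real_inner_comm]; exact horth j i h
  have hνeq : ∀ k, inner ℝ (T (e (S k))) (e (S k)) = ν (S k) := by
    intro k
    rw [(he k).2.2.1, inner_smul_left, real_inner_self_eq_norm_sq, (he k).2.1]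
    simp
  have hνpos : ∀ k, 0 < ν (S k) := fun k => by
    rw [← hνeq]
    exact hpos _ (fun h => by have := (he k).2.1; rw [h, norm_zero] at this; exact zero_ne_one this)
  have hνanti : Antitone fun k => ν (S k) := by
    intro i j hij
    have := (he i).2.2.2 (e (S j)) (Submodule.orthogonal_le (hSmono hij) (he j).1)
    rwa [hνeq, (he j).2.1, one_pow, mul_one] at this
  have hlim : Tendsto (fun k => ν (S k)) atTop (𝓝 0) := by
    have hlb : ∀ c : ℝ, 0 < c → ∃ k, ν (S k) < c := by
      intro c hc
      by_contra! hcon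
      have hcomp := hT.isCompact_closure_image_closedBall (1 : ℝ)
      obtain ⟨y, -, φ, hφ, hlim⟩ := hcomp.tendsto_subseq (x := fun k => T (e (S k)))
        (fun k => subset_closure ⟨e (S k), by simp [(he k).2.1], rfl⟩)
      obtain ⟨N, hN⟩ := Metric.cauchySeq_iff.1 hlim.cauchySeq c hc
      have hd := hN N le_rfl (N + 1) (Nat.le_succ _)
      simp only [Function.comp] at hd
      rw [dist_eq_norm] at hd
      have hlt : φ N < φ (N + 1) := hφ (Nat.lt_succ_self _)
      have hsq : ‖T (e (S (φ N))) - T (e (S (φ (N + 1))))‖ ^ 2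
          = ν (S (φ N)) ^ 2 + ν (S (φ (N + 1))) ^ 2 := by
        rw [(he _).2.2.1, (he _).2.2.1, norm_sub_sq_real, inner_smul_left, inner_smul_right,
          horth _ _ hlt, norm_smul, norm_smul, (he _).2.1, (he _).2.1]
        simp
      have h1 := hcon (φ N)
      have h2 : ‖T (e (S (φ N))) - T (e (S (φ (N + 1))))‖ ^ 2 < c ^ 2 := by gcongr
      nlinarith [sq_nonneg (ν (S (φ (N + 1))))]
    rw [Metric.tendsto_atTop]
    intro c hc
    obtain ⟨k, hk⟩ := hlb c hc
    refine ⟨k, fun j hj => ?_⟩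
    rw [Real.dist_eq, sub_zero, abs_of_pos (hνpos j)]
    exact (hνanti hj).trans_lt hk
  have hcompl : (Submodule.span ℝ (Set.range fun k => e (S k)))ᗮ = ⊥ := by
    rw [Submodule.eq_bot_iff]
    intro x hx
    by_contra hx0
    have hxS : ∀ k, x ∈ (S k)ᗮ := by
      intro k
      induction k with
      | zero =>
        rw [Submodule.mem_orthogonal]
        intro u hu
        rw [hS0] at hu
        rw [(Submodule.mem_bot ℝ).1 hu, inner_zero_left]
      | succ k ih =>
        rw [hSs, ← Submodule.inf_orthogonal]
        refine ⟨ih, Submodule.orthogonal_le (Submodule.span_mono ?_) hx⟩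
        rintro _ rfl
        exact ⟨k, rfl⟩
    have h1 : ∀ k, inner ℝ (T x) x ≤ ν (S k) * ‖x‖ ^ 2 := fun k => (he k).2.2.2 x (hxS k)
    have h2 := ge_of_tendsto' (hlim.mul_const (‖x‖ ^ 2)) h1
    rw [zero_mul] at h2
    exact absurd (hpos x hx0) (not_lt.2 h2)
  refine ⟨HilbertBasis.mkOfOrthogonalEqBot hon hcompl, fun k => ν (S k), fun k => ?_, hνpos,
    hνanti, hlim⟩
  rw [HilbertBasis.coe_mkOfOrthogonalEqBot]
  exact (he k).2.2.1

end Hilbert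

end MixedSpectrum

/-! ### Variational characterisation and convergence of form eigenvalues. -/

namespace MixedSpectrum

set_option linter.unusedSectionVars false

section Forms

variable {W H : Type*} [NormedAddCommGroup W] [InnerProductSpace ℝ W] [CompleteSpace W]
  [NormedAddCommGroup H] [InnerProductSpace ℝ H] [CompleteSpace H]

/-! ### Eigenbases of a form -/

/-- The orthonormal basis `b` of `H` consists of eigenvectors, with eigenvalues `μ`, of the
operator associated with the form `⟪·, ·⟫` of `W` restricted to `V`, where `W` is mapped
to `H` by `J`. -/
structure IsFormBasis (J : W →L[ℝ] H) (V : Submodule ℝ W) (b : HilbertBasis ℕ ℝ H)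
    (μ : ℕ → ℝ) : Prop where
  mono : Monotone μ
  eigen : ∀ k, ∃ w ∈ V, J w = b k ∧ ∀ v ∈ V, inner ℝ w v = μ k * inner ℝ (b k) (J v)

/-- The operator `T = J_V J_V*` on `H` inverts the operator of the form. If `T b = ν b`, then `w =
ν⁻¹ J_V* b` satisfies `J w = b` and `⟪w, v⟫ = ν⁻¹ ⟪b, J v⟫` on `V`, so the form eigenvalues are the
reciprocals of those of `T`. Density of `J V` makes `T` strictly positive. -/
theorem exists_isFormBasis {J : W →L[ℝ] H} (hJ : IsCompactOperator J) {V : Submodule ℝ W}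
    (hV : IsClosed (V : Set W)) (hdense : Dense (J '' (V : Set W)))
    (hinf : ¬ FiniteDimensional ℝ H) :
    ∃ (b : HilbertBasis ℕ ℝ H) (μ : ℕ → ℝ), IsFormBasis J V b μ ∧ Tendsto μ atTop atTop := by
  have : CompleteSpace V := hV.completeSpace_coe
  let JV : V →L[ℝ] H := J ∘L V.subtypeL
  let Ja : H →L[ℝ] V := ContinuousLinearMap.adjoint JV
  let T : H →L[ℝ] H := JV ∘L Ja
  have hT : IsCompactOperator T := (hJ.comp_clm V.subtypeL).comp_clm Ja
  have hinner : ∀ x y, inner ℝ (T x) y = inner ℝ (Ja x) (Ja y) := fun x y => by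
    change inner ℝ (JV (Ja x)) y = _
    rw [ContinuousLinearMap.adjoint_inner_right]
  have hsymm : T.IsSymmetric := fun x y => by
    change inner ℝ (T x) y = inner ℝ x (T y)
    rw [hinner, real_inner_comm (T y) x, hinner, real_inner_comm]
  have hpos : ∀ x, x ≠ 0 → 0 < inner ℝ (T x) x := by
    intro x hx
    rw [hinner, real_inner_self_eq_norm_sq]
    have : Ja x ≠ 0 := by
      intro h
      apply hx
      have h0 : ∀ y ∈ J '' (V : Set W), inner ℝ x y = (0 : ℝ) := by
        rintro _ ⟨v, hv, rfl⟩
        have := ContinuousLinearMap.adjoint_inner_left JV (⟨v, hv⟩ : V) x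
        change inner ℝ (Ja x) _ = _ at this
        rw [h, inner_zero_left] at this
        exact this.symm
      exact hdense.eq_zero_of_inner_left (𝕜 := ℝ) (fun v hv => h0 v hv)
    positivity
  obtain ⟨b, ν, hb, hν, hanti, hlim⟩ := exists_ordered_eigenbasis hT hsymm hpos hinf
  refine ⟨b, fun k => (ν k)⁻¹, ⟨?_, fun k => ⟨(ν k)⁻¹ • (Ja (b k) : W), ?_, ?_, ?_⟩⟩, ?_⟩
  · intro i j hij
    exact inv_anti₀ (hν j) (hanti hij)
  · exact V.smul_mem _ (Ja (b k)).2
  · have := hb k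
    change J (Ja (b k)) = _ at this
    rw [map_smul, this, smul_smul, inv_mul_cancel₀ (hν k).ne', one_smul]
  · intro v hv
    rw [inner_smul_left]
    have := ContinuousLinearMap.adjoint_inner_left JV (⟨v, hv⟩ : V) (b k)
    change inner ℝ (Ja (b k) : W) v = inner ℝ (b k) (J v) at this
    rw [this]
    rfl
  · exact tendsto_inv_nhdsGT_zero.comp
      (tendsto_nhdsWithin_iff.2 ⟨hlim, Eventually.of_forall hν⟩)

namespace IsFormBasis

variable {J : W →L[ℝ] H} {V : Submodule ℝ W} {b : HilbertBasis ℕ ℝ H} {μ : ℕ → ℝ}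

theorem exists_orthogonal (h : IsFormBasis J V b μ) : ∃ w : ℕ → W, (∀ k, w k ∈ V) ∧
    (∀ k, J (w k) = b k) ∧ (∀ k, ∀ v ∈ V, inner ℝ (w k) v = μ k * inner ℝ (b k) (J v)) ∧
    ∀ i j, inner ℝ (w i) (w j) = if i = j then μ i else 0 := by
  choose w h1 h2 h3 using h.eigen
  refine ⟨w, h1, h2, h3, fun i j => ?_⟩
  rw [h3 i (w j) (h1 j), h2 j, orthonormal_iff_ite.1 b.orthonormal]
  split_ifs <;> simp

theorem norm_sum_sq {w : ℕ → W} (hw : ∀ i j, inner ℝ (w i) (w j) = if i = j then μ i else 0)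
    (s : Finset ℕ) (c : ℕ → ℝ) : ‖∑ i ∈ s, c i • w i‖ ^ 2 = ∑ i ∈ s, μ i * c i ^ 2 := by
  rw [← real_inner_self_eq_norm_sq, sum_inner]
  refine Finset.sum_congr rfl fun i hi => ?_
  rw [inner_sum, Finset.sum_eq_single i]
  · rw [inner_smul_left, inner_smul_right, hw, if_pos rfl]
    simp only [conj_trivial]
    ring
  · intro j _ hji
    rw [inner_smul_left, inner_smul_right, hw, if_neg hji.symm]
    simp
  · exact fun h => (h hi).elim

theorem nonneg (h : IsFormBasis J V b μ) (k : ℕ) : 0 ≤ μ k := by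
  obtain ⟨w, -, -, -, hw⟩ := h.exists_orthogonal
  have := hw k k
  rw [if_pos rfl, real_inner_self_eq_norm_sq] at this
  rw [← this]
  positivity

/-- The form is at least `μ k` on vectors orthogonal to the first `k` eigenvectors. -/
theorem le_norm_sq (h : IsFormBasis J V b μ) {k : ℕ} {u : W} (hu : u ∈ V)
    (hk : ∀ i < k, inner ℝ (b i) (J u) = (0 : ℝ)) : μ k * ‖J u‖ ^ 2 ≤ ‖u‖ ^ 2 := by
  obtain ⟨w, hwV, hJw, hwin, hw⟩ := h.exists_orthogonal
  set c : ℕ → ℝ := fun i => inner ℝ (b i) (J u)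
  have hpars : HasSum (fun i => c i ^ 2) (‖J u‖ ^ 2) := by
    have := b.hasSum_inner_mul_inner (J u) (J u)
    rw [real_inner_self_eq_norm_sq] at this
    have he : (fun i => c i ^ 2) = fun i => inner ℝ (J u) (b i) * inner ℝ (b i) (J u) := by
      ext i
      rw [real_inner_comm (b i) (J u), sq]
    rw [he]
    exact this
  have hfin : ∀ m, ∑ i ∈ Finset.range m, μ i * c i ^ 2 ≤ ‖u‖ ^ 2 := by
    intro m
    -- Bessel's inequality for the orthogonal vectors `w i`, with `‖w i‖² = μ i` and `⟪w i, u⟫ = μ i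
    -- * c i`.
    have h0 := sq_nonneg ‖u - ∑ i ∈ Finset.range m, c i • w i‖
    rw [norm_sub_sq_real, norm_sum_sq hw, inner_sum] at h0
    have : ∀ i, inner ℝ u (c i • w i) = μ i * c i ^ 2 := fun i => by
      rw [inner_smul_right, real_inner_comm, hwin i u hu]
      ring
    simp_rw [this] at h0
    linarith
  have hle : ∀ m, μ k * ∑ i ∈ Finset.range m, c i ^ 2 ≤ ‖u‖ ^ 2 := by
    intro m
    refine le_trans ?_ (hfin m)
    rw [Finset.mul_sum]
    refine Finset.sum_le_sum fun i _ => ?_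
    rcases lt_or_ge i k with hik | hik
    · simp [c, hk i hik]
    · have := h.mono hik
      gcongr
  exact le_of_tendsto' (hpars.tendsto_sum_nat.const_mul _) hle

/-- If the form is at most `Λ` on a `k + 1`-dimensional subspace, then `μ k ≤ Λ`. -/
theorem le_of_subspace (h : IsFormBasis J V b μ) {k : ℕ} {x : ℕ → W} (hx : ∀ i, i ≤ k → x i ∈ V)
    (hon : ∀ i ≤ k, ∀ j ≤ k, inner ℝ (J (x i)) (J (x j)) = if i = j then (1 : ℝ) else 0) {Λ : ℝ}
    (hΛ : ∀ c : ℕ → ℝ, ‖∑ i ∈ Finset.range (k + 1), c i • x i‖ ^ 2 ≤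
      Λ * ∑ i ∈ Finset.range (k + 1), c i ^ 2) : μ k ≤ Λ := by
  let L : (Fin (k + 1) → ℝ) →ₗ[ℝ] (Fin k → ℝ) :=
    { toFun := fun c j => ∑ i : Fin (k + 1), c i * inner ℝ (b j) (J (x i))
      map_add' := fun c d => by
        ext j
        simp [add_mul, Finset.sum_add_distrib]
      map_smul' := fun r c => by
        ext j
        simp [mul_assoc, Finset.mul_sum] }
  -- Orthogonality to the first `k` eigenvectors imposes `k` linear conditions on `k + 1`
  -- coefficients, so some nonzero combination satisfies them.
  have hker : LinearMap.ker L ≠ ⊥ := LinearMap.ker_ne_bot_of_finrank_lt (by simp)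
  obtain ⟨c, hc, hc0⟩ := Submodule.exists_mem_ne_zero_of_ne_bot hker
  let d : ℕ → ℝ := fun i => if hi : i < k + 1 then c ⟨i, hi⟩ else 0
  have hd : ∀ i : Fin (k + 1), d i = c i := fun i => by
    have : (i : ℕ) < k + 1 := i.2
    simp only [d, dif_pos this]
  set u := ∑ i ∈ Finset.range (k + 1), d i • x i
  have huV : u ∈ V := V.sum_mem fun i hi =>
    V.smul_mem _ (hx i (Nat.lt_succ_iff.1 (Finset.mem_range.1 hi)))
  have hJu : J u = ∑ i ∈ Finset.range (k + 1), d i • J (x i) := by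
    simp [u, map_sum]
  have horth : ∀ j < k, inner ℝ (b j) (J u) = (0 : ℝ) := by
    intro j hj
    have := congrFun (LinearMap.mem_ker.1 hc) ⟨j, hj⟩
    rw [hJu, inner_sum]
    simp_rw [inner_smul_right]
    rw [← Fin.sum_univ_eq_sum_range (fun i => d i * inner ℝ (b j) (J (x i)))]
    simp_rw [hd]
    exact this
  have hnorm : ‖J u‖ ^ 2 = ∑ i ∈ Finset.range (k + 1), d i ^ 2 := by
    rw [hJu, ← real_inner_self_eq_norm_sq, sum_inner]
    refine Finset.sum_congr rfl fun i hi => ?_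
    rw [inner_sum, Finset.sum_eq_single i]
    · have hi' := Nat.lt_succ_iff.1 (Finset.mem_range.1 hi)
      rw [inner_smul_left, inner_smul_right, hon i hi' i hi', if_pos rfl]
      simp [sq]
    · intro j hj hji
      rw [inner_smul_left, inner_smul_right, hon i (Nat.lt_succ_iff.1 (Finset.mem_range.1 hi)) j
        (Nat.lt_succ_iff.1 (Finset.mem_range.1 hj)), if_neg hji.symm]
      simp
    · exact fun h => (h hi).elim
  have h1 := h.le_norm_sq huV horth
  have h2 := hΛ d
  rw [hnorm] at h1
  have hpos : 0 < ∑ i ∈ Finset.range (k + 1), d i ^ 2 := by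
    rw [← Fin.sum_univ_eq_sum_range (fun i => d i ^ 2)]
    simp_rw [hd]
    obtain ⟨i, hi⟩ := Function.ne_iff.1 hc0
    exact Finset.sum_pos' (fun _ _ => sq_nonneg _) ⟨i, Finset.mem_univ _, by
      have : c i ≠ 0 := hi
      positivity⟩
  exact le_of_mul_le_mul_right (h1.trans h2) hpos

theorem sum_le {w : ℕ → W} (hmono : Monotone μ)
    (hw : ∀ i j, inner ℝ (w i) (w j) = if i = j then μ i else 0) (k : ℕ) (c : ℕ → ℝ) :
    ‖∑ i ∈ Finset.range (k + 1), c i • w i‖ ^ 2 ≤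
      μ k * ∑ i ∈ Finset.range (k + 1), c i ^ 2 := by
  rw [norm_sum_sq hw, Finset.mul_sum]
  refine Finset.sum_le_sum fun i hi => ?_
  have := hmono (Nat.lt_succ_iff.1 (Finset.mem_range.1 hi))
  gcongr

/-- Min-max: the first `k + 1` eigenvectors for the smaller space are admissible test vectors for
the larger one. -/
theorem le_of_le {V' : Submodule ℝ W} {b' : HilbertBasis ℕ ℝ H} {μ' : ℕ → ℝ}
    (h : IsFormBasis J V b μ) (h' : IsFormBasis J V' b' μ') (hV : V' ≤ V) (k : ℕ) :
    μ k ≤ μ' k := by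
  obtain ⟨w, hwV, hJw, -, hw⟩ := h'.exists_orthogonal
  refine h.le_of_subspace (x := w) (fun i _ => hV (hwV i)) (fun i _ j _ => ?_)
    (sum_le h'.mono hw k)
  rw [hJw, hJw, orthonormal_iff_ite.1 b'.orthonormal]

end IsFormBasis

/-- Lower semicontinuity of the eigenvalues along a decreasing family of subspaces. -/
theorem eigenvalue_le_of_forall {J : W →L[ℝ] H} (hJ : IsCompactOperator J)
    (hinj : Function.Injective J) {V₀ : Submodule ℝ W} {V : ℝ → Submodule ℝ W}
    (hVc : ∀ ε > 0, IsClosed (V ε : Set W)) (hVmono : ∀ ε ε', 0 < ε → ε ≤ ε' → V ε ≤ V ε')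
    (hinter : ∀ w, (∀ ε > 0, w ∈ V ε) → w ∈ V₀)
    {b₀ : HilbertBasis ℕ ℝ H} {μ₀ : ℕ → ℝ} (h₀ : IsFormBasis J V₀ b₀ μ₀)
    {b : ℝ → HilbertBasis ℕ ℝ H} {μ : ℝ → ℕ → ℝ} (h : ∀ ε > 0, IsFormBasis J (V ε) (b ε) (μ ε))
    {k : ℕ} {c : ℝ} (hc : ∀ ε > 0, μ ε k ≤ c) : μ₀ k ≤ c := by
  have hc0 : 0 ≤ c := ((h 1 one_pos).nonneg k).trans (hc 1 one_pos)
  let ε : ℕ → ℝ := fun m => 1 / ((m : ℝ) + 1)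
  have hε : ∀ m, 0 < ε m := fun m => by positivity
  have hεlim : Tendsto ε atTop (𝓝 0) := tendsto_one_div_add_atTop_nhds_zero_nat
  choose w hwV hJw hwin hw using fun m => (h (ε m) (hε m)).exists_orthogonal
  have hwnorm : ∀ m i, i ≤ k → ‖w m i‖ ≤ √c := by
    intro m i hi
    have := hw m i i
    rw [if_pos rfl, real_inner_self_eq_norm_sq] at this
    apply Real.le_sqrt_of_sq_le
    rw [this]
    exact ((h _ (hε m)).mono hi).trans (hc _ (hε m))
  -- The eigenvectors lie in the ball of radius `√c` of `W`, so compactness of `J` gives one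
  -- subsequence along which the first `k + 1` of them converge in `H` simultaneously.
  let K := closure (J '' Metric.closedBall 0 √c)
  have hK : IsCompact K := hJ.isCompact_closure_image_closedBall _
  have hKpi : IsCompact (Set.univ.pi fun _ : Fin (k + 1) => K) := isCompact_univ_pi fun _ => hK
  obtain ⟨y, -, φ, hφ, hlim⟩ := hKpi.tendsto_subseq
    (x := fun m (i : Fin (k + 1)) => J (w m i)) (fun m i _ => subset_closure
      ⟨w m i, by simpa using hwnorm m i (Nat.lt_succ_iff.1 i.2), rfl⟩)
  rw [tendsto_pi_nhds] at hlim
  have hex : ∀ i : ℕ, ∃ x : W, i ≤ k → Tendsto (fun m => J (w (φ m) i)) atTop (𝓝 (J x)) ∧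
      x ∈ V₀ ∧ ∀ v, Tendsto (fun m => inner ℝ (w (φ m) i) v) atTop (𝓝 (inner ℝ x v)) := by
    intro i
    by_cases hi : i ≤ k
    · have hl := hlim ⟨i, Nat.lt_succ_iff.2 hi⟩
      obtain ⟨x, hx1, -, hx3⟩ := exists_weak_limit hinj
        (u := fun m => w (φ m) i) (fun m => hwnorm (φ m) i hi) hl
      refine ⟨x, fun _ => ⟨by rw [hx1]; exact hl, hinter x fun δ hδ => ?_, hx3⟩⟩
      -- For fixed `δ` the eigenvectors eventually lie in `V δ`, which is weakly closed; so the weak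
      -- limit lies in every `V δ`, hence in `V₀`.
      have hev : ∀ᶠ m in atTop, w (φ m) i ∈ (V δ : Set W) := by
        have : ∀ᶠ m in atTop, ε (φ m) ≤ δ :=
          ((hεlim.comp hφ.tendsto_atTop).eventually (ge_mem_nhds hδ))
        exact this.mono fun m hm => hVmono _ _ (hε _) hm (hwV _ _)
      exact mem_of_weak_limit (hVc δ hδ) (V δ).convex hev hx3
    · exact ⟨0, fun hi' => (hi hi').elim⟩
  choose x hx using hex
  refine h₀.le_of_subspace (x := x) (fun i hi => (hx i hi).2.1) (fun i hi j hj => ?_) (fun d => ?_)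
  · have := (hx i hi).1.inner (hx j hj).1 (𝕜 := ℝ)
    refine tendsto_nhds_unique this ?_
    simp_rw [hJw, orthonormal_iff_ite.1 (b _).orthonormal]
    exact tendsto_const_nhds
  · set X := ∑ i ∈ Finset.range (k + 1), d i • x i
    set s := ∑ i ∈ Finset.range (k + 1), d i ^ 2
    have hs : 0 ≤ s := Finset.sum_nonneg fun _ _ => sq_nonneg _
    have ht : Tendsto (fun m => inner ℝ (∑ i ∈ Finset.range (k + 1), d i • w (φ m) i) X) atTop
        (𝓝 (inner ℝ X X)) := by
      have hX : inner ℝ X X = ∑ i ∈ Finset.range (k + 1), d i * inner ℝ (x i) X := by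
        conv_lhs => rw [show inner ℝ X X =
          inner ℝ (∑ i ∈ Finset.range (k + 1), d i • x i) X from rfl]
        rw [sum_inner]
        simp_rw [inner_smul_left]
        rfl
      rw [hX]
      simp_rw [sum_inner, inner_smul_left]
      refine tendsto_finsetSum _ fun i hi => ?_
      exact ((hx i (Nat.lt_succ_iff.1 (Finset.mem_range.1 hi))).2.2 X).const_mul _
    -- Weak lower semicontinuity of the norm: `‖X‖²` is the limit of the products of `X` with the
    -- approximating combinations, whose norms are at most `√(c * s)`.
    have hle : inner ℝ X X ≤ √(c * s) * ‖X‖ := by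
      refine le_of_tendsto' ht fun m => (real_inner_le_norm _ _).trans ?_
      gcongr
      apply Real.le_sqrt_of_sq_le
      refine (IsFormBasis.sum_le (h _ (hε _)).mono (hw (φ m)) k d).trans ?_
      gcongr
      exact hc _ (hε _)
    rw [real_inner_self_eq_norm_sq] at hle
    have hcs : 0 ≤ c * s := by positivity
    have hX : ‖X‖ ≤ √(c * s) := by
      by_contra! hcon
      have : 0 < ‖X‖ := (Real.sqrt_nonneg _).trans_lt hcon
      nlinarith
    calc ‖X‖ ^ 2 ≤ √(c * s) ^ 2 := by gcongr
      _ = c * s := Real.sq_sqrt hcs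

/-- The values increase as `ε` decreases and are bounded above by `μ₀ k`. Their supremum cannot be
less than `μ₀ k`, by `eigenvalue_le_of_forall`. -/
theorem tendsto_eigenvalue {J : W →L[ℝ] H} (hJ : IsCompactOperator J)
    (hinj : Function.Injective J) {V₀ : Submodule ℝ W} {V : ℝ → Submodule ℝ W}
    (hVc : ∀ ε > 0, IsClosed (V ε : Set W)) (hVmono : ∀ ε ε', 0 < ε → ε ≤ ε' → V ε ≤ V ε')
    (hV₀ : ∀ ε > 0, V₀ ≤ V ε) (hinter : ∀ w, (∀ ε > 0, w ∈ V ε) → w ∈ V₀)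
    {b₀ : HilbertBasis ℕ ℝ H} {μ₀ : ℕ → ℝ} (h₀ : IsFormBasis J V₀ b₀ μ₀)
    {b : ℝ → HilbertBasis ℕ ℝ H} {μ : ℝ → ℕ → ℝ} (h : ∀ ε > 0, IsFormBasis J (V ε) (b ε) (μ ε))
    (k : ℕ) : Tendsto (fun ε => μ ε k) (𝓝[>] 0) (𝓝 (μ₀ k)) := by
  refine tendsto_order.2 ⟨fun c hc => ?_, fun c hc => ?_⟩
  · have : ∃ ε > 0, c < μ ε k := by
      by_contra! hcon
      exact absurd (eigenvalue_le_of_forall hJ hinj hVc hVmono hinter h₀ h hcon) (not_le.2 hc)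
    obtain ⟨ε, hε, hlt⟩ := this
    filter_upwards [Ioc_mem_nhdsGT hε] with δ hδ
    exact hlt.trans_le ((h ε hε).le_of_le (h δ hδ.1) (hVmono _ _ hδ.1 hδ.2) k)
  · filter_upwards [self_mem_nhdsWithin] with δ hδ
    exact ((h δ hδ).le_of_le h₀ (hV₀ δ hδ) k).trans_lt hc

end Forms

end MixedSpectrum

/-! ### Form domains as completions, and their subspaces of vanishing trace. -/

namespace MixedSpectrum

set_option linter.unusedSectionVars false

section Completion

variable {H : Type*} [NormedAddCommGroup H] [InnerProductSpace ℝ H] [CompleteSpace H]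

/-! ### The form domain as a completion -/

/-- The form is only positive semidefinite on `D`, as it will be for smooth functions on `N` seen
only through `M`; passing to the completion also divides out the null vectors. The map `ι` extends
because its norm is dominated by the form. -/
theorem exists_form_completion.{u} {D : Type u} [AddCommGroup D] [Module ℝ D] (ι : D →ₗ[ℝ] H)
    (B : D → D → ℝ) (hsymm : ∀ φ ψ, B φ ψ = B ψ φ) (hpos : ∀ φ, 0 ≤ B φ φ)
    (hadd : ∀ φ φ' ψ, B (φ + φ') ψ = B φ ψ + B φ' ψ)
    (hsmul : ∀ (c : ℝ) φ ψ, B (c • φ) ψ = c * B φ ψ) :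
    ∃ (W : Type u) (_ : NormedAddCommGroup W) (_ : InnerProductSpace ℝ W) (_ : CompleteSpace W)
      (inc : D →ₗ[ℝ] W) (J : W →L[ℝ] H), DenseRange inc ∧
      (∀ φ ψ, inner ℝ (inc φ) (inc ψ) = inner ℝ (ι φ) (ι ψ) + B φ ψ) ∧
      ∀ φ, J (inc φ) = ι φ := by
  let core : PreInnerProductSpace.Core ℝ D :=
    { inner := fun φ ψ => inner ℝ (ι φ) (ι ψ) + B φ ψ
      conj_inner_symm := fun φ ψ => by
        simp only [conj_trivial]
        rw [real_inner_comm, hsymm]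
      re_inner_nonneg := fun φ => by
        simp only [RCLike.re_to_real]
        exact add_nonneg real_inner_self_nonneg (hpos φ)
      add_left := fun φ φ' ψ => by
        simp only [map_add, inner_add_left, hadd]
        ring
      smul_left := fun φ ψ c => by
        simp only [map_smul, inner_smul_left, hsmul, conj_trivial]
        ring }
  let _ : SeminormedAddCommGroup D :=
    @InnerProductSpace.Core.toSeminormedAddCommGroup ℝ D _ _ _ core
  let _ : InnerProductSpace ℝ D := InnerProductSpace.ofCore core
  have hinner : ∀ φ ψ : D, inner ℝ φ ψ = inner ℝ (ι φ) (ι ψ) + B φ ψ := fun φ ψ => rfl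
  let inc : D →ₗ[ℝ] UniformSpace.Completion D :=
    (UniformSpace.Completion.toComplL (𝕜 := ℝ) (E := D)).toLinearMap
  have hinc : ∀ φ, inc φ = (φ : UniformSpace.Completion D) := fun φ => rfl
  have hdense : DenseRange inc := UniformSpace.Completion.denseRange_coe
  have hin : ∀ φ ψ, inner ℝ (inc φ) (inc ψ) = inner ℝ (ι φ) (ι ψ) + B φ ψ := fun φ ψ => by
    rw [hinc, hinc, UniformSpace.Completion.inner_coe, hinner]
  have hnorm : ∀ φ, ‖ι φ‖ ≤ 1 * ‖inc φ‖ := fun φ => by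
    rw [one_mul]
    refine le_of_sq_le_sq ?_ (norm_nonneg _)
    rw [← real_inner_self_eq_norm_sq, ← real_inner_self_eq_norm_sq, hin]
    linarith [hpos φ]
  exact ⟨UniformSpace.Completion D, inferInstance, inferInstance, inferInstance, inc,
    ι.extendOfNorm inc, hdense, hin, fun φ => ι.extendOfNorm_eq hdense ⟨1, hnorm⟩ φ⟩

variable {D W : Type*} [AddCommGroup D] [Module ℝ D] [NormedAddCommGroup W]
  [InnerProductSpace ℝ W] [CompleteSpace W]

/-- An element of the kernel of `J` is a limit of a form-Cauchy sequence tending to zero in `H`;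
closability says exactly that such a limit is zero. -/
theorem injective_of_closable {inc : D →ₗ[ℝ] W} {J : W →L[ℝ] H} (hd : DenseRange inc)
    (hclos : ∀ φ : ℕ → D, Tendsto (fun j => J (inc (φ j))) atTop (𝓝 0) →
      CauchySeq (fun j => inc (φ j)) → Tendsto (fun j => inc (φ j)) atTop (𝓝 0)) :
    Function.Injective J := by
  rw [injective_iff_map_eq_zero]
  intro w hw
  obtain ⟨x, hx, hlim⟩ := mem_closure_iff_seq_limit.1 (hd w)
  choose φ hφ using hx
  obtain rfl : (fun j => inc (φ j)) = x := funext hφ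
  refine tendsto_nhds_unique hlim (hclos φ ?_ hlim.cauchySeq)
  rw [← hw]
  exact (J.continuous.tendsto w).comp hlim

/-- On the common kernel of the functionals `J` has norm at most `√ε`, and the orthogonal complement
of this kernel is finite-dimensional. Projecting onto the complement first, one approximates `J` in
norm by finite-rank operators. -/
theorem isCompactOperator_of_forall_list {inc : D →ₗ[ℝ] W} {J : W →L[ℝ] H} (hd : DenseRange inc)
    (h : ∀ ε > 0, ∃ l : List (D →ₗ[ℝ] ℝ), (∀ P ∈ l, ∃ C, ∀ φ, |P φ| ≤ C * ‖inc φ‖) ∧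
      ∀ φ, ‖J (inc φ)‖ ^ 2 ≤ ε * ‖inc φ‖ ^ 2 + (l.map fun P => P φ ^ 2).sum) :
    IsCompactOperator J := by
  have key : ∀ ε > 0, ∃ F : W →L[ℝ] H, IsCompactOperator F ∧ ‖J - F‖ ≤ √ε := by
    intro ε hε
    obtain ⟨l, hl, hle⟩ := h ε hε
    let Q : Fin l.length → W →L[ℝ] ℝ := fun i => (l.get i).extendOfNorm inc
    have hQ : ∀ i φ, Q i (inc φ) = l.get i φ := fun i φ =>
      LinearMap.extendOfNorm_eq hd (hl _ (l.get_mem i)) φ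
    have hle' : ∀ w, ‖J w‖ ^ 2 ≤ ε * ‖w‖ ^ 2 + ∑ i, Q i w ^ 2 := by
      intro w
      refine hd.induction_on w (isClosed_le (by fun_prop) (by fun_prop)) fun φ => ?_
      refine (hle φ).trans_eq ?_
      simp_rw [hQ]
      congr 1
      rw [← List.sum_ofFn]
      congr 1
      exact List.ext_getElem (by simp) (by simp)
    let P : W →L[ℝ] (Fin l.length → ℝ) := ContinuousLinearMap.pi Q
    let K : Submodule ℝ W := LinearMap.ker (P : W →ₗ[ℝ] (Fin l.length → ℝ))
    have hK : IsClosed (K : Set W) := P.isClosed_ker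
    have : CompleteSpace K := hK.completeSpace_coe
    have hfin : FiniteDimensional ℝ Kᗮ := by
      refine FiniteDimensional.of_injective ((P : W →ₗ[ℝ] (Fin l.length → ℝ)).comp Kᗮ.subtype) ?_
      rw [injective_iff_map_eq_zero]
      intro x hx
      have hxK : (x : W) ∈ K := hx
      have := (Submodule.mem_orthogonal _ _).1 x.2 x hxK
      exact Subtype.ext (inner_self_eq_zero.1 this)
    let F : W →L[ℝ] H := J ∘L Kᗮ.starProjection
    refine ⟨F, ?_, ?_⟩
    · have hid : IsCompactOperator (id : Kᗮ → Kᗮ) :=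
        (isCompactOperator_id_iff_finiteDimensional (𝕜 := ℝ)).2 hfin
      exact (hid.comp_clm Kᗮ.orthogonalProjectionOnto).clm_comp (J ∘L Kᗮ.subtypeL)
    · refine ContinuousLinearMap.opNorm_le_bound _ (Real.sqrt_nonneg _) fun w => ?_
      have hw : (J - F) w = J (K.starProjection w) := by
        change J w - J (Kᗮ.starProjection w) = _
        rw [← map_sub, Submodule.starProjection_orthogonal_val, sub_sub_cancel]
      have hzero : ∑ i, Q i (K.starProjection w) ^ 2 = 0 := by
        refine Finset.sum_eq_zero fun i _ => ?_
        have : P (K.starProjection w) = 0 := K.starProjection_apply_mem w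
        have := congrFun this i
        change Q i (K.starProjection w) = 0 at this
        rw [this, zero_pow two_ne_zero]
      have h1 := hle' (K.starProjection w)
      rw [hzero, add_zero] at h1
      rw [hw]
      refine le_of_sq_le_sq (h1.trans ?_) (by positivity)
      rw [mul_pow, Real.sq_sqrt hε.le]
      gcongr
      exact K.norm_starProjection_apply_le w
  choose F hF hJF using fun k : ℕ => key (1 / ((k : ℝ) + 1)) (by positivity)
  refine isCompactOperator_of_tendsto (F := F) (l := atTop) ?_ (Eventually.of_forall hF)
  rw [tendsto_iff_norm_sub_tendsto_zero]
  have h0 : Tendsto (fun k : ℕ => √(1 / ((k : ℝ) + 1))) atTop (𝓝 0) := by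
    have := (Real.continuous_sqrt.tendsto 0).comp (tendsto_one_div_add_atTop_nhds_zero_nat (𝕜 := ℝ))
    rwa [Real.sqrt_zero] at this
  exact squeeze_zero (fun _ => norm_nonneg _) (fun k => by rw [norm_sub_rev]; exact hJF k) h0

/-! ### Subspaces of vanishing trace -/

/-- The elements of `W` that are limits of elements of `D` with arbitrarily small trace
seminorm `τ`. -/
def traceKernel (inc : D →ₗ[ℝ] W) (τ : D → ℝ≥0∞) (h0 : τ 0 = 0)
    (hadd : ∀ φ ψ, τ (φ + ψ) ≤ τ φ + τ ψ) (hsmul : ∀ (c : ℝ) φ, τ (c • φ) = ‖c‖ₑ * τ φ) :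
    Submodule ℝ W where
  carrier := {w | ∀ δ : ℝ≥0∞, 0 < δ → w ∈ closure (inc '' {φ | τ φ ≤ δ})}
  zero_mem' := fun δ _ => subset_closure ⟨0, by simp [h0], map_zero _⟩
  add_mem' := by
    intro v w hv hw δ hδ
    have h := map_mem_closure₂ continuous_add (hv (δ / 2) (ENNReal.half_pos hδ.ne'))
      (hw (δ / 2) (ENNReal.half_pos hδ.ne')) (u := inc '' {φ | τ φ ≤ δ})
    refine h ?_
    rintro _ ⟨φ, hφ, rfl⟩ _ ⟨ψ, hψ, rfl⟩
    refine ⟨φ + ψ, ?_, map_add _ _ _⟩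
    exact (hadd φ ψ).trans ((add_le_add hφ hψ).trans_eq (ENNReal.add_halves δ))
  smul_mem' := by
    intro c w hw δ hδ
    by_cases hc : c = 0
    · rw [hc, zero_smul]
      exact subset_closure ⟨0, by simp [h0], map_zero _⟩
    have hc' : ‖c‖ₑ ≠ 0 := by simpa using hc
    have h := map_mem_closure (continuous_const_smul c) (hw (δ / ‖c‖ₑ)
      (ENNReal.div_pos hδ.ne' enorm_ne_top)) (t := inc '' {φ | τ φ ≤ δ})
    refine h ?_
    rintro _ ⟨φ, hφ, rfl⟩
    refine ⟨c • φ, ?_, map_smul _ _ _⟩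
    change τ (c • φ) ≤ δ
    rw [hsmul]
    refine (mul_le_mul_right hφ _).trans_eq ?_
    exact ENNReal.mul_div_cancel hc' enorm_ne_top

variable {inc : D →ₗ[ℝ] W} {τ : D → ℝ≥0∞} {h0 : τ 0 = 0}
  {hadd : ∀ φ ψ, τ (φ + ψ) ≤ τ φ + τ ψ} {hsmul : ∀ (c : ℝ) φ, τ (c • φ) = ‖c‖ₑ * τ φ}

theorem mem_traceKernel {w : W} : w ∈ traceKernel inc τ h0 hadd hsmul ↔
    ∀ δ : ℝ≥0∞, 0 < δ → w ∈ closure (inc '' {φ | τ φ ≤ δ}) := Iff.rfl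

theorem isClosed_traceKernel : IsClosed (traceKernel inc τ h0 hadd hsmul : Set W) := by
  have : (traceKernel inc τ h0 hadd hsmul : Set W) =
      ⋂ (δ : ℝ≥0∞) (_ : 0 < δ), closure (inc '' {φ | τ φ ≤ δ}) := by
    ext w
    simp [mem_traceKernel]
  rw [this]
  exact isClosed_iInter fun _ => isClosed_iInter fun _ => isClosed_closure

/-- The sublevel sets of a seminorm are convex, so the closures of their images are weakly closed.
Weak convergence in `W` is therefore enough to preserve vanishing traces. -/
theorem mem_traceKernel_of_weak_limit {φ : ℕ → D} {w : W}
    (hτ : Tendsto (fun m => τ (φ m)) atTop (𝓝 0))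
    (hw : ∀ v, Tendsto (fun m => inner ℝ (inc (φ m)) v) atTop (𝓝 (inner ℝ w v))) :
    w ∈ traceKernel inc τ h0 hadd hsmul := by
  intro δ hδ
  refine mem_of_weak_limit isClosed_closure (Convex.closure ?_)
    ((hτ.eventually (ge_mem_nhds hδ)).mono fun m hm => subset_closure ⟨φ m, hm, rfl⟩) hw
  refine Convex.linear_image (f := inc) ?_
  intro φ hφ ψ hψ a b ha hb hab
  change τ (a • φ + b • ψ) ≤ δ
  refine (hadd _ _).trans ?_
  rw [hsmul, hsmul]
  calc ‖a‖ₑ * τ φ + ‖b‖ₑ * τ ψ ≤ ‖a‖ₑ * δ + ‖b‖ₑ * δ := by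
        gcongr
        · exact hφ
        · exact hψ
    _ = δ := by
      rw [← add_mul, Real.enorm_eq_ofReal ha, Real.enorm_eq_ofReal hb, ← ENNReal.ofReal_add ha hb,
        hab, ENNReal.ofReal_one, one_mul]

theorem mem_traceKernel_of_tendsto {φ : ℕ → D} {w : W}
    (hτ : Tendsto (fun m => τ (φ m)) atTop (𝓝 0))
    (hw : Tendsto (fun m => inc (φ m)) atTop (𝓝 w)) :
    w ∈ traceKernel inc τ h0 hadd hsmul :=
  mem_traceKernel_of_weak_limit hτ fun _ => hw.inner tendsto_const_nhds

theorem exists_seq_of_mem_traceKernel {w : W} (hw : w ∈ traceKernel inc τ h0 hadd hsmul) :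
    ∃ φ : ℕ → D, Tendsto (fun m => τ (φ m)) atTop (𝓝 0) ∧
      Tendsto (fun m => inc (φ m)) atTop (𝓝 w) := by
  have : ∀ m : ℕ, ∃ φ, τ φ ≤ ENNReal.ofReal (1 / ((m : ℝ) + 1)) ∧
      dist (inc φ) w ≤ 1 / ((m : ℝ) + 1) := by
    intro m
    have hpos : (0 : ℝ) < 1 / ((m : ℝ) + 1) := by positivity
    obtain ⟨_, ⟨φ, hφ, rfl⟩, hd⟩ := Metric.mem_closure_iff.1
      (hw (ENNReal.ofReal (1 / ((m : ℝ) + 1))) (by simpa using hpos)) _ hpos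
    exact ⟨φ, hφ, by rw [dist_comm]; exact hd.le⟩
  choose φ h1 h2 using this
  have hlim := tendsto_one_div_add_atTop_nhds_zero_nat (𝕜 := ℝ)
  refine ⟨φ, ?_, ?_⟩
  · have := ENNReal.tendsto_ofReal hlim
    rw [ENNReal.ofReal_zero] at this
    exact tendsto_of_tendsto_of_tendsto_of_le_of_le tendsto_const_nhds this (fun _ => zero_le) h1
  · rw [tendsto_iff_dist_tendsto_zero]
    exact squeeze_zero (fun _ => dist_nonneg) h2 hlim

theorem traceKernel_mono {τ' : D → ℝ≥0∞} {h0' : τ' 0 = 0}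
    {hadd' : ∀ φ ψ, τ' (φ + ψ) ≤ τ' φ + τ' ψ} {hsmul' : ∀ (c : ℝ) φ, τ' (c • φ) = ‖c‖ₑ * τ' φ}
    (h : ∀ φ, τ φ ≤ τ' φ) :
    traceKernel inc τ' h0' hadd' hsmul' ≤ traceKernel inc τ h0 hadd hsmul :=
  fun _ hw δ hδ => closure_mono (image_mono fun φ hφ => (h φ).trans hφ) (hw δ hδ)

end Completion

end MixedSpectrum

/-! ### Calculus and continuity of the Riemannian gradient. -/

namespace MixedSpectrum

set_option linter.unusedSectionVars false

section Gradient

/-! ### The gradient -/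

variable {n : ℕ} {N : Type*} [EMetricSpace N]
    [ChartedSpace (EuclideanSpace ℝ (Fin n)) N] [IsManifold (𝓡 n) ∞ N]
    [RiemannianBundle (fun x : N => TangentSpace (𝓡 n) x)]
    [IsContMDiffRiemannianBundle (𝓡 n) ∞ (EuclideanSpace ℝ (Fin n))
      (fun x : N => TangentSpace (𝓡 n) x)]

theorem isContinuousRiemannianBundle : IsContinuousRiemannianBundle (EuclideanSpace ℝ (Fin n))
      (fun x : N => TangentSpace (𝓡 n) x) := by
  obtain ⟨g, hg, h⟩ := IsContMDiffRiemannianBundle.exists_contMDiff (IB := 𝓡 n) (n := ∞)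
    (F := EuclideanSpace ℝ (Fin n))
     (E := fun x : N => TangentSpace (𝓡 n) x)
  exact ⟨g, hg.continuous, h⟩
theorem inner_riemannianGradient (φ : N → ℝ) (x : N) (v : TangentSpace (𝓡 n) x) :
    inner ℝ (riemannianGradient n φ x) v = mfderiv (𝓡 n) 𝓘(ℝ, ℝ) φ x v := by
  have : FiniteDimensional ℝ (TangentSpace (𝓡 n) x) :=
    inferInstanceAs (FiniteDimensional ℝ (EuclideanSpace ℝ (Fin n)))
  have : CompleteSpace (TangentSpace (𝓡 n) x) := FiniteDimensional.complete ℝ _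
  exact InnerProductSpace.toDual_symm_apply
theorem riemannianGradient_eq_of_forall {φ : N → ℝ} {x : N} {v : TangentSpace (𝓡 n) x}
   (h : ∀ w, inner ℝ v w = mfderiv (𝓡 n) 𝓘(ℝ, ℝ) φ x w) : riemannianGradient n φ x = v := by
  refine ext_inner_right ℝ fun w => ?_
  rw [inner_riemannianGradient, h]

theorem _root_.ContMDiff.mdifferentiableAt_real {φ : N → ℝ} (hφ : ContMDiff (𝓡 n) 𝓘(ℝ, ℝ) ∞ φ)
    (x : N) : MDifferentiableAt (𝓡 n) 𝓘(ℝ, ℝ) φ x :=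
  (hφ x).mdifferentiableAt (by simp)

theorem riemannianGradient_add {φ ψ : N → ℝ} {x : N} (hφ : MDifferentiableAt (𝓡 n) 𝓘(ℝ, ℝ) φ x)
    (hψ : MDifferentiableAt (𝓡 n) 𝓘(ℝ, ℝ) ψ x) :
    riemannianGradient n (φ + ψ) x = riemannianGradient n φ x + riemannianGradient n ψ x := by
  refine riemannianGradient_eq_of_forall fun w => ?_
  rw [inner_add_left, inner_riemannianGradient, inner_riemannianGradient, mfderiv_add hφ hψ]
  rfl

theorem riemannianGradient_smul {φ : N → ℝ} {x : N} (hφ : MDifferentiableAt (𝓡 n) 𝓘(ℝ, ℝ) φ x)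
    (c : ℝ) : riemannianGradient n (c • φ) x = c • riemannianGradient n φ x := by
  refine riemannianGradient_eq_of_forall fun w => ?_
  rw [inner_smul_left, inner_riemannianGradient, const_smul_mfderiv hφ]
  rfl

theorem riemannianGradient_mul {φ ψ : N → ℝ} {x : N} (hφ : MDifferentiableAt (𝓡 n) 𝓘(ℝ, ℝ) φ x)
    (hψ : MDifferentiableAt (𝓡 n) 𝓘(ℝ, ℝ) ψ x) :
    riemannianGradient n (φ * ψ) x =
      φ x • riemannianGradient n ψ x + ψ x • riemannianGradient n φ x := by
  refine riemannianGradient_eq_of_forall fun w => ?_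
  rw [inner_add_left, inner_smul_left, inner_smul_left, inner_riemannianGradient,
    inner_riemannianGradient, (hφ.hasMFDerivAt.mul hψ.hasMFDerivAt).mfderiv]
  rfl

theorem riemannianGradient_comp {φ : N → ℝ} {h : ℝ → ℝ} {x : N}
    (hφ : MDifferentiableAt (𝓡 n) 𝓘(ℝ, ℝ) φ x) {h' : ℝ} (hh : HasDerivAt h h' (φ x)) :
    riemannianGradient n (h ∘ φ) x = h' • riemannianGradient n φ x := by
  refine riemannianGradient_eq_of_forall fun w => ?_
  rw [inner_smul_left, inner_riemannianGradient,
    (HasMFDerivAt.comp x hh.hasFDerivAt.hasMFDerivAt hφ.hasMFDerivAt).mfderiv]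
  exact mul_comm h' (show ℝ from mfderiv (𝓡 n) 𝓘(ℝ, ℝ) φ x w)

/-- In a trivialization the metric becomes a continuous family `G` of invertible maps from the model
space to its dual, and the product of the gradients is `dψ (G⁻¹ dφ)`. Inversion is continuous at
invertible maps. -/
theorem continuous_inner_riemannianGradient {φ ψ : N → ℝ} (hφ : ContMDiff (𝓡 n) 𝓘(ℝ, ℝ) ∞ φ)
    (hψ : ContMDiff (𝓡 n) 𝓘(ℝ, ℝ) ∞ ψ) :
    Continuous fun x => inner ℝ (riemannianGradient n φ x) (riemannianGradient n ψ x) := by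
  let E := EuclideanSpace ℝ (Fin n)
  rw [continuous_iff_continuousAt]
  intro x₀
  have := isContinuousRiemannianBundle (n := n) (N := N)
  obtain ⟨g, g_cont, hg⟩ := IsContinuousRiemannianBundle.exists_continuous
    (F := EuclideanSpace ℝ (Fin n)) (E := fun x : N => TangentSpace (𝓡 n) x)
  let e := trivializationAt E (TangentSpace (𝓡 n) : N → Type _) x₀
  let G : N → E →L[ℝ] E →L[ℝ] ℝ := fun y ↦
    ContinuousLinearMap.inCoordinates E (TangentSpace (𝓡 n) : N → Type _) (E →L[ℝ] ℝ)
      (fun x ↦ TangentSpace (𝓡 n) x →L[ℝ] ℝ) x₀ y x₀ y (g y)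
  have hG : ContinuousAt G x₀ := by
    have W := g_cont.continuousAt (x := x₀)
    simp only [continuousAt_hom_bundle] at W
    exact W.2
  have hGeq : ∀ y ∈ e.baseSet, ∀ v w : E, G y v w = inner ℝ (e.symmL ℝ y v) (e.symmL ℝ y w) := by
    intro y hy v w
    rw [hg]
    simp only [G]
    rw [inCoordinates_apply_eq₂ hy hy (Set.mem_univ _)]
    simp only [Trivial.fiberBundle_trivializationAt', Trivial.linearMapAt_trivialization,
      LinearMap.id_coe, id_eq]
    rw [e.symmL_apply hy, e.symmL_apply hy]
  have hx₀ : x₀ ∈ e.baseSet := FiberBundle.mem_baseSet_trivializationAt' x₀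
  let ℓ : (N → ℝ) → N → E →L[ℝ] ℝ := fun f =>
    inTangentCoordinates (𝓡 n) 𝓘(ℝ, ℝ) id f (mfderiv (𝓡 n) 𝓘(ℝ, ℝ) f) x₀
  have hℓ : ∀ f : N → ℝ, ContMDiff (𝓡 n) 𝓘(ℝ, ℝ) ∞ f → ContinuousAt (ℓ f) x₀ := fun f hf =>
    ((hf x₀).mfderiv_const (m := 0) (by simp)).continuousAt
  have hℓeq : ∀ f : N → ℝ, ∀ y ∈ e.baseSet, ∀ v : E,
      ℓ f y v = mfderiv (𝓡 n) 𝓘(ℝ, ℝ) f y (e.symmL ℝ y v) := by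
    intro f y hy v
    simp only [ℓ, inTangentCoordinates, ContinuousLinearMap.inCoordinates]
    simp [e]
    rfl
  -- Positive definiteness makes `G x₀` injective, and equality of dimensions makes it invertible.
  have hinj : Function.Injective (G x₀ : E →ₗ[ℝ] (E →L[ℝ] ℝ)) := by
    rw [injective_iff_map_eq_zero]
    intro v hv
    have h0 : G x₀ v v = 0 := by
      change (G x₀ : E →ₗ[ℝ] (E →L[ℝ] ℝ)) v v = 0
      rw [hv]
      rfl
    rw [hGeq x₀ hx₀, inner_self_eq_zero] at h0
    have := e.continuousLinearMapAt_symmL (R := ℝ) hx₀ v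
    rw [h0, map_zero] at this
    exact this.symm
  have hfr : Module.finrank ℝ E = Module.finrank ℝ (E →L[ℝ] ℝ) := by
    rw [LinearEquiv.finrank_eq (InnerProductSpace.toDual ℝ E).toLinearEquiv]
  let G₀ : E ≃L[ℝ] (E →L[ℝ] ℝ) :=
    (LinearEquiv.ofInjectiveOfFinrankEq (G x₀ : E →ₗ[ℝ] (E →L[ℝ] ℝ)) hinj
      hfr).toContinuousLinearEquiv
  have hG₀ : (G₀ : E →L[ℝ] (E →L[ℝ] ℝ)) = G x₀ := by
    ext v
    rfl
  have hev : ∀ᶠ y in 𝓝 x₀, inner ℝ (riemannianGradient n φ y) (riemannianGradient n ψ y) =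
      ℓ ψ y ((G y).inverse (ℓ φ y)) := by
    have h1 : ∀ᶠ y in 𝓝 x₀, G y ∈ range ((↑) : (E ≃L[ℝ] (E →L[ℝ] ℝ)) → (E →L[ℝ] (E →L[ℝ] ℝ))) :=
      hG.eventually (by rw [← hG₀]; exact ContinuousLinearEquiv.nhds G₀)
    filter_upwards [h1, e.open_baseSet.mem_nhds hx₀] with y ⟨Gy, hGy⟩ hy
    have hL : ∀ v, e.symmL ℝ y (e.continuousLinearMapAt ℝ y v) = v := fun v =>
      e.symmL_continuousLinearMapAt hy v
    have hinv : (G y).inverse (ℓ φ y) = e.continuousLinearMapAt ℝ y (riemannianGradient n φ y) := by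
      rw [← hGy, ContinuousLinearMap.inverse_equiv]
      change Gy.symm (ℓ φ y) = _
      rw [ContinuousLinearEquiv.symm_apply_eq]
      ext v
      rw [hℓeq φ y hy]
      change _ = (Gy : E →L[ℝ] (E →L[ℝ] ℝ)) _ v
      rw [hGy, hGeq y hy, hL, inner_riemannianGradient]
    rw [hinv, hℓeq ψ y hy, hL, real_inner_comm, inner_riemannianGradient]
  refine ContinuousAt.congr ?_ (hev.mono fun y hy => hy.symm)
  refine (hℓ ψ hψ).clm_apply (ContinuousAt.clm_apply ?_ (hℓ φ hφ))
  have h2 : ContinuousAt ContinuousLinearMap.inverse (G x₀) := by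
    rw [← hG₀]
    exact (contDiffAt_map_inverse (n := 0) G₀).continuousAt
  exact h2.comp hG

end Gradient

end MixedSpectrum

namespace MixedSpectrum

set_option linter.unusedSectionVars false

section Charts

/-! ### Charts are locally bi-Lipschitz -/

open scoped NNReal

variable {n : ℕ} {N : Type*} [EMetricSpace N]
    [ChartedSpace (EuclideanSpace ℝ (Fin n)) N] [IsManifold (𝓡 n) ∞ N]
    [RiemannianBundle (fun x : N => TangentSpace (𝓡 n) x)]
    [IsContMDiffRiemannianBundle (𝓡 n) ∞ (EuclideanSpace ℝ (Fin n))
      (fun x : N => TangentSpace (𝓡 n) x)]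

/-- The differentials of a chart and of its inverse are bounded near the base point. -/
theorem exists_bound_mfderiv_chart (x : N) : ∃ C > (0 : ℝ≥0), ∃ U ∈ 𝓝 x,
    U ⊆ (extChartAt (𝓡 n) x).source ∧
    (∀ y ∈ U, ∀ v : EuclideanSpace ℝ (Fin n), ‖(trivializationAt (EuclideanSpace ℝ (Fin n))
      (TangentSpace (𝓡 n) : N → Type _) x).symmL ℝ y v‖ₑ ≤ C * ‖v‖ₑ) ∧
    ∀ y ∈ U, ∀ v : TangentSpace (𝓡 n) y, ‖(show EuclideanSpace ℝ (Fin n) from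
      (trivializationAt (EuclideanSpace ℝ (Fin n))
      (TangentSpace (𝓡 n) : N → Type _) x).continuousLinearMapAt ℝ y v)‖ₑ ≤ C * ‖v‖ₑ := by
  have := isContinuousRiemannianBundle (n := n) (N := N)
  obtain ⟨C₁, hC₁, h₁⟩ := eventually_norm_symmL_trivializationAt_lt (EuclideanSpace ℝ (Fin n))
    (fun x : N => TangentSpace (𝓡 n) x) x
  obtain ⟨C₂, hC₂, h₂⟩ := eventually_norm_trivializationAt_lt (EuclideanSpace ℝ (Fin n))
    (fun x : N => TangentSpace (𝓡 n) x) x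
  refine ⟨(C₁ + C₂).toNNReal, by simpa using add_pos hC₁ hC₂, _,
    inter_mem (inter_mem h₁ h₂) (extChartAt_source_mem_nhds (I := 𝓡 n) x), inter_subset_right,
    fun y hy v => ?_, fun y hy v => ?_⟩
  · refine (ContinuousLinearMap.le_opENorm _ _).trans ?_
    gcongr
    rw [← enorm_norm, Real.enorm_eq_ofReal (norm_nonneg _)]
    exact ENNReal.ofReal_le_ofReal ((show _ < C₁ from hy.1.1).le.trans (by linarith))
  · refine (ContinuousLinearMap.le_opENorm _ _).trans ?_
    gcongr
    rw [← enorm_norm, Real.enorm_eq_ofReal (norm_nonneg _)]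
    exact ENNReal.ofReal_le_ofReal ((show _ < C₂ from hy.1.2).le.trans (by linarith))

theorem mfderiv_extChartAt_symm_eq {x y : N} (hy : y ∈ (extChartAt (𝓡 n) x).source)
    (v : EuclideanSpace ℝ (Fin n)) :
    mfderiv 𝓘(ℝ, EuclideanSpace ℝ (Fin n)) (𝓡 n) (extChartAt (𝓡 n) x).symm
      (extChartAt (𝓡 n) x y) v = (trivializationAt (EuclideanSpace ℝ (Fin n))
      (TangentSpace (𝓡 n) : N → Type _) x).symmL ℝ y v := by
  rw [extChartAt_source] at hy
  rw [TangentBundle.symmL_trivializationAt hy, ModelWithCorners.range_eq_univ, mfderivWithin_univ]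
  rfl

/-- The image of a straight segment under the inverse chart is a path joining the two points; its
length bounds the Riemannian distance. -/
theorem edist_extChartAt_symm_le [IsRiemannianManifold (𝓡 n) N] {x : N} {C : ℝ≥0} {U : Set N}
    (hU : U ⊆ (extChartAt (𝓡 n) x).source)
    (hC : ∀ y ∈ U, ∀ v : EuclideanSpace ℝ (Fin n), ‖(trivializationAt (EuclideanSpace ℝ (Fin n))
      (TangentSpace (𝓡 n) : N → Type _) x).symmL ℝ y v‖ₑ ≤ C * ‖v‖ₑ)
    {B : Set (EuclideanSpace ℝ (Fin n))} (hB : Convex ℝ B)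
    (hBU : ∀ y ∈ B, y ∈ (extChartAt (𝓡 n) x).target ∧ (extChartAt (𝓡 n) x).symm y ∈ U)
    {y z : EuclideanSpace ℝ (Fin n)} (hy : y ∈ B) (hz : z ∈ B) :
    edist ((extChartAt (𝓡 n) x).symm y) ((extChartAt (𝓡 n) x).symm z) ≤ C * edist y z := by
  rw [IsRiemannianManifold.out (I := 𝓡 n)]
  let η := ContinuousAffineMap.lineMap (R := ℝ) y z
  set γ := (extChartAt (𝓡 n) x).symm ∘ η
  have hη : ∀ t ∈ Icc (0 : ℝ) 1, η t ∈ B := by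
    intro t ht
    have : η t ∈ segment ℝ y z := by
      rw [segment_eq_image_lineMap]
      exact ⟨t, ht, rfl⟩
    exact hB.segment_subset hy hz this
  have η_smooth : ContMDiffOn 𝓘(ℝ, ℝ) 𝓘(ℝ, EuclideanSpace ℝ (Fin n)) 1 η (Icc 0 1) := by
    apply ContMDiff.contMDiffOn
    rw [contMDiff_iff_contDiff]
    exact ContinuousAffineMap.contDiff _
  have : Manifold.riemannianEDist (𝓡 n) ((extChartAt (𝓡 n) x).symm y) ((extChartAt (𝓡 n) x).symm z)
      ≤ pathELength (𝓡 n) γ 0 1 := by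
    apply riemannianEDist_le_pathELength _ _ _ zero_le_one
    · exact (contMDiffOn_extChartAt_symm x).comp η_smooth fun t ht => (hBU _ (hη t ht)).1
    · simp [γ, η, ContinuousAffineMap.coe_lineMap_eq]
    · simp [γ, η, ContinuousAffineMap.coe_lineMap_eq]
  apply this.trans
  rw [← lintegral_fderiv_lineMap_eq_edist, pathELength_eq_lintegral_mfderivWithin_Icc,
    ← lintegral_const_mul' _ _ ENNReal.coe_ne_top]
  apply setLIntegral_mono' measurableSet_Icc (fun t ht ↦ ?_)
  have hcomp : mfderivWithin 𝓘(ℝ, ℝ) (𝓡 n) γ (Icc 0 1) t 1 =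
      mfderivWithin 𝓘(ℝ, EuclideanSpace ℝ (Fin n)) (𝓡 n) (extChartAt (𝓡 n) x).symm (range (𝓡 n))
        (η t) (mfderivWithin 𝓘(ℝ, ℝ) 𝓘(ℝ, EuclideanSpace ℝ (Fin n)) η (Icc 0 1) t 1) := by
    have : mfderivWithin 𝓘(ℝ, ℝ) (𝓡 n) γ (Icc 0 1) t =
      (mfderivWithin 𝓘(ℝ, EuclideanSpace ℝ (Fin n)) (𝓡 n) (extChartAt (𝓡 n) x).symm (range (𝓡 n))
        (η t)) ∘L (mfderivWithin 𝓘(ℝ, ℝ) 𝓘(ℝ, EuclideanSpace ℝ (Fin n)) η (Icc 0 1) t) := by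
      apply mfderivWithin_comp
      · exact mdifferentiableWithinAt_extChartAt_symm (hBU _ (hη t ht)).1
      · exact η_smooth.mdifferentiableOn one_ne_zero t ht
      · intro s _
        simp
      · rw [uniqueMDiffWithinAt_iff_uniqueDiffWithinAt]
        exact uniqueDiffOn_Icc zero_lt_one t ht
    exact DFunLike.congr_fun this 1
  rw [hcomp]
  have hyt := hBU _ (hη t ht)
  have hinv : extChartAt (𝓡 n) x ((extChartAt (𝓡 n) x).symm (η t)) = η t :=
    (extChartAt (𝓡 n) x).right_inv hyt.1
  have key : ∀ v : EuclideanSpace ℝ (Fin n),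
      ‖mfderivWithin 𝓘(ℝ, EuclideanSpace ℝ (Fin n)) (𝓡 n) (extChartAt (𝓡 n) x).symm (range (𝓡 n))
        (η t) v‖ₑ ≤ C * ‖v‖ₑ := by
    intro v
    have h1 := mfderiv_extChartAt_symm_eq (hU hyt.2) v
    rw [hinv] at h1
    rw [ModelWithCorners.range_eq_univ, mfderivWithin_univ, h1]
    exact hC _ hyt.2 v
  refine (key _).trans ?_
  rw [mfderivWithin_eq_fderivWithin]
  rfl

theorem edist_extChartAt_le_pathELength {x : N} {C : ℝ≥0} {U : Set N}
    (hU : U ⊆ (extChartAt (𝓡 n) x).source)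
    (hC : ∀ y ∈ U, ∀ v : TangentSpace (𝓡 n) y, ‖(show EuclideanSpace ℝ (Fin n) from
      (trivializationAt (EuclideanSpace ℝ (Fin n))
      (TangentSpace (𝓡 n) : N → Type _) x).continuousLinearMapAt ℝ y v)‖ₑ ≤ C * ‖v‖ₑ)
    {γ : ℝ → N} (hγ : ContMDiff 𝓘(ℝ, ℝ) (𝓡 n) 1 γ) (hγU : ∀ t ∈ Icc (0 : ℝ) 1, γ t ∈ U) :
    edist (extChartAt (𝓡 n) x (γ 0)) (extChartAt (𝓡 n) x (γ 1)) ≤ C * pathELength (𝓡 n) γ 0 1 := by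
  let γ' := extChartAt (𝓡 n) x ∘ γ
  have hU' : U ⊆ (chartAt (EuclideanSpace ℝ (Fin n)) x).source := by
    rwa [extChartAt_source] at hU
  have hγ' : ContMDiffOn 𝓘(ℝ, ℝ) 𝓘(ℝ, EuclideanSpace ℝ (Fin n)) 1 γ' (Icc 0 1) :=
    contMDiffOn_extChartAt.comp (I' := 𝓡 n)
      (t := (chartAt (EuclideanSpace ℝ (Fin n)) x).source) hγ.contMDiffOn fun t ht => hU' (hγU t ht)
  rw [edist_comm, edist_eq_enorm_sub]
  calc ‖γ' 1 - γ' 0‖ₑ ≤ ∫⁻ t in Icc (0 : ℝ) 1, ‖derivWithin γ' (Icc 0 1) t‖ₑ := by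
        apply enorm_sub_le_lintegral_derivWithin_Icc_of_contDiffOn_Icc _ zero_le_one
        rwa [← contMDiffOn_iff_contDiffOn]
    _ ≤ ∫⁻ t in Icc (0 : ℝ) 1, C * ‖mfderivWithin 𝓘(ℝ, ℝ) (𝓡 n) γ (Icc 0 1) t 1‖ₑ := by
        apply setLIntegral_mono' measurableSet_Icc fun t ht => ?_
        have h1 : derivWithin γ' (Icc 0 1) t =
            mfderivWithin 𝓘(ℝ, ℝ) 𝓘(ℝ, EuclideanSpace ℝ (Fin n)) γ' (Icc 0 1) t 1 := by
          rw [mfderivWithin_eq_fderivWithin, ← fderivWithin_derivWithin]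
          rfl
        have h2 : mfderivWithin 𝓘(ℝ, ℝ) 𝓘(ℝ, EuclideanSpace ℝ (Fin n)) γ' (Icc 0 1) t =
            (mfderiv (𝓡 n) 𝓘(ℝ, EuclideanSpace ℝ (Fin n)) (extChartAt (𝓡 n) x) (γ t)) ∘L
              (mfderivWithin 𝓘(ℝ, ℝ) (𝓡 n) γ (Icc 0 1) t) := by
          apply mfderiv_comp_mfderivWithin
          · exact mdifferentiableAt_extChartAt (hU' (hγU t ht))
          · exact (hγ.mdifferentiable one_ne_zero).mdifferentiableOn _ ht
          · rw [uniqueMDiffWithinAt_iff_uniqueDiffWithinAt]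
            exact uniqueDiffOn_Icc zero_lt_one t ht
        rw [h1, h2, ← TangentBundle.continuousLinearMapAt_trivializationAt (hU' (hγU t ht))]
        exact hC _ (hγU t ht) _
    _ = C * pathELength (𝓡 n) γ 0 1 := by
        rw [lintegral_const_mul' _ _ ENNReal.coe_ne_top, pathELength_eq_lintegral_mfderivWithin_Icc]

/-- The derivative bound controls only paths that stay in `U`. A path of length less than `2ρ`
starting in the ball of radius `ρ` stays within `3ρ` of the centre, hence in `U`, so almost shortest
paths may be used. -/
theorem exists_nhds_edist_extChartAt_le [IsRiemannianManifold (𝓡 n) N] {x : N} {C : ℝ≥0}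
    (hC0 : 0 < C) {U : Set N} (hUx : U ∈ 𝓝 x)
    (hU : U ⊆ (extChartAt (𝓡 n) x).source)
    (hC : ∀ y ∈ U, ∀ v : TangentSpace (𝓡 n) y, ‖(show EuclideanSpace ℝ (Fin n) from
      (trivializationAt (EuclideanSpace ℝ (Fin n))
      (TangentSpace (𝓡 n) : N → Type _) x).continuousLinearMapAt ℝ y v)‖ₑ ≤ C * ‖v‖ₑ) :
    ∃ V ∈ 𝓝 x, V ⊆ U ∧ ∀ y ∈ V, ∀ z ∈ V,
      edist (extChartAt (𝓡 n) x y) (extChartAt (𝓡 n) x z) ≤ C * edist y z := by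
  obtain ⟨R, hR, hRU⟩ := Metric.nhds_basis_eball.mem_iff.1 hUx
  obtain ⟨ρ, hρ0, hρR⟩ : ∃ ρ > (0 : ℝ≥0∞), 3 * ρ ≤ R :=
    ⟨R / 3, ENNReal.div_pos hR.ne' (by simp), ENNReal.mul_div_le⟩
  have hsub : Metric.eball x ρ ⊆ U := fun y hy => hRU <| by
    rw [Metric.mem_eball] at hy ⊢
    refine hy.trans_le (le_trans ?_ hρR)
    calc ρ = 1 * ρ := (one_mul _).symm
      _ ≤ 3 * ρ := by gcongr; norm_num
  refine ⟨Metric.eball x ρ, Metric.eball_mem_nhds _ hρ0, hsub, fun y hy z hz => ?_⟩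
  rw [Metric.mem_eball] at hy hz
  have hyz : edist y z < 2 * ρ := by
    refine (edist_triangle_right y z x).trans_lt ?_
    rw [two_mul]
    exact ENNReal.add_lt_add hy hz
  by_contra! hcon
  set L := edist (extChartAt (𝓡 n) x y) (extChartAt (𝓡 n) x z)
  have h1 : edist y z < L / C := by
    rw [ENNReal.lt_div_iff_mul_lt (Or.inl (by exact_mod_cast hC0.ne'))
      (Or.inl ENNReal.coe_ne_top), mul_comm]
    exact hcon
  have h2 : edist y z < min (L / C) (2 * ρ) := lt_min h1 hyz
  rw [IsRiemannianManifold.out (I := 𝓡 n)] at h2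
  obtain ⟨γ, hγ0, hγ1, hγ, hlen, -⟩ :=
    exists_lt_locally_constant_of_riemannianEDist_lt h2 zero_lt_one
  have hγU : ∀ t ∈ Icc (0 : ℝ) 1, γ t ∈ U := by
    intro t ht
    apply hRU
    rw [Metric.mem_eball]
    have h3 : edist y (γ t) ≤ pathELength (𝓡 n) γ 0 1 := by
      rw [IsRiemannianManifold.out (I := 𝓡 n)]
      exact (riemannianEDist_le_pathELength hγ.contMDiffOn hγ0 rfl ht.1).trans
        (pathELength_mono le_rfl ht.2)
    calc edist (γ t) x ≤ edist (γ t) y + edist y x := edist_triangle _ _ _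
      _ < 2 * ρ + ρ := by
          rw [edist_comm (γ t)]
          exact ENNReal.add_lt_add (h3.trans_lt (hlen.trans_le (min_le_right _ _))) hy
      _ = 3 * ρ := by ring
      _ ≤ R := hρR
  have h4 := edist_extChartAt_le_pathELength hU hC hγ hγU
  rw [hγ0, hγ1] at h4
  have h5 := hlen.trans_le (min_le_left _ _)
  rw [ENNReal.lt_div_iff_mul_lt (Or.inl (by exact_mod_cast hC0.ne'))
      (Or.inl ENNReal.coe_ne_top), mul_comm] at h5
  exact absurd h4 (not_le.2 h5)

theorem fderiv_comp_extChartAt_symm {x y : N} (hy : y ∈ (extChartAt (𝓡 n) x).source) {φ : N → ℝ}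
    (hφ : ContMDiff (𝓡 n) 𝓘(ℝ, ℝ) ∞ φ) (v : EuclideanSpace ℝ (Fin n)) :
    fderiv ℝ (φ ∘ (extChartAt (𝓡 n) x).symm) (extChartAt (𝓡 n) x y) v =
      inner ℝ (riemannianGradient n φ y) ((trivializationAt (EuclideanSpace ℝ (Fin n))
      (TangentSpace (𝓡 n) : N → Type _) x).symmL ℝ y v) := by
  have hinv : (extChartAt (𝓡 n) x).symm (extChartAt (𝓡 n) x y) = y :=
    (extChartAt (𝓡 n) x).left_inv hy
  have ht : extChartAt (𝓡 n) x y ∈ (extChartAt (𝓡 n) x).target := (extChartAt (𝓡 n) x).map_source hy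
  have hs : MDifferentiableAt 𝓘(ℝ, EuclideanSpace ℝ (Fin n)) (𝓡 n) (extChartAt (𝓡 n) x).symm
      (extChartAt (𝓡 n) x y) := by
    have := mdifferentiableWithinAt_extChartAt_symm ht
    rwa [ModelWithCorners.range_eq_univ, mdifferentiableWithinAt_univ] at this
  have hc := mfderiv_comp (extChartAt (𝓡 n) x y) (hφ.mdifferentiableAt_real (n := n) _) hs
  rw [inner_riemannianGradient, ← mfderiv_extChartAt_symm_eq hy, ← mfderiv_eq_fderiv, hc]
  change mfderiv _ _ _ _ _ = _
  rw [hinv]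
  rfl

/-- Near each point, the chart is bi-Lipschitz, and the norm of the gradient of a function is
comparable to that of the derivative of the function read in the chart. -/
theorem exists_chart_bounds [IsRiemannianManifold (𝓡 n) N] (x : N) : ∃ C : ℝ≥0, ∃ r > 0,
    Metric.ball (extChartAt (𝓡 n) x x) r ⊆ (extChartAt (𝓡 n) x).target ∧
    (∀ y ∈ Metric.ball (extChartAt (𝓡 n) x x) r, ∀ z ∈ Metric.ball (extChartAt (𝓡 n) x x) r,
      edist ((extChartAt (𝓡 n) x).symm y) ((extChartAt (𝓡 n) x).symm z) ≤ C * edist y z ∧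
      edist y z ≤ C * edist ((extChartAt (𝓡 n) x).symm y) ((extChartAt (𝓡 n) x).symm z)) ∧
    ∀ φ : N → ℝ, ContMDiff (𝓡 n) 𝓘(ℝ, ℝ) ∞ φ → ∀ y ∈ Metric.ball (extChartAt (𝓡 n) x x) r,
      ‖fderiv ℝ (φ ∘ (extChartAt (𝓡 n) x).symm) y‖ ≤
        C * ‖riemannianGradient n φ ((extChartAt (𝓡 n) x).symm y)‖ ∧
      ‖riemannianGradient n φ ((extChartAt (𝓡 n) x).symm y)‖ ≤
        C * ‖fderiv ℝ (φ ∘ (extChartAt (𝓡 n) x).symm) y‖ := by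
  obtain ⟨C, hC0, U, hUx, hU, h₁, h₂⟩ := exists_bound_mfderiv_chart (n := n) x
  obtain ⟨V, hVx, hVU, hV⟩ := exists_nhds_edist_extChartAt_le hC0 hUx hU h₂
  obtain ⟨r, hr, hball⟩ : ∃ r > 0, Metric.ball (extChartAt (𝓡 n) x x) r ⊆
      (extChartAt (𝓡 n) x).target ∩ (extChartAt (𝓡 n) x).symm ⁻¹' V :=
    Metric.mem_nhds_iff.1 (inter_mem (extChartAt_target_mem_nhds x)
      (extChartAt_preimage_mem_nhds hVx))
  have hinv : ∀ y ∈ Metric.ball (extChartAt (𝓡 n) x x) r,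
      extChartAt (𝓡 n) x ((extChartAt (𝓡 n) x).symm y) = y := fun y hy =>
    (extChartAt (𝓡 n) x).right_inv (hball hy).1
  refine ⟨C, r, hr, fun y hy => (hball hy).1, fun y hy z hz => ⟨?_, ?_⟩, fun φ hφ y hy => ⟨?_, ?_⟩⟩
  · exact edist_extChartAt_symm_le hU h₁ (convex_ball _ r)
      (fun y hy => ⟨(hball hy).1, hVU (hball hy).2⟩) hy hz
  · have := hV _ (hball hy).2 _ (hball hz).2
    rwa [hinv y hy, hinv z hz] at this
  · have hyU := hVU (hball hy).2
    refine ContinuousLinearMap.opNorm_le_bound _ (by positivity) fun v => ?_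
    have h := fderiv_comp_extChartAt_symm (hU hyU) hφ v
    rw [hinv y hy] at h
    rw [h]
    refine (norm_inner_le_norm _ _).trans ?_
    rw [mul_comm (C : ℝ), mul_assoc]
    gcongr
    have := h₁ _ hyU v
    simp only [enorm, ← ENNReal.coe_mul, ENNReal.coe_le_coe] at this
    exact_mod_cast this
  · have hyU := hVU (hball hy).2
    set G := riemannianGradient n φ ((extChartAt (𝓡 n) x).symm y)
    set e := trivializationAt (EuclideanSpace ℝ (Fin n)) (TangentSpace (𝓡 n) : N → Type _) x
    have hbase : (extChartAt (𝓡 n) x).symm y ∈ e.baseSet := by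
      have := hU hyU
      rwa [extChartAt_source] at this
    -- The gradient itself, read in the chart, is the test vector: on it the derivative takes the
    -- value `‖G‖²`.
    let v : EuclideanSpace ℝ (Fin n) := e.continuousLinearMapAt ℝ _ G
    have h := fderiv_comp_extChartAt_symm (hU hyU) hφ v
    rw [hinv y hy, e.symmL_continuousLinearMapAt hbase] at h
    change _ = inner ℝ G G at h
    rw [real_inner_self_eq_norm_sq] at h
    have h3 : ‖v‖ ≤ C * ‖G‖ := by
      have := h₂ _ hyU G
      simp only [enorm, ← ENNReal.coe_mul, ENNReal.coe_le_coe] at this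
      exact_mod_cast this
    have h4 : ‖G‖ ^ 2 ≤ ‖fderiv ℝ (φ ∘ (extChartAt (𝓡 n) x).symm) y‖ * (C * ‖G‖) := by
      rw [← h]
      refine (le_abs_self _).trans ?_
      exact ((fderiv ℝ (φ ∘ (extChartAt (𝓡 n) x).symm) y).le_opNorm v).trans (by gcongr)
    by_cases hG : ‖G‖ = 0
    · rw [hG]
      positivity
    · have : 0 < ‖G‖ := lt_of_le_of_ne (norm_nonneg _) (Ne.symm hG)
      nlinarith

end Charts

end MixedSpectrum

namespace MixedSpectrum

set_option linter.unusedSectionVars false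

/-! ### Lipschitz maps and differences along segments -/

section Segments

open scoped NNReal

variable {E F : Type*} [NormedAddCommGroup E] [NormedSpace ℝ E] [NormedAddCommGroup F]
  [NormedSpace ℝ F]

theorem segment_point_mem {B : Set E} (hB : Convex ℝ B) {y z : E} (hy : y ∈ B) (hz : z ∈ B)
    {t : ℝ} (ht : t ∈ Icc (0 : ℝ) 1) : y + t • (z - y) ∈ B :=
  hB.add_smul_sub_mem hy hz ht

/-- A continuous map which at each point takes the value of one of finitely many `L`-Lipschitz
maps is `L`-Lipschitz. -/
theorem lipschitzOnWith_of_forall_exists_eq {B : Set E} (hB : Convex ℝ B) {f : E → F}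
    (hf : ContinuousOn f B) {m : ℕ} {G : Fin m → E → F} {L : ℝ≥0}
    (hG : ∀ i, LipschitzOnWith L (G i) B) (hfG : ∀ y ∈ B, ∃ i, f y = G i y) :
    LipschitzOnWith L f B := by
  refine LipschitzOnWith.of_dist_le_mul fun y hy z hz => ?_
  set γ : ℝ → E := fun t => y + t • (z - y)
  have hγ : ∀ t ∈ Icc (0 : ℝ) 1, γ t ∈ B := fun t ht => segment_point_mem hB hy hz ht
  have hγc : Continuous γ := by fun_prop
  have hγd : ∀ s t, dist (γ s) (γ t) = |s - t| * dist y z := by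
    intro s t
    simp only [γ, dist_eq_norm, add_sub_add_left_eq_sub, ← sub_smul, norm_smul, Real.norm_eq_abs]
    rw [norm_sub_rev y z]
  have hh : ContinuousOn (fun t => f (γ t)) (Icc 0 1) := hf.comp hγc.continuousOn hγ
  have key := image_le_of_liminf_slope_right_le_deriv_boundary (a := 0) (b := 1)
    (f := fun t => dist (f (γ t)) (f (γ 0))) (B := fun t => L * dist y z * t)
    (B' := fun _ => L * dist y z) (continuous_dist.comp_continuousOn (hh.prodMk continuousOn_const))
    (by simp) (by fun_prop)
    (fun t _ => by simpa using ((hasDerivAt_id t).const_mul (L * dist y z)).hasDerivWithinAt) ?_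
    (right_mem_Icc.2 zero_le_one)
  · have h0 : γ 0 = y := by simp [γ]
    have h1 : γ 1 = z := by simp [γ]
    rw [h0, h1, mul_one, dist_comm] at key
    exact key
  · intro t ht r hr
    have hmem : ∀ᶠ s in 𝓝[>] t, s ∈ Ioo t 1 := Ioo_mem_nhdsGT ht.2
    -- By pigeonhole one index `i` serves points arbitrarily close to `t` on the right and, by
    -- continuity, also `t`. This bounds the lower right Dini derivative, which is all the
    -- comparison theorem requires.
    obtain ⟨i, hi⟩ : ∃ i, ∃ᶠ s in 𝓝[>] t, f (γ s) = G i (γ s) := by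
      by_contra! hcon
      have hall : ∀ᶠ s in 𝓝[>] t, ∀ i, ¬ f (γ s) = G i (γ s) := eventually_all.2 hcon
      obtain ⟨s, hs, hs1⟩ := (hall.and hmem).exists
      obtain ⟨i, hi⟩ := hfG _ (hγ s ⟨ht.1.trans hs1.1.le, hs1.2.le⟩)
      exact hs i hi
    have htI : t ∈ Icc (0 : ℝ) 1 := Ico_subset_Icc_self ht
    have hle : 𝓝[>] t ≤ 𝓝[Icc 0 1] t := by
      rw [← nhdsWithin_Ioo_eq_nhdsGT ht.2]
      exact nhdsWithin_mono _ fun s hs => ⟨ht.1.trans hs.1.le, hs.2.le⟩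
    have hit : f (γ t) = G i (γ t) := by
      have l1 : Tendsto (fun s => f (γ s)) (𝓝[>] t) (𝓝 (f (γ t))) := (hh t htI).mono_left hle
      have l2 : Tendsto (fun s => G i (γ s)) (𝓝[>] t) (𝓝 (G i (γ t))) :=
        (((hG i).continuousOn.comp hγc.continuousOn hγ) t htI).mono_left hle
      exact tendsto_nhds_unique_of_frequently_eq l1 l2 hi
    refine (hi.and_eventually hmem).mono fun s hs => lt_of_le_of_lt ?_ hr
    have hpos : 0 < s - t := sub_pos.2 hs.2.1
    rw [slope_def_field, div_le_iff₀ hpos]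
    have h1 := dist_triangle (f (γ s)) (f (γ t)) (f (γ 0))
    have h2 : dist (f (γ s)) (f (γ t)) ≤ L * dist (γ s) (γ t) := by
      rw [hs.1, hit]
      exact (hG i).dist_le_mul _ (hγ s ⟨ht.1.trans hs.2.1.le, hs.2.2.le⟩) _ (hγ t htI)
    rw [hγd, abs_of_pos hpos] at h2
    linarith [h2, h1]

theorem PiecewiseSmoothOn.exists_lipschitzOnWith {n : ℕ}
    {f : EuclideanSpace ℝ (Fin n) → EuclideanSpace ℝ (Fin n)} {U : Set (EuclideanSpace ℝ (Fin n))}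
    (hf : PiecewiseSmoothOn f U) (hU : IsOpen U) {x : EuclideanSpace ℝ (Fin n)} (hx : x ∈ U) :
    ∃ L : ℝ≥0, ∃ r > 0, LipschitzOnWith L f (Metric.ball x r) := by
  obtain ⟨hc, m, G, hG, hfG⟩ := hf
  have h1 : ∀ i, ∃ K : ℝ≥0, ∃ t ∈ 𝓝 x, LipschitzOnWith K (G i) t := fun i =>
    (((hG i).contDiffAt (hU.mem_nhds hx)).of_le (by exact_mod_cast le_top)).exists_lipschitzOnWith
  choose K t ht hK using h1
  obtain ⟨r, hr, hball⟩ := Metric.mem_nhds_iff.1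
    (inter_mem (hU.mem_nhds hx) ((iInter_mem (s := t)).2 ht))
  refine ⟨∑ i, K i, r, hr, lipschitzOnWith_of_forall_exists_eq (convex_ball _ _)
    (hc.mono fun y hy => (hball hy).1) (G := G) (fun i => ?_) fun y hy => hfG y (hball hy).1⟩
  exact ((hK i).mono fun y hy => mem_iInter.1 (hball hy).2 i).weaken
    (Finset.single_le_sum (f := K) (fun _ _ => zero_le) (Finset.mem_univ i))

/-- The difference of the values of a function at two points, bounded by the integral of the
derivative along the image of the segment under a Lipschitz map. -/
theorem abs_sub_le_integral_norm_fderiv {U : Set F} (hU : IsOpen U) {f : F → ℝ}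
    (hf : ContDiffOn ℝ 1 f U) {B : Set E} (hB : Convex ℝ B) {ψ : E → F} {L : ℝ≥0}
    (hψ : LipschitzOnWith L ψ B) (hψU : MapsTo ψ B U) {y z : E} (hy : y ∈ B) (hz : z ∈ B) :
    |f (ψ y) - f (ψ z)| ≤
      L * ‖y - z‖ * ∫ t in (0 : ℝ)..1, ‖fderiv ℝ f (ψ (y + t • (z - y)))‖ := by
  set γ : ℝ → E := fun t => y + t • (z - y)
  have hγ : ∀ t ∈ Icc (0 : ℝ) 1, γ t ∈ B := fun t ht => segment_point_mem hB hy hz ht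
  have hγc : Continuous γ := by fun_prop
  have hγd : ∀ s t, dist (γ s) (γ t) = |s - t| * ‖y - z‖ := by
    intro s t
    simp only [γ, dist_eq_norm, add_sub_add_left_eq_sub, ← sub_smul, norm_smul, Real.norm_eq_abs]
    rw [norm_sub_rev y z]
  set g : ℝ → ℝ := fun t => ‖fderiv ℝ f (ψ (γ t))‖
  have hfd : ContinuousOn (fderiv ℝ f) U := hf.continuousOn_fderiv_of_isOpen hU le_rfl
  have hg : ContinuousOn g (Icc 0 1) :=
    ((hfd.comp hψ.continuousOn hψU).comp hγc.continuousOn hγ).norm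
  -- Extending `g` constantly beyond the interval makes the primitive differentiable everywhere,
  -- including the endpoints.
  set g' : ℝ → ℝ := IccExtend zero_le_one ((Icc (0 : ℝ) 1).domRestrict g)
  have hg' : Continuous g' := (continuousOn_iff_continuous_domRestrict.1 hg).Icc_extend'
  have hgg : ∀ t ∈ Icc (0 : ℝ) 1, g' t = g t := fun t ht => IccExtend_of_mem _ _ ht
  have hint : ∫ t in (0 : ℝ)..1, g t = ∫ t in (0 : ℝ)..1, g' t := by
    refine intervalIntegral.integral_congr fun t ht => (hgg t ?_).symm
    rwa [uIcc_of_le zero_le_one] at ht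
  -- The map `ψ` is only Lipschitz, so there is no chain rule along the path; a bound on difference
  -- quotients from the right replaces it.
  have key := image_le_of_liminf_slope_right_le_deriv_boundary (a := 0) (b := 1)
    (f := fun t => |f (ψ (γ t)) - f (ψ (γ 0))|)
    (B := fun t => L * ‖y - z‖ * ∫ s in (0 : ℝ)..t, g' s)
    (B' := fun t => L * ‖y - z‖ * g' t) ?_ (by simp) ?_ (fun t _ => ?_) ?_
    (right_mem_Icc.2 zero_le_one)
  · have h0 : γ 0 = y := by simp [γ]
    have h1 : γ 1 = z := by simp [γ]
    rw [h0, h1, abs_sub_comm] at key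
    rwa [hint]
  · exact (((hf.continuousOn.comp hψ.continuousOn hψU).comp hγc.continuousOn hγ).sub
      continuousOn_const).abs
  · exact (continuous_const.mul (intervalIntegral.continuous_primitive
      (fun a b => hg'.intervalIntegrable a b) 0)).continuousOn
  · exact ((hg'.integral_hasStrictDerivAt 0 t).hasDerivAt.const_mul _).hasDerivWithinAt
  · intro t ht r hr
    have htI : t ∈ Icc (0 : ℝ) 1 := Ico_subset_Icc_self ht
    rw [hgg t htI] at hr
    have hmem : ∀ᶠ s in 𝓝[>] t, s ∈ Ioo t 1 := Ioo_mem_nhdsGT ht.2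
    have hle : 𝓝[>] t ≤ 𝓝[Icc 0 1] t := by
      rw [← nhdsWithin_Ioo_eq_nhdsGT ht.2]
      exact nhdsWithin_mono _ fun s hs => ⟨ht.1.trans hs.1.le, hs.2.le⟩
    obtain ⟨c, hc0, hcr⟩ : ∃ c > 0, L * ‖y - z‖ * (g t + c) < r := by
      have : Tendsto (fun c : ℝ => L * ‖y - z‖ * (g t + c)) (𝓝[>] 0)
          (𝓝 (L * ‖y - z‖ * (g t + 0))) :=
        ((continuous_const.mul (continuous_const.add continuous_id)).tendsto 0).mono_left
          nhdsWithin_le_nhds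
      rw [add_zero] at this
      obtain ⟨c, h1, h2⟩ := ((this.eventually (gt_mem_nhds hr)).and self_mem_nhdsWithin).exists
      exact ⟨c, h2, h1⟩
    have hd : HasFDerivAt f (fderiv ℝ f (ψ (γ t))) (ψ (γ t)) :=
      ((hf.differentiableOn one_ne_zero).differentiableAt
        (hU.mem_nhds (hψU (hγ t htI)))).hasFDerivAt
    have hcont : Tendsto (fun s => ψ (γ s)) (𝓝[>] t) (𝓝 (ψ (γ t))) :=
      ((hψ.continuousOn.comp hγc.continuousOn hγ) t htI).mono_left hle
    have hlo := hcont.eventually (hd.isLittleO.def hc0)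
    refine (hlo.and hmem).frequently.mono fun s hs => lt_of_le_of_lt ?_ hcr
    obtain ⟨hs, hs1⟩ := hs
    have hpos : 0 < s - t := sub_pos.2 hs1.1
    have hsI : s ∈ Icc (0 : ℝ) 1 := ⟨ht.1.trans hs1.1.le, hs1.2.le⟩
    rw [slope_def_field, div_le_iff₀ hpos]
    have h1 : |f (ψ (γ s)) - f (ψ (γ 0))| ≤ |f (ψ (γ s)) - f (ψ (γ t))| +
      |f (ψ (γ t)) - f (ψ (γ 0))| := abs_sub_le _ _ _
    have h2 : dist (ψ (γ s)) (ψ (γ t)) ≤ L * dist (γ s) (γ t) :=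
      hψ.dist_le_mul _ (hγ s hsI) _ (hγ t htI)
    rw [hγd, abs_of_pos hpos, dist_eq_norm] at h2
    have h3 : |f (ψ (γ s)) - f (ψ (γ t))| ≤ (g t + c) * ‖ψ (γ s) - ψ (γ t)‖ := by
      have h4 := (fderiv ℝ f (ψ (γ t))).le_opNorm (ψ (γ s) - ψ (γ t))
      have h5 := norm_add_le (f (ψ (γ s)) - f (ψ (γ t)) - fderiv ℝ f (ψ (γ t)) (ψ (γ s) - ψ (γ t)))
        (fderiv ℝ f (ψ (γ t)) (ψ (γ s) - ψ (γ t)))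
      rw [sub_add_cancel, Real.norm_eq_abs (f _ - f _)] at h5
      linarith
    have h6 : (g t + c) * ‖ψ (γ s) - ψ (γ t)‖ ≤ (g t + c) * (L * ((s - t) * ‖y - z‖)) := by
      have : 0 ≤ g t := norm_nonneg _
      gcongr
    linarith

end Segments

/-! ### Lipschitz maps and the Euclidean Hausdorff measure -/

section HausdorffMeasure

open scoped NNReal

variable {X Y : Type*} [EMetricSpace X] [MeasurableSpace X] [BorelSpace X] [EMetricSpace Y]
  [MeasurableSpace Y] [BorelSpace Y]

theorem euclideanHausdorffMeasure_image_le {f : X → Y} {S : Set X} {C : ℝ≥0}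
    (hf : LipschitzOnWith C f S) (n : ℕ) :
    (μHE[n] : Measure Y) (f '' S) ≤ (C : ℝ≥0∞) ^ n * (μHE[n] : Measure X) S := by
  have h := hf.hausdorffMeasure_image_le (Nat.cast_nonneg (α := ℝ) n)
  rw [Measure.euclideanHausdorffMeasure_def, Measure.euclideanHausdorffMeasure_def]
  simp only [Measure.smul_apply]
  rw [ENNReal.rpow_natCast] at h
  rw [ENNReal.smul_def, ENNReal.smul_def, smul_eq_mul, smul_eq_mul, mul_left_comm]
  gcongr

theorem euclideanHausdorffMeasure_le_image {f : X → Y} {S : Set X} {C : ℝ≥0}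
    (hf : ∀ y ∈ S, ∀ z ∈ S, edist y z ≤ C * edist (f y) (f z)) (n : ℕ) :
    (μHE[n] : Measure X) S ≤ (C : ℝ≥0∞) ^ n * (μHE[n] : Measure Y) (f '' S) := by
  have hinj : InjOn f S := fun y hy z hz hyz => by
    have := hf y hy z hz
    rw [hyz, edist_self, mul_zero] at this
    exact edist_eq_zero.1 (le_antisymm this zero_le)
  rcases isEmpty_or_nonempty X with hX | hX
  · simp [eq_empty_of_isEmpty S]
  have hg : LipschitzOnWith C (Function.invFunOn f S) (f '' S) := by
    rintro _ ⟨y, hy, rfl⟩ _ ⟨z, hz, rfl⟩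
    rw [hinj.leftInvOn_invFunOn hy, hinj.leftInvOn_invFunOn hz]
    exact hf y hy z hz
  have := euclideanHausdorffMeasure_image_le hg n
  rwa [hinj.invFunOn_image le_rfl] at this

end HausdorffMeasure

end MixedSpectrum

/-! ### Bi-Lipschitz patches covering `M`, and the volume in them. -/

namespace MixedSpectrum

set_option linter.unusedSectionVars false

section Patches

open scoped NNReal

variable {n : ℕ} {N : Type*} [EMetricSpace N]
    [ChartedSpace (EuclideanSpace ℝ (Fin n)) N] [IsManifold (𝓡 n) ∞ N]
    [RiemannianBundle (fun x : N => TangentSpace (𝓡 n) x)]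
    [IsContMDiffRiemannianBundle (𝓡 n) ∞ (EuclideanSpace ℝ (Fin n))
      (fun x : N => TangentSpace (𝓡 n) x)]

/-! ### Patches -/

variable (n) in
/-- A patch of `M` is a bi-Lipschitz parametrisation `θ` of a part of `M` by a bounded convex set
`B`, along which differences of smooth functions are controlled by their gradients. -/
structure IsPatch (M : Set N) (θ : EuclideanSpace ℝ (Fin n) → N)
    (B : Set (EuclideanSpace ℝ (Fin n))) (C : ℝ≥0) : Prop where
  convex : Convex ℝ B
  isBounded : Bornology.IsBounded B
  measurableSet : MeasurableSet B
  mapsTo : MapsTo θ B M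
  lipschitz : LipschitzOnWith C θ B
  edist_le : ∀ y ∈ B, ∀ z ∈ B, edist y z ≤ C * edist (θ y) (θ z)
  abs_sub_le : ∀ φ : N → ℝ, ContMDiff (𝓡 n) 𝓘(ℝ, ℝ) ∞ φ → ∀ y ∈ B, ∀ z ∈ B,
    |φ (θ y) - φ (θ z)| ≤
      C * ‖y - z‖ * ∫ t in (0 : ℝ)..1, ‖riemannianGradient n φ (θ (y + t • (z - y)))‖

theorem continuous_norm_riemannianGradient {φ : N → ℝ} (hφ : ContMDiff (𝓡 n) 𝓘(ℝ, ℝ) ∞ φ) :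
    Continuous fun x => ‖riemannianGradient n φ x‖ := by
  have h : (fun x => ‖riemannianGradient n φ x‖) =
      fun x => √(inner ℝ (riemannianGradient n φ x) (riemannianGradient n φ x)) := by
    funext x
    rw [real_inner_self_eq_norm_sq, Real.sqrt_sq (norm_nonneg _)]
  rw [h]
  exact (continuous_inner_riemannianGradient hφ hφ).sqrt

theorem contDiffOn_comp_extChartAt_symm {φ : N → ℝ} (hφ : ContMDiff (𝓡 n) 𝓘(ℝ, ℝ) ∞ φ) (x : N) :
    ContDiffOn ℝ ∞ (φ ∘ (extChartAt (𝓡 n) x).symm) (extChartAt (𝓡 n) x).target := by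
  rw [← contMDiffOn_iff_contDiffOn]
  exact hφ.comp_contMDiffOn (contMDiffOn_extChartAt_symm x)

/-- A patch is a Lipschitz straightening map `ψ` followed by the inverse of a smooth chart.
Bi-Lipschitz constants multiply, and the upper gradient estimate combines the path estimate for `ψ`
with the gradient comparison in the chart. -/
theorem isPatch_of_chart {M : Set N} {x : N} {C : ℝ≥0} {U : Set (EuclideanSpace ℝ (Fin n))}
    (hUo : IsOpen U) (hU : U ⊆ (extChartAt (𝓡 n) x).target)
    (hC : ∀ y ∈ U, ∀ z ∈ U,
      edist ((extChartAt (𝓡 n) x).symm y) ((extChartAt (𝓡 n) x).symm z) ≤ C * edist y z ∧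
      edist y z ≤ C * edist ((extChartAt (𝓡 n) x).symm y) ((extChartAt (𝓡 n) x).symm z))
    (hgrad : ∀ φ : N → ℝ, ContMDiff (𝓡 n) 𝓘(ℝ, ℝ) ∞ φ → ∀ y ∈ U,
      ‖fderiv ℝ (φ ∘ (extChartAt (𝓡 n) x).symm) y‖ ≤
        C * ‖riemannianGradient n φ ((extChartAt (𝓡 n) x).symm y)‖)
    {ψ : EuclideanSpace ℝ (Fin n) → EuclideanSpace ℝ (Fin n)} {B : Set (EuclideanSpace ℝ (Fin n))}
    {L : ℝ≥0} (hB : Convex ℝ B) (hBb : Bornology.IsBounded B) (hBm : MeasurableSet B)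
    (hψ : LipschitzOnWith L ψ B) (hψ' : ∀ y ∈ B, ∀ z ∈ B, edist y z ≤ L * edist (ψ y) (ψ z))
    (hψU : MapsTo ψ B U) (hM : MapsTo ((extChartAt (𝓡 n) x).symm ∘ ψ) B M) :
    IsPatch n M ((extChartAt (𝓡 n) x).symm ∘ ψ) B (C * L) := by
  have hlip : LipschitzOnWith (C * L) ((extChartAt (𝓡 n) x).symm ∘ ψ) B :=
    (show LipschitzOnWith C (extChartAt (𝓡 n) x).symm U from
      fun y hy z hz => (hC y hy z hz).1).comp hψ hψU
  refine ⟨hB, hBb, hBm, hM, hlip, fun y hy z hz => ?_, fun φ hφ y hy z hz => ?_⟩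
  · refine (hψ' y hy z hz).trans ?_
    rw [ENNReal.coe_mul, mul_comm (C : ℝ≥0∞), mul_assoc]
    gcongr
    exact (hC _ (hψU hy) _ (hψU hz)).2
  · set f := φ ∘ (extChartAt (𝓡 n) x).symm
    have hf : ContDiffOn ℝ 1 f U :=
      ((contDiffOn_comp_extChartAt_symm hφ x).mono hU).of_le (by exact_mod_cast le_top)
    refine (abs_sub_le_integral_norm_fderiv hUo hf hB hψ hψU hy hz).trans ?_
    have hγ : ∀ t ∈ Icc (0 : ℝ) 1, y + t • (z - y) ∈ B := fun t ht =>
      segment_point_mem hB hy hz ht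
    have hγc : ContinuousOn (fun t : ℝ => y + t • (z - y)) (uIcc 0 1) := by fun_prop
    rw [← uIcc_of_le zero_le_one] at hγ
    have h1 : IntervalIntegrable (fun t => ‖fderiv ℝ f (ψ (y + t • (z - y)))‖) volume 0 1 :=
      ((((hf.continuousOn_fderiv_of_isOpen hUo le_rfl).comp hψ.continuousOn hψU).comp
        hγc hγ).norm).intervalIntegrable
    have h2 : IntervalIntegrable (fun t => C * ‖riemannianGradient n φ
        (((extChartAt (𝓡 n) x).symm ∘ ψ) (y + t • (z - y)))‖) volume 0 1 :=
      (continuousOn_const.mul (((continuous_norm_riemannianGradient hφ).comp_continuousOn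
        hlip.continuousOn).comp hγc hγ)).intervalIntegrable
    have h3 := intervalIntegral.integral_mono_on zero_le_one h1 h2 fun t ht =>
      hgrad φ hφ _ (hψU (segment_point_mem hB hy hz ht))
    rw [intervalIntegral.integral_const_mul] at h3
    calc (L : ℝ) * ‖y - z‖ * ∫ t in (0 : ℝ)..1, ‖fderiv ℝ f (ψ (y + t • (z - y)))‖
        ≤ L * ‖y - z‖ * (C * ∫ t in (0 : ℝ)..1, ‖riemannianGradient n φ
          (((extChartAt (𝓡 n) x).symm ∘ ψ) (y + t • (z - y)))‖) := by gcongr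
      _ = _ := by push_cast; ring

theorem extChartAt_symm_image_mem_nhds {x : N} {V : Set (EuclideanSpace ℝ (Fin n))}
    (hV : V ∈ 𝓝 (extChartAt (𝓡 n) x x)) : (extChartAt (𝓡 n) x).symm '' V ∈ 𝓝 x := by
  filter_upwards [(continuousAt_extChartAt (I := 𝓡 n) x).preimage_mem_nhds hV,
    extChartAt_source_mem_nhds (I := 𝓡 n) x] with y hy hys
  exact ⟨_, hy, (extChartAt (𝓡 n) x).left_inv hys⟩

variable [IsRiemannianManifold (𝓡 n) N]

theorem exists_isPatch_interior {M : Set N} {x : N} (hx : M ∈ 𝓝 x) :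
    ∃ r > 0, ∃ C, IsPatch n M (extChartAt (𝓡 n) x).symm (Metric.ball (extChartAt (𝓡 n) x x) r) C ∧
      Metric.ball (extChartAt (𝓡 n) x x) r ⊆ (extChartAt (𝓡 n) x).target ∧
      ∀ φ : N → ℝ, ContMDiff (𝓡 n) 𝓘(ℝ, ℝ) ∞ φ → ∀ y ∈ Metric.ball (extChartAt (𝓡 n) x x) r,
      ‖fderiv ℝ (φ ∘ (extChartAt (𝓡 n) x).symm) y‖ ≤
        C * ‖riemannianGradient n φ ((extChartAt (𝓡 n) x).symm y)‖ ∧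
      ‖riemannianGradient n φ ((extChartAt (𝓡 n) x).symm y)‖ ≤
        C * ‖fderiv ℝ (φ ∘ (extChartAt (𝓡 n) x).symm) y‖ := by
  obtain ⟨C, r, hr, hball, hC, hgrad⟩ := exists_chart_bounds (n := n) x
  obtain ⟨ρ, hρ, hρM⟩ : ∃ ρ > 0, Metric.ball (extChartAt (𝓡 n) x x) ρ ⊆
      Metric.ball (extChartAt (𝓡 n) x x) r ∩ (extChartAt (𝓡 n) x).symm ⁻¹' M :=
    Metric.mem_nhds_iff.1 (inter_mem (Metric.ball_mem_nhds _ hr)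
      (extChartAt_preimage_mem_nhds hx))
  have := isPatch_of_chart (M := M) (ψ := id) (L := 1) Metric.isOpen_ball hball hC
    (fun φ hφ y hy => (hgrad φ hφ y hy).1) (convex_ball _ ρ) Metric.isBounded_ball
    measurableSet_ball (LipschitzWith.id.lipschitzOnWith) (by simp)
    (fun y hy => (hρM hy).1) (fun y hy => (hρM hy).2)
  rw [mul_one] at this
  exact ⟨ρ, hρ, C, this, fun y hy => hball (hρM hy).1, fun φ hφ y hy => hgrad φ hφ y (hρM hy).1⟩

theorem volume_setOf_coord_eq_zero (i : Fin n) :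
    volume {z : EuclideanSpace ℝ (Fin n) | z i = 0} = 0 := by
  let S : Submodule ℝ (EuclideanSpace ℝ (Fin n)) :=
    LinearMap.ker (EuclideanSpace.proj (𝕜 := ℝ) i : EuclideanSpace ℝ (Fin n) →L[ℝ] ℝ).toLinearMap
  have hS : S ≠ ⊤ := by
    intro h
    have : (EuclideanSpace.single i (1 : ℝ)) ∈ S := by rw [h]; trivial
    simp [S] at this
  exact Measure.addHaar_submodule volume S hS

/-- Around a boundary point, `M` has a patch covering a neighbourhood of it in `M`, in which the
boundary corresponds to a hyperplane. -/
theorem exists_isPatch_frontier {M : Set N} (hM : IsClosed M)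
    (hbd : HasPiecewiseSmoothBoundary n M) {x : N} (hx : x ∈ frontier M) :
    ∃ θ B C, ∃ i : Fin n, IsPatch n M θ B C ∧ θ '' B ∈ 𝓝[M] x ∧
      frontier M ∩ θ '' B ⊆ θ '' {z ∈ B | z i = 0} ∧ (θ '' B ∩ interior M).Nonempty := by
  obtain ⟨C, r, hr, hball, hC, hgrad⟩ := exists_chart_bounds (n := n) x
  obtain ⟨Φ, i, hxΦ, -, hΦ, hΦ', hΦM⟩ := hbd x hx
  set a := extChartAt (𝓡 n) x x
  set s := (extChartAt (𝓡 n) x).symm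
  obtain ⟨L, r₁, hr₁, hL⟩ := hΦ.exists_lipschitzOnWith Φ.open_source hxΦ
  obtain ⟨L', r₂, hr₂, hL'⟩ := hΦ'.exists_lipschitzOnWith Φ.open_target (Φ.map_source hxΦ)
  have hcont : ContinuousAt Φ.symm (Φ a) := Φ.symm.continuousAt (Φ.map_source hxΦ)
  have hinvx : Φ.symm (Φ a) = a := Φ.left_inv hxΦ
  obtain ⟨ρ, hρ, hsub⟩ : ∃ ρ > 0, Metric.ball (Φ a) ρ ⊆ (Φ.target ∩ Metric.ball (Φ a) r₂) ∩
      Φ.symm ⁻¹' (Metric.ball a r ∩ Metric.ball a r₁) := by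
    refine Metric.mem_nhds_iff.1 (inter_mem (inter_mem (Φ.open_target.mem_nhds
      (Φ.map_source hxΦ)) (Metric.ball_mem_nhds _ hr₂)) (hcont.preimage_mem_nhds ?_))
    rw [hinvx]
    exact inter_mem (Metric.ball_mem_nhds _ hr) (Metric.ball_mem_nhds _ hr₁)
  have hs : ∀ y ∈ Metric.ball a r, extChartAt (𝓡 n) x (s y) = y := fun y hy =>
    (extChartAt (𝓡 n) x).right_inv (hball hy)
  have hso : ∀ V ⊆ Metric.ball (Φ a) ρ, IsOpen V → IsOpen ((s ∘ Φ.symm) '' V) := by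
    intro V hV hVo
    rw [image_comp]
    have h1 : IsOpen (Φ.symm '' V) := Φ.symm.isOpen_image_of_subset_source hVo
      fun z hz => (hsub (hV hz)).1.1
    refine (chartAt (EuclideanSpace ℝ (Fin n)) x).symm.isOpen_image_of_subset_source h1 ?_
    rintro _ ⟨z, hz, rfl⟩
    have := hball (hsub (hV hz)).2.1
    simpa [extChartAt_target] using this
  have hmem : ∀ z ∈ Metric.ball (Φ a) ρ, (s ∘ Φ.symm) z ∈ M ↔ 0 ≤ z i := by
    intro z hz
    have h := hΦM (Φ.symm z) (Φ.map_target (hsub hz).1.1)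
    rwa [Φ.right_inv (hsub hz).1.1] at h
  have hinj : InjOn (s ∘ Φ.symm) (Metric.ball (Φ a) ρ) := by
    intro y hy z hz hyz
    have h1 : Φ.symm y = Φ.symm z := by
      rw [← hs _ (hsub hy).2.1, ← hs _ (hsub hz).2.1]
      exact congrArg _ hyz
    rw [← Φ.right_inv (hsub hy).1.1, ← Φ.right_inv (hsub hz).1.1, h1]
  have hx0 : (s ∘ Φ.symm) (Φ a) = x := by
    simp only [Function.comp, hinvx]
    exact extChartAt_to_inv x
  have hnhds : (s ∘ Φ.symm) '' Metric.ball (Φ a) ρ ∈ 𝓝 x :=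
    (hso _ le_rfl Metric.isOpen_ball).mem_nhds ⟨_, Metric.mem_ball_self hρ, hx0⟩
  have hopen : IsOpen {z : EuclideanSpace ℝ (Fin n) | 0 < z i} :=
    isOpen_lt continuous_const (by fun_prop)
  set B : Set (EuclideanSpace ℝ (Fin n)) := Metric.ball (Φ a) ρ ∩ {z | 0 ≤ z i}
  -- The open half of the ball has open image contained in `M`, hence in its interior. So boundary
  -- points in the patch can only come from the hyperplane.
  have hint : (s ∘ Φ.symm) '' (Metric.ball (Φ a) ρ ∩ {z | 0 < z i}) ⊆ interior M := by
    refine interior_maximal ?_ (hso _ inter_subset_left (Metric.isOpen_ball.inter hopen))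
    rintro _ ⟨z, hz, rfl⟩
    exact (hmem z hz.1).2 (le_of_lt hz.2)
  have hhalf : Convex ℝ {z : EuclideanSpace ℝ (Fin n) | 0 ≤ z i} :=
    convex_halfSpace_ge (𝕜 := ℝ) (f := fun z : EuclideanSpace ℝ (Fin n) => z i)
      ⟨fun _ _ => rfl, fun _ _ => rfl⟩ 0
  have hpatch : IsPatch n M (s ∘ Φ.symm) B (C * (L + L')) := by
    refine isPatch_of_chart Metric.isOpen_ball hball hC (fun φ hφ y hy => (hgrad φ hφ y hy).1)
      ((convex_ball _ ρ).inter hhalf) (Metric.isBounded_ball.subset inter_subset_left)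
      (measurableSet_ball.inter (isClosed_le continuous_const (by fun_prop)).measurableSet)
      ((hL'.mono fun z hz => (hsub hz.1).1.2).weaken (le_add_of_nonneg_left zero_le))
      (fun y hy z hz => ?_) (fun z hz => (hsub hz.1).2.1) fun z hz => (hmem z hz.1).2 hz.2
    have := hL (hsub hy.1).2.2 (hsub hz.1).2.2
    rw [Φ.right_inv (hsub hy.1).1.1, Φ.right_inv (hsub hz.1).1.1] at this
    refine this.trans ?_
    gcongr
    exact le_add_of_nonneg_right zero_le
  refine ⟨s ∘ Φ.symm, B, _, i, hpatch, ?_, ?_, ?_⟩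
  · filter_upwards [mem_nhdsWithin_of_mem_nhds hnhds, self_mem_nhdsWithin] with y hy hyM
    obtain ⟨z, hz, rfl⟩ := hy
    exact ⟨z, ⟨hz, (hmem z hz).1 hyM⟩, rfl⟩
  · rintro _ ⟨hfr, z, hz, rfl⟩
    refine ⟨z, ⟨hz, ?_⟩, rfl⟩
    by_contra hne
    exact hfr.2 (hint ⟨z, ⟨hz.1, lt_of_le_of_ne hz.2 (Ne.symm hne)⟩, rfl⟩)
  · have hxi : 0 ≤ Φ a i := (hmem _ (Metric.mem_ball_self hρ)).1 (by
      rw [hx0]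
      exact hM.frontier_subset hx)
    -- Moving from the base point by `ρ / 2` in the inward direction gives a point of the open half
    -- ball, so the patch meets the interior.
    set z := Φ a + (ρ / 2) • EuclideanSpace.single i (1 : ℝ)
    have hz : z ∈ Metric.ball (Φ a) ρ := by
      rw [Metric.mem_ball, dist_eq_norm]
      simp only [z, add_sub_cancel_left, norm_smul, PiLp.norm_single]
      simp only [Real.norm_eq_abs, abs_of_pos (half_pos hρ), norm_one, mul_one]
      exact half_lt_self hρ
    have hzi : 0 < z i := by
      simp only [z, PiLp.add_apply, PiLp.smul_apply, PiLp.single_apply]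
      simp
      linarith
    exact ⟨_, ⟨z, ⟨hz, hzi.le⟩, rfl⟩, hint ⟨z, ⟨hz, hzi⟩, rfl⟩⟩

/-- Every point of `M` has a neighbourhood in `M` that is a patch, in which the boundary is
negligible. -/
theorem exists_isPatch {M : Set N} (hM : IsClosed M)
    (hbd : HasPiecewiseSmoothBoundary n M) {x : N} (hx : x ∈ M) :
    ∃ θ B C, ∃ Z ⊆ B, IsPatch n M θ B C ∧ θ '' B ∈ 𝓝[M] x ∧ volume Z = 0 ∧
      (x ∈ frontier M → frontier M ∩ θ '' B ⊆ θ '' Z) := by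
  by_cases hxf : x ∈ frontier M
  · obtain ⟨θ, B, C, i, h, h1, h2, -⟩ := exists_isPatch_frontier hM hbd hxf
    exact ⟨θ, B, C, _, sep_subset _ _, h, h1, measure_mono_null (fun z hz => hz.2)
      (volume_setOf_coord_eq_zero i), fun _ => h2⟩
  · have hxM : M ∈ 𝓝 x := by
      rw [mem_interior_iff_mem_nhds.symm]
      by_contra h
      exact hxf ⟨subset_closure hx, h⟩
    obtain ⟨r, hr, C, h, -⟩ := exists_isPatch_interior (n := n) hxM
    exact ⟨_, _, C, ∅, empty_subset _, h, mem_nhdsWithin_of_mem_nhds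
      (extChartAt_symm_image_mem_nhds (Metric.ball_mem_nhds _ hr)), measure_empty,
      fun h => absurd h hxf⟩

/-! ### The Riemannian volume in patches -/

variable [MeasurableSpace N] [BorelSpace N]

theorem IsPatch.measure_image_le {M : Set N} {θ : EuclideanSpace ℝ (Fin n) → N}
    {B S : Set (EuclideanSpace ℝ (Fin n))} {C : ℝ≥0} (h : IsPatch n M θ B C) (hS : S ⊆ B) :
    (μHE[n] : Measure N) (θ '' S) ≤ (C : ℝ≥0∞) ^ n * volume S := by
  have := euclideanHausdorffMeasure_image_le (h.lipschitz.mono hS) n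
  rwa [EuclideanSpace.euclideanHausdorffMeasure_eq_volume] at this

theorem IsPatch.volume_le {M : Set N} {θ : EuclideanSpace ℝ (Fin n) → N}
    {B S : Set (EuclideanSpace ℝ (Fin n))} {C : ℝ≥0} (h : IsPatch n M θ B C) (hS : S ⊆ B) :
    volume S ≤ (C : ℝ≥0∞) ^ n * (μHE[n] : Measure N) (θ '' S) := by
  have := euclideanHausdorffMeasure_le_image
    (fun y hy z hz => h.edist_le y (hS hy) z (hS hz)) n
  rwa [EuclideanSpace.euclideanHausdorffMeasure_eq_volume] at this

/-- The integral over the image of a patch is at most a constant times the integral in the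
parameter domain. -/
theorem IsPatch.lintegral_image_le {M : Set N} {θ : EuclideanSpace ℝ (Fin n) → N}
    {B S : Set (EuclideanSpace ℝ (Fin n))} {C : ℝ≥0} (h : IsPatch n M θ B C) (hS : S ⊆ B)
    (hSm : MeasurableSet S) {f : N → ℝ≥0∞} (hf : Measurable f) :
    ∫⁻ x in θ '' S, f x ∂μHE[n] ≤ (C : ℝ≥0∞) ^ n * ∫⁻ y in S, f (θ y) := by
  have hθ : AEMeasurable θ (volume.restrict S) :=
    (h.lipschitz.mono hS).continuousOn.aemeasurable hSm
  rw [← lintegral_map' hf.aemeasurable hθ, ← smul_eq_mul, ← lintegral_smul_measure]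
  refine lintegral_mono' (Measure.le_iff.2 fun A hA => ?_) le_rfl
  rw [Measure.restrict_apply hA, Measure.smul_apply, Measure.map_apply_of_aemeasurable hθ hA,
    smul_eq_mul]
  have h1 : A ∩ θ '' S = θ '' (θ ⁻¹' A ∩ S) := by rw [image_preimage_inter]
  rw [h1, Measure.restrict_apply' hSm]
  exact h.measure_image_le (inter_subset_right.trans hS)

/-- The integral over the parameter domain of a patch is at most a constant times the integral
over `M`. -/
theorem IsPatch.lintegral_comp_le {M : Set N} {θ : EuclideanSpace ℝ (Fin n) → N}
    {B S : Set (EuclideanSpace ℝ (Fin n))} {C : ℝ≥0} (h : IsPatch n M θ B C) (hS : S ⊆ B)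
    (hSm : MeasurableSet S) {f : N → ℝ≥0∞} (hf : Measurable f) {T : Set N} (hT : MapsTo θ S T) :
    ∫⁻ y in S, f (θ y) ≤ (C : ℝ≥0∞) ^ n * ∫⁻ x in T, f x ∂μHE[n] := by
  have hθ : AEMeasurable θ (volume.restrict S) :=
    (h.lipschitz.mono hS).continuousOn.aemeasurable hSm
  rw [← lintegral_map' hf.aemeasurable hθ, ← smul_eq_mul, ← lintegral_smul_measure]
  refine lintegral_mono' (Measure.le_iff.2 fun A hA => ?_) le_rfl
  rw [Measure.smul_apply, Measure.map_apply_of_aemeasurable hθ hA, smul_eq_mul,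
    Measure.restrict_apply hA, Measure.restrict_apply' hSm]
  refine (h.volume_le (inter_subset_right.trans hS)).trans ?_
  gcongr
  rintro _ ⟨y, hy, rfl⟩
  exact ⟨hy.1, hT hy.2⟩

theorem measure_lt_top_of_hasPiecewiseSmoothBoundary {M : Set N} (hM : IsCompact M)
    (hbd : HasPiecewiseSmoothBoundary n M) : (μHE[n] : Measure N) M < ⊤ := by
  refine hM.measure_lt_top_of_nhdsWithin fun x hx => ?_
  obtain ⟨θ, B, C, Z, -, h, h1, -, -⟩ := exists_isPatch hM.isClosed hbd hx
  refine ⟨_, h1, (h.measure_image_le le_rfl).trans_lt ?_⟩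
  exact ENNReal.mul_lt_top (by simp [ENNReal.pow_lt_top_iff]) h.isBounded.measure_lt_top

theorem measure_frontier_eq_zero {M : Set N} (hM : IsCompact M)
    (hbd : HasPiecewiseSmoothBoundary n M) : (μHE[n] : Measure N) (frontier M) = 0 := by
  refine (hM.of_isClosed_subset isClosed_frontier hM.isClosed.frontier_subset
    ).measure_zero_of_nhdsWithin fun x hx => ?_
  obtain ⟨θ, B, C, Z, hZ, h, h1, hZ0, h2⟩ := exists_isPatch hM.isClosed hbd
    (hM.isClosed.frontier_subset hx)
  refine ⟨frontier M ∩ θ '' B, inter_mem self_mem_nhdsWithin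
    (nhdsWithin_mono _ hM.isClosed.frontier_subset h1), measure_mono_null (h2 hx) ?_⟩
  have := h.measure_image_le hZ
  rwa [hZ0, mul_zero, nonpos_iff_eq_zero] at this

theorem measure_pos_of_isOpen {U : Set N} (hU : IsOpen U) (hne : U.Nonempty) :
    0 < (μHE[n] : Measure N) U := by
  obtain ⟨x, hx⟩ := hne
  obtain ⟨r, hr, C, h, -⟩ := exists_isPatch_interior (n := n) (hU.mem_nhds hx)
  rw [pos_iff_ne_zero]
  intro h0
  have h2 := h.volume_le le_rfl
  rw [measure_mono_null h.mapsTo.image_subset h0, mul_zero, nonpos_iff_eq_zero] at h2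
  exact (Metric.measure_ball_pos volume _ hr).ne' h2

end Patches

end MixedSpectrum

namespace MixedSpectrum

set_option linter.unusedSectionVars false

/-! ### The Poincaré inequality on convex sets -/

section Poincare

open scoped NNReal

theorem lintegral_sq_le {α : Type*} [MeasurableSpace α] {μ : Measure α} {f : α → ℝ≥0∞}
    (hf : AEMeasurable f μ) : (∫⁻ x, f x ∂μ) ^ 2 ≤ μ univ * ∫⁻ x, f x ^ 2 ∂μ := by
  have h := ENNReal.lintegral_mul_le_Lp_mul_Lq μ Real.HolderConjugate.two_two
    (aemeasurable_const (b := (1 : ℝ≥0∞))) hf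
  simp only [Pi.mul_apply, one_mul, ENNReal.rpow_two, one_pow, lintegral_one] at h
  calc (∫⁻ x, f x ∂μ) ^ 2
      ≤ (μ univ ^ (1 / (2 : ℝ)) * (∫⁻ x, f x ^ 2 ∂μ) ^ (1 / (2 : ℝ))) ^ 2 := by gcongr
    _ = _ := by
      rw [mul_pow, ← ENNReal.rpow_two, ← ENNReal.rpow_two, ← ENNReal.rpow_mul, ← ENNReal.rpow_mul]
      norm_num

variable {n : ℕ}

local notation "𝔼" => EuclideanSpace ℝ (Fin n)

theorem lintegral_comp_smul_add_le {G : 𝔼 → ℝ≥0∞} (hG : Measurable G) {t : ℝ} (ht : 1 / 2 ≤ t)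
    (c : 𝔼) : ∫⁻ z, G (t • z + c) ≤ 2 ^ n * ∫⁻ z, G z := by
  have ht0 : 0 < t := by linarith
  have h1 : ∫⁻ z, G (t • z + c) = ∫⁻ z, G (z + c) ∂(Measure.map (t • ·) (volume : Measure 𝔼)) := by
    rw [lintegral_map (by fun_prop) (by fun_prop)]
  rw [h1, Measure.map_addHaar_smul _ ht0.ne', lintegral_smul_measure, lintegral_add_right_eq_self,
    smul_eq_mul]
  gcongr
  rw [finrank_euclideanSpace_fin, abs_of_pos (by positivity), ← inv_pow,
    ENNReal.ofReal_pow (by positivity)]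
  gcongr
  rw [← ENNReal.ofReal_ofNat 2]
  refine ENNReal.ofReal_le_ofReal ?_
  rw [inv_le_comm₀ ht0 two_pos]
  linarith

/-- For each `t`, one of `t` and `1 - t` is at least `1 / 2`. Integrating first in the endpoint with
that coefficient, the linear substitution costs a factor of at most `2 ^ n`, uniformly in `t`. -/
theorem lintegral_lintegral_lintegral_segment_le {G : 𝔼 → ℝ≥0∞} (hG : Measurable G) (Q : Set 𝔼) :
    ∫⁻ y in Q, ∫⁻ z in Q, ∫⁻ t in Icc (0 : ℝ) 1, G (y + t • (z - y)) ≤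
      2 ^ n * volume Q * ∫⁻ y, G y := by
  have hm : Measurable fun p : 𝔼 × 𝔼 × ℝ => G (p.1 + p.2.2 • (p.2.1 - p.1)) :=
    hG.comp (by fun_prop)
  have e1 : ∀ y, ∫⁻ z in Q, ∫⁻ t in Icc (0 : ℝ) 1, G (y + t • (z - y)) =
      ∫⁻ t in Icc (0 : ℝ) 1, ∫⁻ z in Q, G (y + t • (z - y)) := fun y =>
    lintegral_lintegral_swap (Measurable.aemeasurable (by fun_prop))
  simp_rw [e1]
  rw [lintegral_lintegral_swap]
  swap
  · have : Measurable fun p : (𝔼 × ℝ) × 𝔼 => G (p.1.1 + p.1.2 • (p.2 - p.1.1)) :=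
      hG.comp (by fun_prop)
    exact this.lintegral_prod_right'.aemeasurable
  have key : ∀ t ∈ Icc (0 : ℝ) 1, ∫⁻ y in Q, ∫⁻ z in Q, G (y + t • (z - y)) ≤
      2 ^ n * volume Q * ∫⁻ y, G y := by
    intro t ht
    rcases le_total (1 / 2) t with h | h
    · calc ∫⁻ y in Q, ∫⁻ z in Q, G (y + t • (z - y))
          ≤ ∫⁻ y in Q, 2 ^ n * ∫⁻ z, G z := by
            refine lintegral_mono fun y => (setLIntegral_le_lintegral _ _).trans ?_
            have := lintegral_comp_smul_add_le hG h (y - t • y)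
            refine le_trans (le_of_eq ?_) this
            refine lintegral_congr fun z => ?_
            congr 1
            module
        _ = _ := by
            rw [setLIntegral_const]
            ring
    · rw [lintegral_lintegral_swap (Measurable.aemeasurable (by fun_prop))]
      calc ∫⁻ z in Q, ∫⁻ y in Q, G (y + t • (z - y))
          ≤ ∫⁻ z in Q, 2 ^ n * ∫⁻ y, G y := by
            refine lintegral_mono fun z => (setLIntegral_le_lintegral _ _).trans ?_
            have := lintegral_comp_smul_add_le hG (t := 1 - t) (by linarith) (t • z)
            refine le_trans (le_of_eq ?_) this
            refine lintegral_congr fun y => ?_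
            congr 1
            module
        _ = _ := by
            rw [setLIntegral_const]
            ring
  refine (setLIntegral_mono' measurableSet_Icc key).trans ?_
  simp

/-- The Poincaré inequality on a convex set of diameter at most `D`, for a function `f` with
"upper gradient" `g`. -/
theorem lintegral_sq_le_of_upper_gradient {Q : Set 𝔼} (hQ : Convex ℝ Q) (hQm : MeasurableSet Q)
    (hQt : volume Q ≠ ⊤) {f g : 𝔼 → ℝ} (hf : IntegrableOn f Q) (hg : ContinuousOn g Q) {C D : ℝ≥0}
    (hD : ∀ y ∈ Q, ∀ z ∈ Q, ‖y - z‖ ≤ D)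
    (hfg : ∀ y ∈ Q, ∀ z ∈ Q, |f y - f z| ≤ C * ‖y - z‖ * ∫ t in (0 : ℝ)..1, g (y + t • (z - y))) :
    ∫⁻ y in Q, ‖f y‖ₑ ^ 2 ≤ 2 * (C * D) ^ 2 * 2 ^ n * (∫⁻ y in Q, ‖g y‖ₑ ^ 2) +
      2 * (volume Q)⁻¹ * ‖∫ y in Q, f y‖ₑ ^ 2 := by
  rcases eq_or_ne (volume Q) 0 with h0 | h0
  · rw [Measure.restrict_eq_zero.2 h0]
    simp
  -- Extended by zero, the squared gradient is defined on the whole space, where the substitutions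
  -- of the segment estimate take place.
  set G : 𝔼 → ℝ≥0∞ := Q.indicator fun y => ‖g y‖ₑ ^ 2
  have hG : Measurable G := by
    classical
    have : Measurable (Q.piecewise (fun y => ‖g y‖ₑ ^ 2) 0) := by
      refine ContinuousOn.measurable_piecewise ?_ continuousOn_const hQm
      exact (ENNReal.continuous_pow 2).comp_continuousOn (continuous_enorm.comp_continuousOn hg)
    rwa [piecewise_eq_indicator] at this
  have hfz : ∀ y ∈ Q, ∀ z ∈ Q, ‖f y - f z‖ₑ ^ 2 ≤
      ((C : ℝ≥0∞) * D) ^ 2 * ∫⁻ t in Icc (0 : ℝ) 1, G (y + t • (z - y)) := by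
    intro y hy z hz
    have hγ : ∀ t ∈ Icc (0 : ℝ) 1, y + t • (z - y) ∈ Q := fun t ht => segment_point_mem hQ hy hz ht
    have hgc : ContinuousOn (fun t : ℝ => g (y + t • (z - y))) (Icc 0 1) :=
      hg.comp (by fun_prop) hγ
    have h1 : ‖f y - f z‖ₑ ≤ (C : ℝ≥0∞) * D * ‖∫ t in (0 : ℝ)..1, g (y + t • (z - y))‖ₑ := by
      have h2 : ‖f y - f z‖ ≤ C * D * ‖∫ t in (0 : ℝ)..1, g (y + t • (z - y))‖ := by
        refine (hfg y hy z hz).trans ?_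
        exact (mul_le_mul_of_nonneg_left (le_abs_self _) (by positivity)).trans
          (mul_le_mul_of_nonneg_right (mul_le_mul_of_nonneg_left (hD y hy z hz) C.coe_nonneg)
            (abs_nonneg _))
      have h3 := ENNReal.ofReal_le_ofReal h2
      rwa [ENNReal.ofReal_mul (by positivity), ENNReal.ofReal_mul (by positivity), ofReal_norm,
        ofReal_norm, ENNReal.ofReal_coe_nnreal, ENNReal.ofReal_coe_nnreal] at h3
    have h4 : ‖∫ t in (0 : ℝ)..1, g (y + t • (z - y))‖ₑ ≤
        ∫⁻ t in Icc (0 : ℝ) 1, ‖g (y + t • (z - y))‖ₑ := by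
      rw [intervalIntegral.integral_of_le zero_le_one, ← integral_Icc_eq_integral_Ioc]
      exact enorm_integral_le_lintegral_enorm _
    have h5 := lintegral_sq_le (μ := volume.restrict (Icc (0 : ℝ) 1))
      (f := fun t => ‖g (y + t • (z - y))‖ₑ)
      (hgc.aemeasurable measurableSet_Icc).enorm
    simp only [Measure.restrict_apply_univ, Real.volume_Icc, sub_zero, ENNReal.ofReal_one,
      one_mul] at h5
    have h6 : ∫⁻ t in Icc (0 : ℝ) 1, ‖g (y + t • (z - y))‖ₑ ^ 2 =
        ∫⁻ t in Icc (0 : ℝ) 1, G (y + t • (z - y)) :=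
      setLIntegral_congr_fun measurableSet_Icc fun t ht =>
        (indicator_of_mem (hγ t ht) (fun y => ‖g y‖ₑ ^ 2)).symm
    calc ‖f y - f z‖ₑ ^ 2
        ≤ ((C : ℝ≥0∞) * D * ∫⁻ t in Icc (0 : ℝ) 1, ‖g (y + t • (z - y))‖ₑ) ^ 2 := by
          gcongr
          exact h1.trans (by gcongr)
      _ ≤ _ := by
          rw [mul_pow, ← h6]
          gcongr
  set V := volume Q
  set m : ℝ := (volume.real Q)⁻¹ * ∫ y in Q, f y
  have hV : ENNReal.ofReal (volume.real Q) = V := ofReal_measureReal hQt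
  have hVp : 0 < volume.real Q := ENNReal.toReal_pos h0 hQt
  have hm : ‖m‖ₑ = V⁻¹ * ‖∫ y in Q, f y‖ₑ := by
    rw [enorm_mul, Real.enorm_eq_ofReal (by positivity), ENNReal.ofReal_inv_of_pos hVp, hV]
  -- With `m` the mean of `f` over `Q`, the deviation is an average of differences `f y - f z`;
  -- Cauchy-Schwarz then bounds its square by the average of their squares.
  have hdev : ∀ y ∈ Q, ‖f y - m‖ₑ ^ 2 ≤ V⁻¹ * ∫⁻ z in Q, ‖f y - f z‖ₑ ^ 2 := by
    intro y hy
    have h1 : f y - m = (volume.real Q)⁻¹ * ∫ z in Q, (f y - f z) := by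
      rw [integral_sub (integrableOn_const (C := f y) hQt) hf, setIntegral_const, smul_eq_mul,
        mul_sub,
        ← mul_assoc, inv_mul_cancel₀ hVp.ne', one_mul]
    have h2 : ‖f y - m‖ₑ ≤ V⁻¹ * ∫⁻ z in Q, ‖f y - f z‖ₑ := by
      rw [h1, enorm_mul, Real.enorm_eq_ofReal (by positivity), ENNReal.ofReal_inv_of_pos hVp, hV]
      gcongr
      exact enorm_integral_le_lintegral_enorm _
    have h3 := lintegral_sq_le (μ := volume.restrict Q) (f := fun z => ‖f y - f z‖ₑ)
      (aemeasurable_const.sub hf.aestronglyMeasurable.aemeasurable).enorm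
    rw [Measure.restrict_apply_univ] at h3
    calc ‖f y - m‖ₑ ^ 2 ≤ (V⁻¹ * ∫⁻ z in Q, ‖f y - f z‖ₑ) ^ 2 := by gcongr
      _ ≤ V⁻¹ ^ 2 * (V * ∫⁻ z in Q, ‖f y - f z‖ₑ ^ 2) := by rw [mul_pow]; gcongr
      _ = _ := by
        rw [← mul_assoc, sq, mul_assoc V⁻¹, ENNReal.inv_mul_cancel h0 hQt, mul_one]
  have hpt : ∀ y ∈ Q, ‖f y‖ₑ ^ 2 ≤ 2 * (V⁻¹ * (((C : ℝ≥0∞) * D) ^ 2 *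
      ∫⁻ z in Q, ∫⁻ t in Icc (0 : ℝ) 1, G (y + t • (z - y)))) + 2 * ‖m‖ₑ ^ 2 := by
    intro y hy
    have h1 : ‖f y‖ₑ ≤ ‖f y - m‖ₑ + ‖m‖ₑ := by
      simpa using enorm_add_le (f y - m) m
    have h2 : (‖f y - m‖ₑ + ‖m‖ₑ) ^ 2 ≤ 2 * ‖f y - m‖ₑ ^ 2 + 2 * ‖m‖ₑ ^ 2 := by
      rw [← mul_add]
      have := ENNReal.rpow_add_le_mul_rpow_add_rpow ‖f y - m‖ₑ ‖m‖ₑ (p := 2) (by norm_num)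
      norm_num at this
      exact this
    calc ‖f y‖ₑ ^ 2 ≤ (‖f y - m‖ₑ + ‖m‖ₑ) ^ 2 := by gcongr
      _ ≤ _ := h2
      _ ≤ _ := by
        gcongr
        refine (hdev y hy).trans ?_
        gcongr
        rw [← lintegral_const_mul' _ _ (by finiteness)]
        exact setLIntegral_mono' hQm fun z hz => hfz y hy z hz
  have hGQ : ∫⁻ y, G y = ∫⁻ y in Q, ‖g y‖ₑ ^ 2 := lintegral_indicator hQm _
  calc ∫⁻ y in Q, ‖f y‖ₑ ^ 2
      ≤ ∫⁻ y in Q, (2 * (V⁻¹ * (((C : ℝ≥0∞) * D) ^ 2 *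
        ∫⁻ z in Q, ∫⁻ t in Icc (0 : ℝ) 1, G (y + t • (z - y)))) + 2 * ‖m‖ₑ ^ 2) :=
        setLIntegral_mono' hQm hpt
    _ = 2 * (V⁻¹ * (((C : ℝ≥0∞) * D) ^ 2 *
        ∫⁻ y in Q, ∫⁻ z in Q, ∫⁻ t in Icc (0 : ℝ) 1, G (y + t • (z - y)))) + 2 * ‖m‖ₑ ^ 2 * V := by
        rw [lintegral_add_right _ measurable_const, setLIntegral_const,
          lintegral_const_mul' _ _ (by finiteness), lintegral_const_mul' _ _ (by finiteness),
          lintegral_const_mul' _ _ (by finiteness)]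
    _ ≤ 2 * (V⁻¹ * (((C : ℝ≥0∞) * D) ^ 2 * (2 ^ n * V * ∫⁻ y, G y))) + 2 * ‖m‖ₑ ^ 2 * V := by
        gcongr
        exact lintegral_lintegral_lintegral_segment_le hG Q
    _ = (V⁻¹ * V) * (2 * (C * D) ^ 2 * 2 ^ n * (∫⁻ y in Q, ‖g y‖ₑ ^ 2)) +
        (V⁻¹ * V) * (2 * V⁻¹ * ‖∫ y in Q, f y‖ₑ ^ 2) := by
        rw [hm, hGQ]
        ring
    _ = _ := by rw [ENNReal.inv_mul_cancel h0 hQt, one_mul, one_mul]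

/-- A bounded convex set is a finite disjoint union of convex sets of small diameter. -/
theorem exists_finite_convex_partition {B : Set 𝔼} (hB : Convex ℝ B) (hBb : Bornology.IsBounded B)
    (hBm : MeasurableSet B) {D : ℝ} (hD : 0 < D) :
    ∃ (T : Finset (Fin n → ℤ)) (Q : (Fin n → ℤ) → Set 𝔼), (∀ κ, Convex ℝ (Q κ)) ∧
      (∀ κ, MeasurableSet (Q κ)) ∧ (∀ κ, Q κ ⊆ B) ∧ (∀ κ, ∀ y ∈ Q κ, ∀ z ∈ Q κ, ‖y - z‖ ≤ D) ∧
      (B = ⋃ κ ∈ T, Q κ) ∧ (T : Set (Fin n → ℤ)).PairwiseDisjoint Q := by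
  obtain ⟨R, hR⟩ := hBb.exists_norm_le
  -- The pieces are cut out by cubes of side `δ`, whose points differ by at most `n * δ ≤ D`. The
  -- denominator `n + 1` avoids a division by zero when `n = 0`.
  set δ : ℝ := D / (n + 1)
  have hδ : 0 < δ := by positivity
  set c : 𝔼 → Fin n → ℤ := fun y i => ⌊y i / δ⌋
  have hc : ∀ κ : Fin n → ℤ, {y | c y = κ} =
      ⋂ i, {y : 𝔼 | κ i * δ ≤ y i} ∩ {y : 𝔼 | y i < (κ i + 1) * δ} := by
    intro κ
    ext y
    simp only [c, funext_iff, mem_ofPred_eq, mem_iInter, mem_inter_iff, Int.floor_eq_iff,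
      le_div_iff₀ hδ, div_lt_iff₀ hδ]
  have hfin : (c '' B).Finite := by
    refine (finite_Icc (fun _ => ⌊-R / δ⌋ : Fin n → ℤ) (fun _ => ⌊R / δ⌋)).subset ?_
    rintro _ ⟨y, hy, rfl⟩
    have h1 : ∀ i, |y i| ≤ R := fun i => (PiLp.norm_apply_le y i).trans (hR y hy)
    constructor <;> intro i <;> refine Int.floor_le_floor ?_ <;> gcongr
    · exact (abs_le.1 (h1 i)).1
    · exact (abs_le.1 (h1 i)).2
  refine ⟨hfin.toFinset, fun κ => B ∩ {y | c y = κ}, fun κ => hB.inter ?_, fun κ => hBm.inter ?_,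
    fun κ => inter_subset_left, fun κ y hy z hz => ?_, ?_, ?_⟩
  · rw [hc]
    have hlin : ∀ i, IsLinearMap ℝ fun y : 𝔼 => y i := fun i => ⟨fun _ _ => rfl, fun _ _ => rfl⟩
    exact convex_iInter fun i =>
      (convex_halfSpace_ge (hlin i) _).inter (convex_halfSpace_lt (hlin i) _)
  · rw [hc]
    exact MeasurableSet.iInter fun i => (measurableSet_le measurable_const (by fun_prop)).inter
      (measurableSet_lt (by fun_prop) measurable_const)
  · have h1 : ∀ i, ‖(y - z) i‖ ≤ δ := by
      intro i
      have hy' := hy.2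
      have hz' := hz.2
      rw [hc] at hy' hz'
      simp only [mem_iInter, mem_inter_iff, mem_ofPred_eq] at hy' hz'
      rw [PiLp.sub_apply, Real.norm_eq_abs, abs_le]
      constructor <;> nlinarith [hy' i, hz' i]
    have h2 : ‖y - z‖ ≤ ∑ i, ‖(y - z) i‖ := by
      conv_lhs => rw [← (EuclideanSpace.basisFun (Fin n) ℝ).sum_repr (y - z)]
      refine (norm_sum_le _ _).trans (Finset.sum_le_sum fun i _ => ?_)
      simp [norm_smul]
    calc ‖y - z‖ ≤ ∑ i : Fin n, δ := h2.trans (Finset.sum_le_sum fun i _ => h1 i)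
      _ = n * δ := by simp
      _ ≤ (n + 1) * δ := by gcongr; linarith
      _ = D := by simp only [δ]; field_simp
  · ext y
    simp only [Finite.mem_toFinset, mem_iUnion, mem_inter_iff, mem_ofPred_eq, exists_prop]
    exact ⟨fun hy => ⟨_, mem_image_of_mem c hy, hy, rfl⟩, fun ⟨_, _, hy, _⟩ => hy⟩
  · intro κ _ κ' _ hne
    refine disjoint_left.2 fun y hy hy' => hne ?_
    rw [← hy.2, ← hy'.2]

end Poincare

end MixedSpectrum

namespace MixedSpectrum

set_option linter.unusedSectionVars false

section Rellich

/-! ### Rellich's theorem -/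

open scoped NNReal

variable {n : ℕ} {N : Type*} [EMetricSpace N]
    [ChartedSpace (EuclideanSpace ℝ (Fin n)) N] [IsManifold (𝓡 n) ∞ N]
    [RiemannianBundle (fun x : N => TangentSpace (𝓡 n) x)]
    [IsContMDiffRiemannianBundle (𝓡 n) ∞ (EuclideanSpace ℝ (Fin n))
      (fun x : N => TangentSpace (𝓡 n) x)]
    [IsRiemannianManifold (𝓡 n) N] [MeasurableSpace N] [BorelSpace N]

variable (n N) in
/-- The smooth functions on `N`. -/
abbrev SmoothFunction : Type _ := ContMDiffMap (𝓡 n) 𝓘(ℝ, ℝ) N ℝ ∞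

theorem IsPatch.integrableOn_comp {M : Set N} (hM : IsCompact M)
    {θ : EuclideanSpace ℝ (Fin n) → N}
    {B S : Set (EuclideanSpace ℝ (Fin n))} {C : ℝ≥0} (h : IsPatch n M θ B C) (hS : S ⊆ B)
    (hSm : MeasurableSet S) {φ : N → ℝ} (hφ : Continuous φ) :
    IntegrableOn (fun y => φ (θ y)) S := by
  obtain ⟨K, hK⟩ := hM.exists_bound_of_continuousOn hφ.continuousOn
  refine IntegrableOn.of_bound ((measure_mono hS).trans_lt h.isBounded.measure_lt_top)
    ((hφ.comp_continuousOn (h.lipschitz.mono hS).continuousOn).aestronglyMeasurable hSm) K ?_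
  exact (ae_restrict_iff' hSm).2 (Eventually.of_forall fun y hy => hK _ (h.mapsTo (hS hy)))

/-- The integral of smooth functions over a part of a patch, as a linear functional. -/
noncomputable def IsPatch.integralFunctional {M : Set N} (hM : IsCompact M)
    {θ : EuclideanSpace ℝ (Fin n) → N}
    {B S : Set (EuclideanSpace ℝ (Fin n))} {C : ℝ≥0} (h : IsPatch n M θ B C) (hS : S ⊆ B)
    (hSm : MeasurableSet S) : SmoothFunction n N →ₗ[ℝ] ℝ where
  toFun φ := ∫ y in S, φ (θ y)
  map_add' φ ψ := integral_add (h.integrableOn_comp hM hS hSm φ.contMDiff.continuous)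
    (h.integrableOn_comp hM hS hSm ψ.contMDiff.continuous)
  map_smul' c _ := integral_const_mul c _

/-- On a patch, the `L²` norm of a smooth function is bounded by a small multiple of the norm of
its gradient and finitely many linear functionals. -/
theorem IsPatch.exists_list {M : Set N} (hM : IsCompact M)
    {θ : EuclideanSpace ℝ (Fin n) → N}
    {B : Set (EuclideanSpace ℝ (Fin n))} {C : ℝ≥0} (h : IsPatch n M θ B C) {ε : ℝ≥0} (hε : 0 < ε) :
    ∃ l : List (SmoothFunction n N →ₗ[ℝ] ℝ),
      (∀ P ∈ l, ∃ K : ℝ≥0, ∀ φ : SmoothFunction n N,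
        ‖P φ‖ₑ ^ 2 ≤ K * ∫⁻ x in M, ‖φ x‖ₑ ^ 2 ∂μHE[n]) ∧
      ∀ φ : SmoothFunction n N, ∫⁻ x in θ '' B, ‖φ x‖ₑ ^ 2 ∂μHE[n] ≤
        ε * (∫⁻ x in M, ‖riemannianGradient n φ x‖ₑ ^ 2 ∂μHE[n]) +
        (l.map fun P => ‖P φ‖ₑ ^ 2).sum := by
  -- The factors come from mapping the integral to the parameter domain, the Poincaré inequality and
  -- mapping back to `M`. The Poincaré factor scales like `D ^ 2`, so a small mesh `D` makes the
  -- product at most `ε`.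
  set A : ℝ≥0 := C ^ n * (2 * C ^ 2 * 2 ^ n) * C ^ n
  set D : ℝ≥0 := NNReal.sqrt (ε / (A + 1))
  have hD : 0 < D := NNReal.sqrt_pos.2 (by positivity)
  have hAD : C ^ n * (2 * (C * D) ^ 2 * 2 ^ n) * C ^ n ≤ ε := by
    calc C ^ n * (2 * (C * D) ^ 2 * 2 ^ n) * C ^ n = A * D ^ 2 := by simp only [A]; ring
      _ = A * (ε / (A + 1)) := by rw [NNReal.sq_sqrt]
      _ ≤ (A + 1) * (ε / (A + 1)) := by gcongr; exact le_self_add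
      _ = ε := mul_div_cancel₀ _ (by positivity)
  obtain ⟨T, Q, hQ, hQm, hQB, hQD, hBQ, hdisj⟩ :=
    exists_finite_convex_partition h.convex h.isBounded h.measurableSet (D := D) hD
  have hVt : ∀ κ, volume (Q κ) ≠ ⊤ := fun κ => (h.isBounded.subset (hQB κ)).measure_lt_top.ne
  -- Normalisation for which the square of the functional dominates the mean-value term of the
  -- Poincaré inequality on the piece.
  set c : (Fin n → ℤ) → ℝ := fun κ => √(C ^ n * (2 * (volume.real (Q κ))⁻¹))
  have hc : ∀ κ (φ : SmoothFunction n N), (C : ℝ≥0∞) ^ n * (2 * (volume (Q κ))⁻¹ *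
      ‖∫ y in Q κ, φ (θ y)‖ₑ ^ 2) ≤ ‖c κ * ∫ y in Q κ, φ (θ y)‖ₑ ^ 2 := by
    intro κ φ
    rcases eq_or_ne (volume (Q κ)) 0 with h0 | h0
    · rw [Measure.restrict_eq_zero.2 h0]
      simp
    have hpos : 0 < volume.real (Q κ) := ENNReal.toReal_pos h0 (hVt κ)
    have h1 : ‖c κ‖ₑ ^ 2 = (C : ℝ≥0∞) ^ n * (2 * (volume (Q κ))⁻¹) := by
      rw [Real.enorm_eq_ofReal (Real.sqrt_nonneg _), ← ENNReal.ofReal_pow (Real.sqrt_nonneg _),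
        Real.sq_sqrt (by positivity), ENNReal.ofReal_mul (by positivity),
        ENNReal.ofReal_mul (by positivity), ENNReal.ofReal_inv_of_pos hpos,
        ofReal_measureReal (hVt κ), ENNReal.ofReal_pow (by positivity),
        ENNReal.ofReal_coe_nnreal, ENNReal.ofReal_ofNat]
    rw [enorm_mul, mul_pow, h1, mul_assoc ((C : ℝ≥0∞) ^ n)]
  refine ⟨T.toList.map fun κ => c κ • h.integralFunctional hM (hQB κ) (hQm κ), ?_, fun φ => ?_⟩
  · intro P hP
    obtain ⟨κ, -, rfl⟩ := List.mem_map.1 hP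
    refine ⟨‖c κ‖₊ ^ 2 * (volume (Q κ)).toNNReal * C ^ n, fun φ => ?_⟩
    have h1 : ‖∫ y in Q κ, φ (θ y)‖ₑ ^ 2 ≤ volume (Q κ) * ((C : ℝ≥0∞) ^ n *
        ∫⁻ x in M, ‖φ x‖ₑ ^ 2 ∂μHE[n]) := by
      calc ‖∫ y in Q κ, φ (θ y)‖ₑ ^ 2 ≤ (∫⁻ y in Q κ, ‖φ (θ y)‖ₑ) ^ 2 := by
            gcongr
            exact enorm_integral_le_lintegral_enorm _
        _ ≤ volume (Q κ) * ∫⁻ y in Q κ, ‖φ (θ y)‖ₑ ^ 2 := by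
            have := lintegral_sq_le (μ := volume.restrict (Q κ)) (f := fun y => ‖φ (θ y)‖ₑ)
              (h.integrableOn_comp hM (hQB κ) (hQm κ)
                φ.contMDiff.continuous).aestronglyMeasurable.aemeasurable.enorm
            rwa [Measure.restrict_apply_univ] at this
        _ ≤ _ := by
            gcongr
            exact h.lintegral_comp_le (hQB κ) (hQm κ) (f := fun x => ‖φ x‖ₑ ^ 2)
              (φ.contMDiff.continuous.measurable.enorm.pow_const 2)
              fun y hy => h.mapsTo (hQB κ hy)
    calc ‖c κ * ∫ y in Q κ, φ (θ y)‖ₑ ^ 2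
        ≤ ‖c κ‖ₑ ^ 2 * (volume (Q κ) * ((C : ℝ≥0∞) ^ n *
          ∫⁻ x in M, ‖φ x‖ₑ ^ 2 ∂μHE[n])) := by
          rw [enorm_mul, mul_pow]
          gcongr
      _ = _ := by
          push_cast
          rw [ENNReal.coe_toNNReal (hVt κ), enorm_eq_nnnorm]
          ring
  · have hφm : Measurable fun x => ‖φ x‖ₑ ^ 2 :=
      φ.contMDiff.continuous.measurable.enorm.pow_const 2
    have hgm : Measurable fun x => ‖riemannianGradient n φ x‖ₑ ^ 2 := by
      have : (fun x => ‖riemannianGradient n φ x‖ₑ ^ 2) =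
          fun x => ‖(‖riemannianGradient n φ x‖)‖ₑ ^ 2 := by
        funext x
        rw [enorm_norm]
      rw [this]
      exact (continuous_norm_riemannianGradient φ.contMDiff).measurable.enorm.pow_const 2
    have hP : ∀ κ, ∫⁻ y in Q κ, ‖φ (θ y)‖ₑ ^ 2 ≤
        2 * (C * D) ^ 2 * 2 ^ n * (∫⁻ y in Q κ, ‖riemannianGradient n φ (θ y)‖ₑ ^ 2) +
        2 * (volume (Q κ))⁻¹ * ‖∫ y in Q κ, φ (θ y)‖ₑ ^ 2 := by
      intro κ
      have := lintegral_sq_le_of_upper_gradient (hQ κ) (hQm κ) (hVt κ)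
        (h.integrableOn_comp hM (hQB κ) (hQm κ) φ.contMDiff.continuous)
        (g := fun y => ‖riemannianGradient n φ (θ y)‖)
        ((continuous_norm_riemannianGradient φ.contMDiff).comp_continuousOn
          (h.lipschitz.mono (hQB κ)).continuousOn) (C := C) (hQD κ)
        fun y hy z hz => h.abs_sub_le φ φ.contMDiff y (hQB κ hy) z (hQB κ hz)
      simpa only [enorm_norm] using this
    rw [List.map_map]
    calc ∫⁻ x in θ '' B, ‖φ x‖ₑ ^ 2 ∂μHE[n]
        ≤ (C : ℝ≥0∞) ^ n * ∫⁻ y in B, ‖φ (θ y)‖ₑ ^ 2 :=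
          h.lintegral_image_le le_rfl h.measurableSet hφm
      _ = (C : ℝ≥0∞) ^ n * ∑ κ ∈ T, ∫⁻ y in Q κ, ‖φ (θ y)‖ₑ ^ 2 := by
          rw [hBQ, lintegral_biUnion_finset hdisj fun κ _ => hQm κ]
      _ ≤ (C : ℝ≥0∞) ^ n * ∑ κ ∈ T, (2 * (C * D) ^ 2 * 2 ^ n *
          (∫⁻ y in Q κ, ‖riemannianGradient n φ (θ y)‖ₑ ^ 2) +
          2 * (volume (Q κ))⁻¹ * ‖∫ y in Q κ, φ (θ y)‖ₑ ^ 2) := by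
          gcongr with κ _
          exact hP κ
      _ = (C : ℝ≥0∞) ^ n * (2 * (C * D) ^ 2 * 2 ^ n) *
          (∫⁻ y in B, ‖riemannianGradient n φ (θ y)‖ₑ ^ 2) +
          ∑ κ ∈ T, (C : ℝ≥0∞) ^ n *
            (2 * (volume (Q κ))⁻¹ * ‖∫ y in Q κ, φ (θ y)‖ₑ ^ 2) := by
          conv_rhs => rw [hBQ]
          rw [lintegral_biUnion_finset hdisj fun κ _ => hQm κ, Finset.sum_add_distrib,
            ← Finset.mul_sum, ← Finset.mul_sum, mul_add, mul_assoc ((C : ℝ≥0∞) ^ n)]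
      _ ≤ (C : ℝ≥0∞) ^ n * (2 * (C * D) ^ 2 * 2 ^ n) *
          ((C : ℝ≥0∞) ^ n * ∫⁻ x in M, ‖riemannianGradient n φ x‖ₑ ^ 2 ∂μHE[n]) +
          ∑ κ ∈ T, ‖c κ * ∫ y in Q κ, φ (θ y)‖ₑ ^ 2 := by
          gcongr with κ _
          · exact h.lintegral_comp_le le_rfl h.measurableSet hgm h.mapsTo
          · exact hc κ φ
      _ ≤ ε * (∫⁻ x in M, ‖riemannianGradient n φ x‖ₑ ^ 2 ∂μHE[n]) +
          ∑ κ ∈ T, ‖c κ * ∫ y in Q κ, φ (θ y)‖ₑ ^ 2 := by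
          rw [← mul_assoc]
          gcongr
          exact_mod_cast hAD
      _ = _ := by
          rw [← Finset.sum_map_toList]
          rfl

/-- Compactness of `M` reduces the estimate to patches. Joining two sets, one halves the allowed
gradient factor and concatenates the lists of functionals. -/
theorem exists_list_functionals {M : Set N} (hM : IsCompact M)
    (hbd : HasPiecewiseSmoothBoundary n M) {ε : ℝ≥0} (hε : 0 < ε) :
    ∃ l : List (SmoothFunction n N →ₗ[ℝ] ℝ),
      (∀ P ∈ l, ∃ K : ℝ≥0, ∀ φ : SmoothFunction n N,
        ‖P φ‖ₑ ^ 2 ≤ K * ∫⁻ x in M, ‖φ x‖ₑ ^ 2 ∂μHE[n]) ∧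
      ∀ φ : SmoothFunction n N, ∫⁻ x in M, ‖φ x‖ₑ ^ 2 ∂μHE[n] ≤
        ε * (∫⁻ x in M, ‖riemannianGradient n φ x‖ₑ ^ 2 ∂μHE[n]) +
        (l.map fun P => ‖P φ‖ₑ ^ 2).sum := by
  have key := hM.induction_on (p := fun s => ∀ ε : ℝ≥0, 0 < ε →
    ∃ l : List (SmoothFunction n N →ₗ[ℝ] ℝ),
      (∀ P ∈ l, ∃ K : ℝ≥0, ∀ φ : SmoothFunction n N,
        ‖P φ‖ₑ ^ 2 ≤ K * ∫⁻ x in M, ‖φ x‖ₑ ^ 2 ∂μHE[n]) ∧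
      ∀ φ : SmoothFunction n N, ∫⁻ x in s, ‖φ x‖ₑ ^ 2 ∂μHE[n] ≤
        ε * (∫⁻ x in M, ‖riemannianGradient n φ x‖ₑ ^ 2 ∂μHE[n]) +
        (l.map fun P => ‖P φ‖ₑ ^ 2).sum) ?_ ?_ ?_ ?_
  · exact key ε hε
  · exact fun ε _ => ⟨[], by simp, by simp⟩
  · intro s t hst ht ε hε
    obtain ⟨l, hl, hle⟩ := ht ε hε
    exact ⟨l, hl, fun φ => (lintegral_mono_set hst).trans (hle φ)⟩
  · intro s t hs ht ε hε
    obtain ⟨l, hl, hle⟩ := hs (ε / 2) (half_pos hε)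
    obtain ⟨l', hl', hle'⟩ := ht (ε / 2) (half_pos hε)
    refine ⟨l ++ l', fun P hP => ?_, fun φ => ?_⟩
    · rcases List.mem_append.1 hP with h | h
      exacts [hl P h, hl' P h]
    · refine (lintegral_union_le _ _ _).trans ((add_le_add (hle φ) (hle' φ)).trans_eq ?_)
      rw [List.map_append, List.sum_append, add_add_add_comm, ← add_mul, ← ENNReal.coe_add,
        add_halves]
  · intro x hx
    obtain ⟨θ, B, C, Z, -, h, h1, -, -⟩ := exists_isPatch hM.isClosed hbd hx
    exact ⟨_, h1, fun ε hε => h.exists_list hM hε⟩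

end Rellich

end MixedSpectrum

namespace MixedSpectrum

set_option linter.unusedSectionVars false

/-! ### Closability of the gradient -/

section L2

variable {α F : Type*} [MeasurableSpace α] {μ : Measure α} [NormedAddCommGroup F]

theorem lintegral_enorm_sq_eq (f : α → F) : ∫⁻ x, ‖f x‖ₑ ^ 2 ∂μ = eLpNorm f 2 μ ^ 2 := by
  have h := eLpNorm_nnreal_pow_eq_lintegral (f := f) (μ := μ) (p := 2) two_ne_zero
  simp only [NNReal.coe_ofNat, ENNReal.rpow_ofNat, ENNReal.coe_ofNat] at h
  exact h.symm

theorem tendsto_lintegral_enorm_sq_iff {ι : Type*} {l : Filter ι} {f : ι → α → F} :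
    Tendsto (fun i => ∫⁻ x, ‖f i x‖ₑ ^ 2 ∂μ) l (𝓝 0) ↔
      Tendsto (fun i => eLpNorm (f i) 2 μ) l (𝓝 0) := by
  simp_rw [lintegral_enorm_sq_eq]
  constructor <;> intro h
  · have h1 := ((ENNReal.continuous_rpow_const (y := 1 / 2)).tendsto 0).comp h
    rw [ENNReal.zero_rpow_of_pos (by norm_num)] at h1
    refine h1.congr fun i => ?_
    simp only [Function.comp]
    rw [← ENNReal.rpow_two, ← ENNReal.rpow_mul]
    norm_num
  · have h1 := ((ENNReal.continuous_pow 2).tendsto 0).comp h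
    rwa [zero_pow two_ne_zero] at h1

theorem exists_L2_limit [CompleteSpace F] {d : ℕ → α → F} (hd : ∀ j, MemLp (d j) 2 μ)
    (hcau : Tendsto (fun ij : ℕ × ℕ => ∫⁻ x, ‖d ij.1 x - d ij.2 x‖ₑ ^ 2 ∂μ) atTop (𝓝 0)) :
    ∃ G, MemLp G 2 μ ∧ Tendsto (fun j => ∫⁻ x, ‖d j x - G x‖ₑ ^ 2 ∂μ) atTop (𝓝 0) := by
  have h1 := (tendsto_lintegral_enorm_sq_iff (f := fun ij : ℕ × ℕ => d ij.1 - d ij.2)).1 hcau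
  have hc : CauchySeq fun j => (hd j).toLp (d j) := by
    rw [cauchySeq_iff_tendsto_dist_atTop_0]
    have h2 := (ENNReal.tendsto_toReal ENNReal.zero_ne_top).comp h1
    rw [ENNReal.toReal_zero] at h2
    refine h2.congr fun ij => ?_
    simp only [Function.comp, dist_edist, Lp.edist_toLp_toLp]
  obtain ⟨G, hG⟩ := cauchySeq_tendsto_of_complete hc
  refine ⟨G, Lp.memLp G, ?_⟩
  refine (tendsto_lintegral_enorm_sq_iff (f := fun j => d j - (G : α → F))).2 ?_
  rw [tendsto_iff_edist_tendsto_0] at hG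
  refine hG.congr fun j => ?_
  rw [Lp.edist_def]
  exact eLpNorm_congr_ae ((hd j).coeFn_toLp.sub EventuallyEq.rfl)

end L2

section Flat

variable {E : Type*} [NormedAddCommGroup E] [NormedSpace ℝ E] [FiniteDimensional ℝ E]
  [MeasurableSpace E] [BorelSpace E] {μ : Measure E} [μ.IsAddHaarMeasure]

theorem integrable_smul_of_tsupport_subset {F : Type*} [NormedAddCommGroup F] [NormedSpace ℝ F]
    {U : Set E} {g : E → ℝ} (hg : Continuous g)
    (hgc : HasCompactSupport g) (hgU : tsupport g ⊆ U) {f : E → F} (hf : ContinuousOn f U) :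
    Integrable (fun y => g y • f y) μ := by
  refine IntegrableOn.integrable_of_forall_notMem_eq_zero (s := tsupport g) ?_ fun y hy => ?_
  · exact ((hg.continuousOn.smul (hf.mono hgU)).integrableOn_compact hgc)
  · rw [image_eq_zero_of_notMem_tsupport hy, zero_smul]

theorem tendsto_setIntegral_smul {F : Type*} [NormedAddCommGroup F] [NormedSpace ℝ F] {U : Set E}
    (hUt : μ U ≠ ⊤) {u : ℕ → E → F} (hu : ∀ j, AEStronglyMeasurable (u j) (μ.restrict U))
    {g : E → ℝ} (hg : Continuous g) (hgc : HasCompactSupport g)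
    (hlim : Tendsto (fun j => ∫⁻ y in U, ‖u j y‖ₑ ^ 2 ∂μ) atTop (𝓝 0)) :
    Tendsto (fun j => ∫ y in U, g y • u j y ∂μ) atTop (𝓝 0) := by
  obtain ⟨K, hK⟩ := hgc.exists_bound_of_continuous hg
  rw [tendsto_zero_iff_enorm_tendsto_zero]
  have hb : ∀ j, ‖∫ y in U, g y • u j y ∂μ‖ₑ ≤
      (ENNReal.ofReal K) * (μ U * ∫⁻ y in U, ‖u j y‖ₑ ^ 2 ∂μ) ^ (1 / 2 : ℝ) := by
    intro j
    have h1 := lintegral_sq_le (hu j).enorm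
    rw [Measure.restrict_apply_univ] at h1
    have h2 := ENNReal.rpow_le_rpow h1 (z := 1 / 2) (by norm_num)
    rw [← ENNReal.rpow_two, ← ENNReal.rpow_mul] at h2
    norm_num at h2
    calc ‖∫ y in U, g y • u j y ∂μ‖ₑ ≤ ∫⁻ y in U, ‖g y • u j y‖ₑ ∂μ :=
          enorm_integral_le_lintegral_enorm _
      _ ≤ ∫⁻ y in U, ENNReal.ofReal K * ‖u j y‖ₑ ∂μ := by
          refine lintegral_mono fun y => ?_
          rw [enorm_smul]
          gcongr
          rw [← ofReal_norm]
          exact ENNReal.ofReal_le_ofReal (hK y)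
      _ ≤ _ := by
          rw [lintegral_const_mul' _ _ ENNReal.ofReal_ne_top]
          gcongr
  have hz : Tendsto (fun j => (ENNReal.ofReal K) *
      (μ U * ∫⁻ y in U, ‖u j y‖ₑ ^ 2 ∂μ) ^ (1 / 2 : ℝ)) atTop (𝓝 0) := by
    have h3 := ENNReal.Tendsto.const_mul (a := μ U) hlim (Or.inr hUt)
    have h4 := ((ENNReal.continuous_rpow_const (y := 1 / 2)).tendsto _).comp h3
    have h5 := ENNReal.Tendsto.const_mul (a := ENNReal.ofReal K) h4 (Or.inr ENNReal.ofReal_ne_top)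
    simpa using h5
  exact tendsto_of_tendsto_of_tendsto_of_le_of_le tendsto_const_nhds hz (fun _ => zero_le) hb

/-- If functions tend to zero in `L²` and their derivatives form a Cauchy sequence in `L²`, then
the derivatives tend to zero. -/
theorem tendsto_lintegral_fderiv {U : Set E} (hU : IsOpen U) (hUt : μ U ≠ ⊤) {f : ℕ → E → ℝ}
    (hf : ∀ j, ContDiffOn ℝ 1 (f j) U)
    (hd : ∀ j, MemLp (fderiv ℝ (f j)) 2 (μ.restrict U))
    (h0 : Tendsto (fun j => ∫⁻ y in U, ‖f j y‖ₑ ^ 2 ∂μ) atTop (𝓝 0))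
    (hcau : Tendsto (fun ij : ℕ × ℕ =>
      ∫⁻ y in U, ‖fderiv ℝ (f ij.1) y - fderiv ℝ (f ij.2) y‖ₑ ^ 2 ∂μ) atTop (𝓝 0)) :
    Tendsto (fun j => ∫⁻ y in U, ‖fderiv ℝ (f j) y‖ₑ ^ 2 ∂μ) atTop (𝓝 0) := by
  obtain ⟨G, hG, hlim⟩ := exists_L2_limit hd hcau
  have : IsFiniteMeasure (μ.restrict U) := ⟨by rw [Measure.restrict_apply_univ]; exact hUt.lt_top⟩
  have hGi : IntegrableOn G U μ := hG.integrable one_le_two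
  have hfd : ∀ j, ContinuousOn (fderiv ℝ (f j)) U := fun j =>
    (hf j).continuousOn_fderiv_of_isOpen hU le_rfl
  -- The `L²` limit `G` of the derivatives is the weak derivative of zero: for a test function `g`,
  -- integration by parts moves the derivative to `g`, and the integrals of `f j * dg` tend to zero.
  have hG0 : ∀ᵐ y ∂μ, y ∈ U → G y = 0 := by
    refine hU.ae_eq_zero_of_integral_contDiff_smul_eq_zero hGi.locallyIntegrableOn
      fun g hg hgc hgU => ?_
    have hset : ∀ (F : E → (E →L[ℝ] ℝ)), ∫ y, g y • F y ∂μ = ∫ y in U, g y • F y ∂μ := fun F =>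
      (setIntegral_eq_integral_of_forall_compl_eq_zero fun y hy => by
        rw [image_eq_zero_of_notMem_tsupport fun h => hy (hgU h), zero_smul]).symm
    rw [hset]
    have hgK := hgc.exists_bound_of_continuous hg.continuous
    have hgG : IntegrableOn (fun y => g y • G y) U μ := by
      obtain ⟨K, hK⟩ := hgK
      exact hGi.bdd_smul K hg.continuous.aestronglyMeasurable (Eventually.of_forall hK)
    have l1 : Tendsto (fun j => ∫ y in U, g y • (fderiv ℝ (f j) y - G y) ∂μ) atTop (𝓝 0) :=
      tendsto_setIntegral_smul hUt (fun j => (hd j).1.sub hG.1) hg.continuous hgc hlim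
    have hgd : ∀ j, Integrable (fun y => g y • fderiv ℝ (f j) y) μ := fun j =>
      integrable_smul_of_tsupport_subset hg.continuous hgc hgU (hfd j)
    have l2 : Tendsto (fun j => ∫ y in U, g y • fderiv ℝ (f j) y ∂μ) atTop
        (𝓝 (∫ y in U, g y • G y ∂μ)) := by
      rw [← zero_add (∫ y in U, g y • G y ∂μ)]
      refine (l1.add_const _).congr fun j => ?_
      simp_rw [smul_sub]
      rw [integral_sub (hgd j).integrableOn hgG, sub_add_cancel]
    ext v
    have l3 := ((ContinuousLinearMap.apply ℝ ℝ v).continuous.tendsto _).comp l2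
    refine tendsto_nhds_unique l3 ?_
    have hg' : Continuous fun y => fderiv ℝ g y v :=
      (hg.continuous_fderiv (by simp)).clm_apply continuous_const
    have hg'c : HasCompactSupport fun y => fderiv ℝ g y v := hgc.fderiv_apply (𝕜 := ℝ) v
    have hg'U : tsupport (fun y => fderiv ℝ g y v) ⊆ U :=
      (tsupport_fderiv_apply_subset ℝ v).trans hgU
    have hparts : ∀ j, (∫ y in U, g y • fderiv ℝ (f j) y ∂μ) v =
        -∫ y in U, fderiv ℝ g y v • f j y ∂μ := by
      intro j
      rw [← hset, ContinuousLinearMap.integral_apply (hgd j)]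
      rw [setIntegral_eq_integral_of_forall_compl_eq_zero fun y hy => by
        rw [image_eq_zero_of_notMem_tsupport fun h => hy (hg'U h), zero_smul]]
      have := integral_mul_fderiv_eq_neg_fderiv_mul_of_integrable (μ := μ) (f := f j) (g := g)
        (v := v) ?_ ?_ ?_ ?_ ?_
      · rw [eq_neg_iff_add_eq_zero, add_comm] at this
        rw [eq_neg_iff_add_eq_zero, ← this]
        congr 1 <;> refine integral_congr_ae (Eventually.of_forall fun y => ?_)
        · simp [mul_comm]
        · simp [mul_comm]
      · refine ((hgd j).apply_continuousLinearMap v).congr (Eventually.of_forall fun y => ?_)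
        simp [mul_comm]
      · refine (integrable_smul_of_tsupport_subset hg' hg'c hg'U (hf j).continuousOn).congr
          (Eventually.of_forall fun y => ?_)
        simp [mul_comm]
      · refine (integrable_smul_of_tsupport_subset hg.continuous hgc hgU (hf j).continuousOn).congr
          (Eventually.of_forall fun y => ?_)
        simp [mul_comm]
      · exact fun y hy => ((hf j).differentiableOn one_ne_zero).differentiableAt
          (hU.mem_nhds (hgU hy))
      · exact fun y _ => (hg.differentiable (by simp)).differentiableAt
    have l4 := (tendsto_setIntegral_smul hUt
      (fun j => (hf j).continuousOn.aestronglyMeasurable hU.measurableSet)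
      hg' hg'c h0).neg
    rw [neg_zero] at l4
    exact l4.congr fun j => (hparts j).symm
  refine hlim.congr fun j => ?_
  refine lintegral_congr_ae ?_
  rw [EventuallyEq, ae_restrict_iff' hU.measurableSet]
  filter_upwards [hG0] with y hy hyU
  rw [hy hyU, sub_zero]

end Flat

end MixedSpectrum

namespace MixedSpectrum

set_option linter.unusedSectionVars false

section Global

open scoped NNReal

variable {n : ℕ} {N : Type*} [EMetricSpace N]
    [ChartedSpace (EuclideanSpace ℝ (Fin n)) N] [IsManifold (𝓡 n) ∞ N]
    [RiemannianBundle (fun x : N => TangentSpace (𝓡 n) x)]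
    [IsContMDiffRiemannianBundle (𝓡 n) ∞ (EuclideanSpace ℝ (Fin n))
      (fun x : N => TangentSpace (𝓡 n) x)]
    [IsRiemannianManifold (𝓡 n) N] [MeasurableSpace N] [BorelSpace N]

/-! ### The gradient is closable -/

theorem measurable_enorm_riemannianGradient {φ : N → ℝ} (hφ : ContMDiff (𝓡 n) 𝓘(ℝ, ℝ) ∞ φ) :
    Measurable fun x => ‖riemannianGradient n φ x‖ₑ := by
  have : (fun x => ‖riemannianGradient n φ x‖ₑ) = fun x => ‖(‖riemannianGradient n φ x‖)‖ₑ := by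
    funext x
    rw [enorm_norm]
  rw [this]
  exact (continuous_norm_riemannianGradient hφ).measurable.enorm

theorem riemannianGradient_sub {φ ψ : N → ℝ} {x : N} (hφ : MDifferentiableAt (𝓡 n) 𝓘(ℝ, ℝ) φ x)
    (hψ : MDifferentiableAt (𝓡 n) 𝓘(ℝ, ℝ) ψ x) :
    riemannianGradient n (φ - ψ) x = riemannianGradient n φ x - riemannianGradient n ψ x := by
  have h1 : MDifferentiableAt (𝓡 n) 𝓘(ℝ, ℝ) ((-1 : ℝ) • ψ) x := hψ.const_smul (-1)
  have h2 : φ - ψ = φ + (-1 : ℝ) • ψ := by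
    rw [neg_one_smul, sub_eq_add_neg]
  rw [h2, riemannianGradient_add hφ h1, riemannianGradient_smul hψ, neg_one_smul, sub_eq_add_neg]

theorem lintegral_gradient_le_of_sub {φ ψ : N → ℝ} (hφ : ContMDiff (𝓡 n) 𝓘(ℝ, ℝ) ∞ φ)
    (hψ : ContMDiff (𝓡 n) 𝓘(ℝ, ℝ) ∞ ψ) (S : Set N) :
    ∫⁻ x in S, ‖riemannianGradient n φ x‖ₑ ^ 2 ∂μHE[n] ≤
      2 * (∫⁻ x in S, ‖riemannianGradient n (φ - ψ) x‖ₑ ^ 2 ∂μHE[n]) +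
      2 * ∫⁻ x in S, ‖riemannianGradient n ψ x‖ₑ ^ 2 ∂μHE[n] := by
  rw [← lintegral_const_mul' _ _ (by simp), ← lintegral_const_mul' _ _ (by simp),
    ← lintegral_add_left (((measurable_enorm_riemannianGradient (φ := φ - ψ)
      (hφ.sub hψ)).pow_const 2).const_mul 2)]
  refine lintegral_mono fun x => ?_
  have := ENNReal.rpow_add_le_mul_rpow_add_rpow ‖riemannianGradient n (φ - ψ) x‖ₑ
    ‖riemannianGradient n ψ x‖ₑ (p := 2) (by norm_num)
  norm_num [mul_add] at this
  refine le_trans ?_ this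
  gcongr
  rw [riemannianGradient_sub (hφ.mdifferentiableAt_real (n := n) x)
    (hψ.mdifferentiableAt_real (n := n) x)]
  conv_lhs => rw [← sub_add_cancel (riemannianGradient n φ x) (riemannianGradient n ψ x)]
  exact enorm_add_le _ _

/-- A chart around an interior point compares volumes and gradients with Euclidean ones up to
constants, so Euclidean closability transfers. -/
theorem exists_nhds_tendsto_gradient {M : Set N} (hM : IsCompact M) {φ : ℕ → SmoothFunction n N}
    (h0 : Tendsto (fun j => ∫⁻ x in M, ‖φ j x‖ₑ ^ 2 ∂μHE[n]) atTop (𝓝 0))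
    (hcau : Tendsto (fun ij : ℕ × ℕ => ∫⁻ x in M,
      ‖riemannianGradient n (φ ij.1 - φ ij.2 : SmoothFunction n N) x‖ₑ ^ 2 ∂μHE[n]) atTop (𝓝 0))
    {x : N} (hx : M ∈ 𝓝 x) : ∃ V ∈ 𝓝 x,
      Tendsto (fun j => ∫⁻ x in V, ‖riemannianGradient n (φ j) x‖ₑ ^ 2 ∂μHE[n]) atTop (𝓝 0) := by
  obtain ⟨r, hr, C, h, hball, hgrad⟩ := exists_isPatch_interior (n := n) hx
  set s := (extChartAt (𝓡 n) x).symm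
  set U := Metric.ball (extChartAt (𝓡 n) x x) r
  have hvol : volume U ≠ ⊤ := measure_ball_lt_top.ne
  have hfin : IsFiniteMeasure (volume.restrict U) :=
    ⟨by rw [Measure.restrict_apply_univ]; exact hvol.lt_top⟩
  have hC : ∀ ψ : SmoothFunction n N, ∀ y ∈ U,
      ‖fderiv ℝ (ψ ∘ s) y‖ₑ ≤ C * ‖riemannianGradient n ψ (s y)‖ₑ ∧
      ‖riemannianGradient n ψ (s y)‖ₑ ≤ C * ‖fderiv ℝ (ψ ∘ s) y‖ₑ := by
    intro ψ y hy
    obtain ⟨h1, h2⟩ := hgrad ψ ψ.contMDiff y hy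
    have h1' := ENNReal.ofReal_le_ofReal h1
    have h2' := ENNReal.ofReal_le_ofReal h2
    rw [ENNReal.ofReal_mul C.coe_nonneg, ENNReal.ofReal_coe_nnreal, ofReal_norm, ofReal_norm]
      at h1' h2'
    exact ⟨h1', h2'⟩
  have hf : ∀ ψ : SmoothFunction n N, ContDiffOn ℝ 1 (ψ ∘ s) U := fun ψ =>
    ((contDiffOn_comp_extChartAt_symm ψ.contMDiff x).mono hball).of_le (by exact_mod_cast le_top)
  have hUm : MeasurableSet U := measurableSet_ball
  have hgm : ∀ ψ : SmoothFunction n N, Measurable fun x => ‖riemannianGradient n ψ x‖ₑ ^ 2 :=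
    fun ψ => (measurable_enorm_riemannianGradient ψ.contMDiff).pow_const 2
  have hbound : ∀ ψ : SmoothFunction n N, ∫⁻ y in U, ‖fderiv ℝ (ψ ∘ s) y‖ₑ ^ 2 ≤
      (C : ℝ≥0∞) ^ 2 * (C ^ n * ∫⁻ x in M, ‖riemannianGradient n ψ x‖ₑ ^ 2 ∂μHE[n]) := by
    intro ψ
    calc ∫⁻ y in U, ‖fderiv ℝ (ψ ∘ s) y‖ₑ ^ 2
        ≤ ∫⁻ y in U, (C : ℝ≥0∞) ^ 2 * ‖riemannianGradient n ψ (s y)‖ₑ ^ 2 := by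
          refine setLIntegral_mono' hUm fun y hy => ?_
          rw [← mul_pow]
          gcongr
          exact (hC ψ y hy).1
      _ ≤ _ := by
          rw [lintegral_const_mul' _ _ (by finiteness)]
          gcongr
          exact h.lintegral_comp_le le_rfl hUm (hgm ψ) h.mapsTo
  have key := tendsto_lintegral_fderiv (μ := volume) Metric.isOpen_ball hvol
    (f := fun j => φ j ∘ s) (fun j => hf _) (fun j => ?_) ?_ ?_
  · refine ⟨s '' U, extChartAt_symm_image_mem_nhds (Metric.ball_mem_nhds _ hr), ?_⟩
    have hz := ENNReal.Tendsto.const_mul (a := (C : ℝ≥0∞) ^ n * C ^ 2) key (Or.inr (by finiteness))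
    rw [mul_zero] at hz
    refine tendsto_of_tendsto_of_tendsto_of_le_of_le tendsto_const_nhds hz (fun _ => zero_le)
      fun j => (h.lintegral_image_le le_rfl hUm (hgm (φ j))).trans ?_
    change _ ≤ (C : ℝ≥0∞) ^ n * C ^ 2 * _
    rw [mul_assoc]
    gcongr
    rw [← lintegral_const_mul' _ _ (by finiteness)]
    refine setLIntegral_mono' hUm fun y hy => ?_
    rw [← mul_pow]
    gcongr
    exact (hC (φ j) y hy).2
  · obtain ⟨K, hK⟩ := hM.exists_bound_of_continuousOn
      (continuous_norm_riemannianGradient (φ j).contMDiff).continuousOn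
    refine MemLp.of_bound (((hf (φ j)).continuousOn_fderiv_of_isOpen Metric.isOpen_ball
      le_rfl).aestronglyMeasurable hUm) (C * K) ?_
    refine (ae_restrict_iff' hUm).2 (Eventually.of_forall fun y hy => ?_)
    refine (hgrad _ (φ j).contMDiff y hy).1.trans ?_
    have := hK _ (h.mapsTo hy)
    rw [norm_norm] at this
    gcongr
  · have hz := ENNReal.Tendsto.const_mul (a := (C : ℝ≥0∞) ^ n) h0 (Or.inr (by finiteness))
    rw [mul_zero] at hz
    exact tendsto_of_tendsto_of_tendsto_of_le_of_le tendsto_const_nhds hz (fun _ => zero_le)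
      fun j => h.lintegral_comp_le le_rfl hUm (f := fun x => ‖φ j x‖ₑ ^ 2)
        ((φ j).contMDiff.continuous.measurable.enorm.pow_const 2) h.mapsTo
  · have hz := ENNReal.Tendsto.const_mul (a := (C : ℝ≥0∞) ^ 2 * C ^ n) hcau
      (Or.inr (by finiteness))
    rw [mul_zero] at hz
    refine tendsto_of_tendsto_of_tendsto_of_le_of_le tendsto_const_nhds hz (fun _ => zero_le)
      fun ij => ?_
    change _ ≤ (C : ℝ≥0∞) ^ 2 * C ^ n * _
    rw [mul_assoc]
    refine le_trans (le_of_eq ?_) (hbound (φ ij.1 - φ ij.2))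
    refine setLIntegral_congr_fun hUm fun y hy => ?_
    have hd : ∀ ψ : SmoothFunction n N, DifferentiableAt ℝ (ψ ∘ s) y := fun ψ =>
      ((hf ψ).differentiableOn one_ne_zero).differentiableAt (Metric.isOpen_ball.mem_nhds hy)
    exact congrArg (fun L : EuclideanSpace ℝ (Fin n) →L[ℝ] ℝ => ‖L‖ₑ ^ 2)
      (fderiv_sub (hd (φ ij.1)) (hd (φ ij.2))).symm

theorem exists_isCompact_exhaustion_interior {M : Set N} (hM : IsCompact M) :
    ∃ K : ℕ → Set N, (∀ m, IsCompact (K m)) ∧ (∀ m, K m ⊆ interior M) ∧ ⋃ m, K m = interior M ∧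
      Monotone K := by
  obtain ⟨K, hK, hKM, hKU, hmono⟩ := (isOpen_interior (s := M)).exists_iUnion_isClosed
  exact ⟨K, fun m => hM.of_isClosed_subset (hK m) ((hKM m).trans interior_subset), hKM, hKU, hmono⟩

theorem restrict_interior_eq {M : Set N} (hM : IsCompact M)
    (hbd : HasPiecewiseSmoothBoundary n M) :
    (μHE[n] : Measure N).restrict M = (μHE[n] : Measure N).restrict (interior M) := by
  refine Measure.restrict_congr_set (ae_eq_set.2 ⟨?_, ?_⟩)
  · rw [← hM.isClosed.frontier_eq]
    exact measure_frontier_eq_zero hM hbd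
  · rw [sdiff_eq_empty.2 interior_subset, measure_empty]

/-- Closability is local only in the interior, so it is first obtained on compact subsets. The
Cauchy condition on all of `M` rules out concentration of the gradients near the boundary, and the
boundary itself is null. -/
theorem tendsto_lintegral_gradient {M : Set N} (hM : IsCompact M)
    (hbd : HasPiecewiseSmoothBoundary n M) {φ : ℕ → SmoothFunction n N}
    (h0 : Tendsto (fun j => ∫⁻ x in M, ‖φ j x‖ₑ ^ 2 ∂μHE[n]) atTop (𝓝 0))
    (hcau : Tendsto (fun ij : ℕ × ℕ => ∫⁻ x in M,
      ‖riemannianGradient n (φ ij.1 - φ ij.2 : SmoothFunction n N) x‖ₑ ^ 2 ∂μHE[n]) atTop (𝓝 0)) :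
    Tendsto (fun j => ∫⁻ x in M, ‖riemannianGradient n (φ j) x‖ₑ ^ 2 ∂μHE[n]) atTop (𝓝 0) := by
  obtain ⟨K, hK, hKM, hKU, hKmono⟩ := exists_isCompact_exhaustion_interior hM
  have hloc : ∀ m, Tendsto
      (fun j => ∫⁻ x in K m, ‖riemannianGradient n (φ j) x‖ₑ ^ 2 ∂μHE[n]) atTop (𝓝 0) := by
    intro m
    refine (hK m).induction_on (p := fun s => Tendsto
      (fun j => ∫⁻ x in s, ‖riemannianGradient n (φ j) x‖ₑ ^ 2 ∂μHE[n]) atTop (𝓝 0)) ?_ ?_ ?_ ?_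
    · simp
    · exact fun s t hst ht => tendsto_of_tendsto_of_tendsto_of_le_of_le tendsto_const_nhds ht
        (fun _ => zero_le) fun j => lintegral_mono_set hst
    · intro s t hs ht
      have := hs.add ht
      rw [add_zero] at this
      exact tendsto_of_tendsto_of_tendsto_of_le_of_le tendsto_const_nhds this
        (fun _ => zero_le) fun j => lintegral_union_le _ _ _
    · intro x hx
      obtain ⟨V, hV, h⟩ := exists_nhds_tendsto_gradient hM h0 hcau
        (mem_interior_iff_mem_nhds.1 (hKM m hx))
      exact ⟨V, mem_nhdsWithin_of_mem_nhds hV, h⟩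
  rw [ENNReal.tendsto_nhds_zero] at hcau ⊢
  intro ε hε
  have hε2 : 0 < ε / 2 := ENNReal.half_pos hε.ne'
  obtain ⟨⟨i₀, j₀⟩, hJ⟩ := eventually_atTop.1 (hcau (ε / 2) hε2)
  filter_upwards [eventually_ge_atTop i₀] with i hi
  rw [restrict_interior_eq hM hbd, ← hKU, setLIntegral_iUnion_of_directed _ hKmono.directed_le]
  refine iSup_le fun m => ?_
  -- Comparison with a later index `j`: the difference costs at most `ε`, whatever `m` is, and the
  -- remaining term on `K m` vanishes as `j → ∞`.
  have hle : ∀ j ≥ j₀, ∫⁻ x in K m, ‖riemannianGradient n (φ i) x‖ₑ ^ 2 ∂μHE[n] ≤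
      ε + 2 * ∫⁻ x in K m, ‖riemannianGradient n (φ j) x‖ₑ ^ 2 ∂μHE[n] := by
    intro j hj
    refine (lintegral_gradient_le_of_sub (φ i).contMDiff (φ j).contMDiff (K m)).trans ?_
    gcongr
    have h1 := hJ (i, j) ⟨hi, hj⟩
    calc 2 * ∫⁻ x in K m, ‖riemannianGradient n (φ i - φ j : N → ℝ) x‖ₑ ^ 2 ∂μHE[n]
        ≤ 2 * (ε / 2) := by
          gcongr
          exact (lintegral_mono_set ((hKM m).trans interior_subset)).trans h1
      _ = ε := ENNReal.mul_div_cancel two_ne_zero (by simp)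
  have hz := (ENNReal.Tendsto.const_mul (a := 2) (hloc m) (Or.inr (by simp))).const_add ε
  rw [mul_zero, add_zero] at hz
  exact ge_of_tendsto hz ((eventually_ge_atTop j₀).mono hle)

/-! ### The space `L²(M)` -/

/-- A square integrable function orthogonal to all smooth functions supported in the interior
vanishes. -/
theorem eq_zero_of_forall_integral_mul_eq_zero {M : Set N} (hM : IsCompact M)
    (hbd : HasPiecewiseSmoothBoundary n M) (h : L2 n M)
    (hh : ∀ g : SmoothFunction n N, tsupport g ⊆ interior M →
      ∫ x in M, g x * h x ∂μHE[n] = 0) : h = 0 := by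
  have hfin : IsFiniteMeasure ((μHE[n] : Measure N).restrict M) :=
    ⟨by rw [Measure.restrict_apply_univ]; exact measure_lt_top_of_hasPiecewiseSmoothBoundary hM hbd⟩
  obtain ⟨K, hK, -, hKU, -⟩ := exists_isCompact_exhaustion_interior hM
  have hint : Integrable h ((μHE[n] : Measure N).restrict M) := (Lp.memLp h).integrable one_le_two
  have key := (isOpen_interior (s := M)).ae_eq_zero_of_integral_contMDiff_smul_eq_zero' (𝓡 n)
    ⟨K, hK, hKU⟩ (μ := (μHE[n] : Measure N).restrict M) hint.integrableOn.locallyIntegrableOn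
    fun g hg _ hgM => hh ⟨g, hg⟩ hgM
  have hae : ∀ᵐ x ∂(μHE[n] : Measure N).restrict M, x ∈ interior M := by
    rw [restrict_interior_eq hM hbd]
    exact ae_restrict_mem isOpen_interior.measurableSet
  rw [Lp.eq_zero_iff_ae_eq_zero]
  filter_upwards [key, hae] with x h1 h2 using h1 h2

theorem measure_singleton_eq_zero (hn : n ≠ 0) (x : N) : (μHE[n] : Measure N) {x} = 0 := by
  have : (μH[n] : Measure N) {x} = 0 := by
    have := Measure.nullSingletonClass_hausdorff N (d := n) (by positivity)
    exact measure_singleton x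
  rw [Measure.euclideanHausdorffMeasure_def, Measure.smul_apply, this, smul_zero]

/-- The nonempty interior contains infinitely many disjoint open sets of positive measure, whose
indicators are independent. This is what allows an eigenbasis indexed by all of `ℕ`. -/
theorem not_finiteDimensional_L2 (hn : n ≠ 0) {M : Set N} (hM : IsCompact M)
    (hbd : HasPiecewiseSmoothBoundary n M) (hne : (interior M).Nonempty) :
    ¬ FiniteDimensional ℝ (L2 n M) := by
  intro hfd
  have hinf : Infinite (interior M) := by
    rw [Set.infinite_coe_iff]
    intro hf
    have h1 : (μHE[n] : Measure N) (interior M) = 0 := by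
      rw [← biUnion_of_singleton (interior M)]
      exact (measure_biUnion_null_iff hf.countable).2 fun x _ => measure_singleton_eq_zero hn x
    exact (measure_pos_of_isOpen (n := n) isOpen_interior hne).ne' h1
  obtain ⟨V, hV, hVo, hVd⟩ := exists_seq_infinite_isOpen_pairwise_disjoint (interior M)
  set U : ℕ → Set N := fun k => Subtype.val '' V k
  have hUo : ∀ k, IsOpen (U k) := fun k => isOpen_interior.isOpenMap_subtype_val _ (hVo k)
  have hUM : ∀ k, U k ⊆ M := by
    rintro k _ ⟨x, -, rfl⟩
    exact interior_subset x.2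
  have hUt : ∀ k, (μHE[n] : Measure N).restrict M (U k) ≠ ⊤ := fun k =>
    ((Measure.restrict_apply_le _ _).trans_lt ((measure_mono (hUM k)).trans_lt
      (measure_lt_top_of_hasPiecewiseSmoothBoundary hM hbd))).ne
  have hpos : ∀ k, 0 < (μHE[n] : Measure N).restrict M (U k) := fun k => by
    rw [Measure.restrict_apply (hUo k).measurableSet, inter_eq_left.2 (hUM k)]
    exact measure_pos_of_isOpen (n := n) (hUo k) ((hV k).nonempty.image _)
  let e : ℕ → L2 n M := fun k => indicatorConstLp 2 (hUo k).measurableSet (hUt k) (1 : ℝ)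
  have hinner : ∀ k l, inner ℝ (e k) (e l) = ((μHE[n] : Measure N).restrict M).real (U k ∩ U l) :=
    fun k l => L2.real_inner_indicatorConstLp_one_indicatorConstLp_one
      (hUo k).measurableSet (hUo l).measurableSet (hUt k) (hUt l)
  have hli : LinearIndependent ℝ e := by
    refine linearIndependent_of_ne_zero_of_inner_eq_zero (fun k hk => ?_) fun k l hkl => ?_
    · have := hinner k k
      rw [hk, inner_zero_left, inter_self] at this
      exact (ENNReal.toReal_pos (hpos k).ne' (hUt k)).ne this
    · simp only
      rw [hinner, ← image_inter Subtype.val_injective, (hVd hkl).inter_eq, image_empty,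
        measureReal_empty]
  exact not_finite_iff_infinite.2 inferInstance hli.finite

end Global

end MixedSpectrum

namespace MixedSpectrum

set_option linter.unusedSectionVars false

section FormDomain

open scoped NNReal

variable {n : ℕ} {N : Type*} [EMetricSpace N]
    [ChartedSpace (EuclideanSpace ℝ (Fin n)) N] [IsManifold (𝓡 n) ∞ N]
    [RiemannianBundle (fun x : N => TangentSpace (𝓡 n) x)]
    [IsContMDiffRiemannianBundle (𝓡 n) ∞ (EuclideanSpace ℝ (Fin n))
      (fun x : N => TangentSpace (𝓡 n) x)]
    [IsRiemannianManifold (𝓡 n) N] [MeasurableSpace N] [BorelSpace N]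

/-! ### The form domain `H¹(M)` -/

theorem memLp_of_continuous {M : Set N} (hM : IsCompact M) (hμ : (μHE[n] : Measure N) M < ⊤)
    {φ : N → ℝ} (hφ : Continuous φ) : MemLp φ 2 ((μHE[n] : Measure N).restrict M) := by
  have hfin : IsFiniteMeasure ((μHE[n] : Measure N).restrict M) :=
    ⟨by rwa [Measure.restrict_apply_univ]⟩
  obtain ⟨K, hK⟩ := hM.exists_bound_of_continuousOn hφ.continuousOn
  exact MemLp.of_bound hφ.measurable.aestronglyMeasurable K
    ((ae_restrict_iff' hM.isClosed.measurableSet).2 (Eventually.of_forall hK))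

theorem integrableOn_of_continuous {M : Set N} (hM : IsCompact M)
    (hμ : (μHE[n] : Measure N) M < ⊤) {φ : N → ℝ} (hφ : Continuous φ) :
    IntegrableOn φ M (μHE[n] : Measure N) := by
  have hfin : IsFiniteMeasure ((μHE[n] : Measure N).restrict M) :=
    ⟨by rwa [Measure.restrict_apply_univ]⟩
  exact (memLp_of_continuous hM hμ hφ).integrable one_le_two

/-- A smooth function as an element of `L²(M)`. -/
noncomputable def smoothToL2 {M : Set N} (hM : IsCompact M) (hμ : (μHE[n] : Measure N) M < ⊤) :
    SmoothFunction n N →ₗ[ℝ] L2 n M where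
  toFun φ := (memLp_of_continuous hM hμ φ.contMDiff.continuous).toLp φ
  map_add' _ _ := rfl
  map_smul' _ _ := rfl

/-- The Dirichlet integral of smooth functions. -/
noncomputable def dirichletForm (M : Set N) (φ ψ : SmoothFunction n N) : ℝ :=
  ∫ x in M, inner ℝ (riemannianGradient n φ x) (riemannianGradient n ψ x) ∂μHE[n]

theorem enorm_smoothToL2_sq {M : Set N} (hM : IsCompact M) (hμ : (μHE[n] : Measure N) M < ⊤)
    (φ : SmoothFunction n N) :
    ‖smoothToL2 hM hμ φ‖ₑ ^ 2 = ∫⁻ x in M, ‖φ x‖ₑ ^ 2 ∂μHE[n] := by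
  rw [lintegral_enorm_sq_eq]
  change ‖(memLp_of_continuous hM hμ φ.contMDiff.continuous).toLp φ‖ₑ ^ 2 = _
  rw [Lp.enorm_toLp]

theorem enorm_smoothToL2_sub_sq {M : Set N} (hM : IsCompact M) (hμ : (μHE[n] : Measure N) M < ⊤)
    (φ : SmoothFunction n N) (u : L2 n M) :
    ‖smoothToL2 hM hμ φ - u‖ₑ ^ 2 = ∫⁻ x in M, ‖φ x - u x‖ₑ ^ 2 ∂μHE[n] := by
  have h := lintegral_enorm_sq_eq (μ := (μHE[n] : Measure N).restrict M) (fun x => φ x - u x)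
  rw [h, Lp.enorm_def]
  congr 1
  refine eLpNorm_congr_ae ((Lp.coeFn_sub _ _).trans ?_)
  exact (MemLp.coeFn_toLp (memLp_of_continuous hM hμ φ.contMDiff.continuous)).sub EventuallyEq.rfl

theorem ofReal_dirichletForm_self {M : Set N} (hM : IsCompact M) (hμ : (μHE[n] : Measure N) M < ⊤)
    (φ : SmoothFunction n N) : ENNReal.ofReal (dirichletForm M φ φ) =
      ∫⁻ x in M, ‖riemannianGradient n φ x‖ₑ ^ 2 ∂μHE[n] := by
  rw [dirichletForm, ofReal_integral_eq_lintegral_ofReal (integrableOn_of_continuous hM hμ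
    (continuous_inner_riemannianGradient φ.contMDiff φ.contMDiff))
    (Eventually.of_forall fun x => real_inner_self_nonneg)]
  refine lintegral_congr fun x => ?_
  rw [real_inner_self_eq_norm_sq, ENNReal.ofReal_pow (norm_nonneg _), ofReal_norm]

theorem dirichletForm_add_left {M : Set N} (hM : IsCompact M) (hμ : (μHE[n] : Measure N) M < ⊤)
    (φ φ' ψ : SmoothFunction n N) :
    dirichletForm M (φ + φ') ψ = dirichletForm M φ ψ + dirichletForm M φ' ψ := by
  rw [dirichletForm, dirichletForm, dirichletForm, ← integral_add
    (integrableOn_of_continuous hM hμ (continuous_inner_riemannianGradient φ.contMDiff ψ.contMDiff))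
    (integrableOn_of_continuous hM hμ
      (continuous_inner_riemannianGradient φ'.contMDiff ψ.contMDiff))]
  refine integral_congr_ae (Eventually.of_forall fun x => ?_)
  change inner ℝ (riemannianGradient n (φ + φ' : N → ℝ) x) _ = _
  rw [riemannianGradient_add (φ.contMDiff.mdifferentiableAt_real x)
    (φ'.contMDiff.mdifferentiableAt_real x), inner_add_left]

theorem dirichletForm_smul_left (M : Set N) (c : ℝ) (φ ψ : SmoothFunction n N) :
    dirichletForm M (c • φ) ψ = c * dirichletForm M φ ψ := by
  rw [dirichletForm, dirichletForm, ← integral_const_mul]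
  refine integral_congr_ae (Eventually.of_forall fun x => ?_)
  change inner ℝ (riemannianGradient n (c • φ : N → ℝ) x) _ = _
  rw [riemannianGradient_smul (φ.contMDiff.mdifferentiableAt_real x), real_inner_smul_left]

/-- `W` is the completion of the smooth functions in the norm of `H¹(M)`, and `J` is the canonical
map from `W` to `L²(M)`. -/
structure IsFormCompletion {M : Set N} (hM : IsCompact M) (hμ : (μHE[n] : Measure N) M < ⊤)
    {W : Type*} [NormedAddCommGroup W] [InnerProductSpace ℝ W]
    (inc : SmoothFunction n N →ₗ[ℝ] W) (J : W →L[ℝ] L2 n M) : Prop where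
  dense : DenseRange inc
  inner_eq : ∀ φ ψ, inner ℝ (inc φ) (inc ψ) =
    inner ℝ (smoothToL2 hM hμ φ) (smoothToL2 hM hμ ψ) + dirichletForm M φ ψ
  map_inc : ∀ φ, J (inc φ) = smoothToL2 hM hμ φ

variable {M : Set N} {hM : IsCompact M} {hμ : (μHE[n] : Measure N) M < ⊤}
    {W : Type*} [NormedAddCommGroup W] [InnerProductSpace ℝ W]
    {inc : SmoothFunction n N →ₗ[ℝ] W} {J : W →L[ℝ] L2 n M}

theorem IsFormCompletion.enorm_sq (h : IsFormCompletion hM hμ inc J) (φ : SmoothFunction n N) :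
    ‖inc φ‖ₑ ^ 2 = (∫⁻ x in M, ‖φ x‖ₑ ^ 2 ∂μHE[n]) +
      ∫⁻ x in M, ‖riemannianGradient n φ x‖ₑ ^ 2 ∂μHE[n] := by
  have h1 := h.inner_eq φ φ
  rw [real_inner_self_eq_norm_sq, real_inner_self_eq_norm_sq] at h1
  rw [← enorm_smoothToL2_sq hM hμ, ← ofReal_dirichletForm_self hM hμ, ← ofReal_norm, ← ofReal_norm,
    ← ENNReal.ofReal_pow (norm_nonneg _), ← ENNReal.ofReal_pow (norm_nonneg _), h1,
    ENNReal.ofReal_add (sq_nonneg _)]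
  exact integral_nonneg fun x => real_inner_self_nonneg

theorem tendsto_enorm_sq_iff {ι F : Type*} [NormedAddCommGroup F] {l : Filter ι} {u : ι → F} :
    Tendsto (fun i => ‖u i‖ₑ ^ 2) l (𝓝 0) ↔ Tendsto u l (𝓝 0) := by
  rw [tendsto_zero_iff_enorm_tendsto_zero (f := u)]
  constructor <;> intro h
  · have h1 := ((ENNReal.continuous_rpow_const (y := 1 / 2)).tendsto 0).comp h
    rw [ENNReal.zero_rpow_of_pos (by norm_num)] at h1
    refine h1.congr fun i => ?_
    simp only [Function.comp]
    rw [← ENNReal.rpow_two, ← ENNReal.rpow_mul]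
    norm_num
  · have h1 := ((ENNReal.continuous_pow 2).tendsto 0).comp h
    rwa [zero_pow two_ne_zero] at h1

theorem cauchySeq_iff_tendsto_enorm_sq {F : Type*} [NormedAddCommGroup F] {u : ℕ → F} :
    CauchySeq u ↔ Tendsto (fun ij : ℕ × ℕ => ‖u ij.1 - u ij.2‖ₑ ^ 2) atTop (𝓝 0) := by
  rw [cauchySeq_iff_tendsto_dist_atTop_0, tendsto_enorm_sq_iff]
  simp_rw [dist_eq_norm]
  exact (tendsto_zero_iff_norm_tendsto_zero (f := fun ij : ℕ × ℕ => u ij.1 - u ij.2)).symm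

theorem IsFormCompletion.cauchy_gradient (h : IsFormCompletion hM hμ inc J)
    {φ : ℕ → SmoothFunction n N} (hφ : CauchySeq fun j => inc (φ j)) :
    Tendsto (fun ij : ℕ × ℕ => ∫⁻ x in M,
      ‖riemannianGradient n (φ ij.1 - φ ij.2 : SmoothFunction n N) x‖ₑ ^ 2 ∂μHE[n])
      atTop (𝓝 0) := by
  rw [cauchySeq_iff_tendsto_enorm_sq] at hφ
  refine tendsto_of_tendsto_of_tendsto_of_le_of_le tendsto_const_nhds hφ (fun _ => zero_le)
    fun ij => ?_
  rw [← map_sub, h.enorm_sq]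
  exact le_add_self

theorem IsFormCompletion.injective [CompleteSpace W] (h : IsFormCompletion hM hμ inc J)
    (hbd : HasPiecewiseSmoothBoundary n M) : Function.Injective J := by
  refine injective_of_closable h.dense fun φ h0 hcau => ?_
  have h0' : Tendsto (fun j => ∫⁻ x in M, ‖φ j x‖ₑ ^ 2 ∂μHE[n]) atTop (𝓝 0) := by
    simp_rw [h.map_inc] at h0
    simp_rw [← enorm_smoothToL2_sq hM hμ]
    exact tendsto_enorm_sq_iff.2 h0
  have h1 := h0'.add (tendsto_lintegral_gradient hM hbd h0' (h.cauchy_gradient hcau))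
  rw [add_zero] at h1
  refine tendsto_enorm_sq_iff.1 (h1.congr fun j => (h.enorm_sq (φ j)).symm)

theorem IsFormCompletion.isCompactOperator [CompleteSpace W] (h : IsFormCompletion hM hμ inc J)
    (hbd : HasPiecewiseSmoothBoundary n M) : IsCompactOperator J := by
  refine isCompactOperator_of_forall_list h.dense fun ε hε => ?_
  obtain ⟨l, hl, hle⟩ := exists_list_functionals hM hbd (ε := ε.toNNReal) (Real.toNNReal_pos.2 hε)
  refine ⟨l, fun P hP => ?_, fun φ => ?_⟩
  · obtain ⟨K, hK⟩ := hl P hP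
    refine ⟨√K, fun φ => ?_⟩
    have h1 : ‖P φ‖ₑ ^ 2 ≤ K * ‖inc φ‖ₑ ^ 2 := by
      refine (hK φ).trans ?_
      rw [h.enorm_sq]
      gcongr
      exact le_self_add
    rw [← ofReal_norm, ← ofReal_norm, ← ENNReal.ofReal_pow (norm_nonneg _),
      ← ENNReal.ofReal_pow (norm_nonneg _), ← ENNReal.ofReal_coe_nnreal,
      ← ENNReal.ofReal_mul K.coe_nonneg, ENNReal.ofReal_le_ofReal_iff (by positivity)] at h1
    refine le_of_sq_le_sq ?_ (by positivity)
    rw [mul_pow, Real.sq_sqrt K.coe_nonneg]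
    exact h1
  · have h1 := hle φ
    have h2 : (l.map fun P => ‖P φ‖ₑ ^ 2).sum = ENNReal.ofReal (l.map fun P => P φ ^ 2).sum := by
      clear hl hle h1
      induction l with
      | nil => simp
      | cons P l ih =>
        rw [List.map_cons, List.sum_cons, List.map_cons, List.sum_cons, ih, ENNReal.ofReal_add
          (sq_nonneg _) (List.sum_nonneg (by
            intro x hx
            obtain ⟨P, -, rfl⟩ := List.mem_map.1 hx
            exact sq_nonneg _)), ← ofReal_norm, ← ENNReal.ofReal_pow (norm_nonneg _),
          Real.norm_eq_abs, sq_abs]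
    have h3 : ‖J (inc φ)‖ₑ ^ 2 ≤ ENNReal.ofReal ε * ‖inc φ‖ₑ ^ 2 +
        ENNReal.ofReal (l.map fun P => P φ ^ 2).sum := by
      rw [h.map_inc, enorm_smoothToL2_sq, h.enorm_sq, ← h2]
      refine h1.trans ?_
      gcongr
      · exact le_rfl
      · exact le_add_self
    have hs : 0 ≤ (l.map fun P => P φ ^ 2).sum := List.sum_nonneg (by
      intro x hx
      obtain ⟨P, -, rfl⟩ := List.mem_map.1 hx
      exact sq_nonneg _)
    rwa [← ofReal_norm, ← ofReal_norm, ← ENNReal.ofReal_pow (norm_nonneg _),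
      ← ENNReal.ofReal_pow (norm_nonneg _), ← ENNReal.ofReal_mul hε.le,
      ← ENNReal.ofReal_add (by positivity) hs, ENNReal.ofReal_le_ofReal_iff (by positivity)] at h3

theorem IsFormCompletion.isH1Approx (h : IsFormCompletion hM hμ inc J)
    {φ : ℕ → SmoothFunction n N} {w : W} (hφ : Tendsto (fun j => inc (φ j)) atTop (𝓝 w)) :
    IsH1Approx n M (J w) fun j => φ j := by
  refine ⟨fun j => (φ j).contMDiff, ?_, ?_⟩
  · have h1 := (J.continuous.tendsto w).comp hφ
    have h2 : Tendsto (fun j => smoothToL2 hM hμ (φ j) - J w) atTop (𝓝 0) := by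
      rw [← sub_self (J w)]
      refine (h1.sub_const (J w)).congr fun j => ?_
      simp only [Function.comp, h.map_inc]
    exact (tendsto_enorm_sq_iff.2 h2).congr fun j => enorm_smoothToL2_sub_sq hM hμ _ _
  · refine (h.cauchy_gradient hφ.cauchySeq).congr fun ij => lintegral_congr fun x => ?_
    rw [← riemannianGradient_sub ((φ ij.1).contMDiff.mdifferentiableAt_real x)
      ((φ ij.2).contMDiff.mdifferentiableAt_real x)]
    rfl

theorem IsFormCompletion.exists_of_isH1Approx [CompleteSpace W] (h : IsFormCompletion hM hμ inc J)
    {u : L2 n M} {φ : ℕ → N → ℝ} (hφ : IsH1Approx n M u φ) :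
    ∃ (φ' : ℕ → SmoothFunction n N) (w : W), (∀ j, φ' j = φ j) ∧ J w = u ∧
      Tendsto (fun j => inc (φ' j)) atTop (𝓝 w) := by
  set φ' : ℕ → SmoothFunction n N := fun j => ⟨φ j, hφ.smooth j⟩
  have h1 : Tendsto (fun j => smoothToL2 hM hμ (φ' j)) atTop (𝓝 u) := by
    have := tendsto_enorm_sq_iff.1 (hφ.tendsto_L2.congr fun j =>
      (enorm_smoothToL2_sub_sq hM hμ (φ' j) u).symm)
    simpa using this.add_const u
  have h2 : CauchySeq fun j => inc (φ' j) := by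
    rw [cauchySeq_iff_tendsto_enorm_sq]
    have h3 := (cauchySeq_iff_tendsto_enorm_sq.1 h1.cauchySeq).add hφ.cauchy_gradient
    rw [add_zero] at h3
    refine h3.congr fun ij => ?_
    rw [← map_sub, ← map_sub, h.enorm_sq, enorm_smoothToL2_sq]
    congr 1
    refine lintegral_congr fun x => ?_
    rw [← riemannianGradient_sub ((hφ.smooth ij.1).mdifferentiableAt_real x)
      ((hφ.smooth ij.2).mdifferentiableAt_real x)]
    rfl
  obtain ⟨w, hw⟩ := cauchySeq_tendsto_of_complete h2
  refine ⟨φ', w, fun j => rfl, tendsto_nhds_unique ((J.continuous.tendsto w).comp hw) ?_, hw⟩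
  exact h1.congr fun j => (h.map_inc (φ' j)).symm

/-- Along any approximating sequences the Dirichlet integral is the inner product of `W` minus that
of `L²`, so it converges. Injectivity of `J` identifies the limits in `W`, so the value does not
depend on the sequences. -/
theorem IsFormCompletion.dirichletIntegralEq_iff [CompleteSpace W]
    (h : IsFormCompletion hM hμ inc J) (hinj : Function.Injective J) {w v : W} {c : ℝ} :
    DirichletIntegralEq n M (J w) (J v) c ↔ inner ℝ w v = c + inner ℝ (J w) (J v) := by
  have key : ∀ {φ ψ : ℕ → SmoothFunction n N}, Tendsto (fun j => inc (φ j)) atTop (𝓝 w) →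
      Tendsto (fun j => inc (ψ j)) atTop (𝓝 v) →
      Tendsto (fun j => dirichletForm M (φ j) (ψ j)) atTop
        (𝓝 (inner ℝ w v - inner ℝ (J w) (J v))) := by
    intro φ ψ hφ hψ
    have h1 := (hφ.inner hψ).sub
      (((J.continuous.tendsto w).comp hφ).inner (𝕜 := ℝ) ((J.continuous.tendsto v).comp hψ))
    refine h1.congr fun j => ?_
    simp only [Function.comp, h.inner_eq, h.map_inc, add_sub_cancel_left]
  constructor
  · rintro ⟨φ, ψ, hφ, hψ, hlim⟩
    obtain ⟨φ', w', hφ', hw', h1⟩ := h.exists_of_isH1Approx hφ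
    obtain ⟨ψ', v', hψ', hv', h2⟩ := h.exists_of_isH1Approx hψ
    obtain rfl := hinj hw'
    obtain rfl := hinj hv'
    have h3 := key h1 h2
    simp only [dirichletForm, hφ', hψ'] at h3
    linarith [tendsto_nhds_unique hlim h3]
  · intro heq
    obtain ⟨x, hx, hxw⟩ := mem_closure_iff_seq_limit.1 (h.dense w)
    obtain ⟨y, hy, hyv⟩ := mem_closure_iff_seq_limit.1 (h.dense v)
    choose φ hφ using hx
    choose ψ hψ using hy
    obtain rfl : (fun j => inc (φ j)) = x := funext hφ
    obtain rfl : (fun j => inc (ψ j)) = y := funext hψ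
    refine ⟨_, _, h.isH1Approx hxw, h.isH1Approx hyv, ?_⟩
    have h3 := key hxw hyv
    rwa [heq, add_sub_cancel_right] at h3

/-- The `L²` seminorm of the restriction of a smooth function to `A`. -/
noncomputable def traceSeminorm (A : Set N) (φ : SmoothFunction n N) : ℝ≥0∞ :=
  eLpNorm φ 2 ((μHE[n - 1] : Measure N).restrict A)

theorem traceSeminorm_zero (A : Set N) : traceSeminorm A (0 : SmoothFunction n N) = 0 :=
  eLpNorm_zero

theorem traceSeminorm_add_le (A : Set N) (φ ψ : SmoothFunction n N) :
    traceSeminorm A (φ + ψ) ≤ traceSeminorm A φ + traceSeminorm A ψ :=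
  eLpNorm_add_le φ.contMDiff.continuous.measurable.aestronglyMeasurable
    ψ.contMDiff.continuous.measurable.aestronglyMeasurable one_le_two

theorem traceSeminorm_smul (A : Set N) (c : ℝ) (φ : SmoothFunction n N) :
    traceSeminorm A (c • φ) = ‖c‖ₑ * traceSeminorm A φ :=
  eLpNorm_const_smul c φ 2 _

theorem traceSeminorm_mono {A A' : Set N} (hA : A ⊆ A') (φ : SmoothFunction n N) :
    traceSeminorm A φ ≤ traceSeminorm A' φ :=
  eLpNorm_mono_measure _ (Measure.restrict_mono hA le_rfl)

/-- The elements of the form domain whose trace vanishes on `A`. -/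
noncomputable def vanishingSubspace (inc : SmoothFunction n N →ₗ[ℝ] W) (A : Set N) :
    Submodule ℝ W :=
  traceKernel inc (traceSeminorm A) (traceSeminorm_zero A) (traceSeminorm_add_le A)
    (traceSeminorm_smul A)

theorem IsFormCompletion.H1Vanishing_eq [CompleteSpace W] (h : IsFormCompletion hM hμ inc J)
    (A : Set N) : H1Vanishing n M A = J '' (vanishingSubspace inc A : Set W) := by
  ext u
  constructor
  · rintro ⟨φ, hφ, hA⟩
    obtain ⟨φ', w, hφ', rfl, hw⟩ := h.exists_of_isH1Approx hφ
    refine ⟨w, mem_traceKernel_of_tendsto ?_ hw, rfl⟩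
    refine (tendsto_lintegral_enorm_sq_iff (f := fun j => (φ' j : N → ℝ))).1 (hA.congr fun j => ?_)
    rw [hφ']
  · rintro ⟨w, hw, rfl⟩
    obtain ⟨φ, h1, h2⟩ := exists_seq_of_mem_traceKernel hw
    exact ⟨_, h.isH1Approx h2, tendsto_lintegral_enorm_sq_iff.2 h1⟩

/-- The shift by `1` arises because the inner product of `W` contains the `L²` product besides the
Dirichlet integral. -/
theorem IsFormCompletion.isEigenvalueSequence_iff [CompleteSpace W]
    (h : IsFormCompletion hM hμ inc J) (hinj : Function.Injective J) {A : Set N} {lam : ℕ → ℝ} :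
    IsEigenvalueSequence n M A lam ↔ Tendsto lam atTop atTop ∧
      ∃ b : HilbertBasis ℕ ℝ (L2 n M),
        IsFormBasis J (vanishingSubspace inc A) b fun k => lam k + 1 := by
  rw [IsEigenvalueSequence]
  constructor
  · rintro ⟨hmono, htend, b, hb⟩
    refine ⟨htend, b, fun i j hij => add_le_add_left (hmono hij) 1, fun k => ?_⟩
    obtain ⟨-, hmem, hk⟩ := hb k
    rw [h.H1Vanishing_eq] at hmem hk
    obtain ⟨w, hw, hwb⟩ := hmem
    refine ⟨w, hw, hwb, fun v hv => ?_⟩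
    have h1 := hk (J v) ⟨v, hv, rfl⟩
    rw [← hwb, h.dirichletIntegralEq_iff hinj] at h1
    rw [← hwb, h1]
    ring
  · rintro ⟨htend, b, hb⟩
    refine ⟨fun i j hij => by linarith [hb.mono hij], htend, b, fun k => ⟨?_, ?_⟩⟩
    · intro h0
      have := b.orthonormal.1 k
      rw [h0, norm_zero] at this
      exact zero_ne_one this
    · obtain ⟨w, hw, hwb, hk⟩ := hb.eigen k
      rw [h.H1Vanishing_eq]
      refine ⟨⟨w, hw, hwb⟩, ?_⟩
      rintro _ ⟨v, hv, rfl⟩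
      rw [← hwb, h.dirichletIntegralEq_iff hinj, hk v hv, hwb]
      ring

/-- Smooth functions supported in the interior have zero trace on every part of the boundary, and
already nothing nonzero in `L²(M)` is orthogonal to them. -/
theorem IsFormCompletion.dense_image [CompleteSpace W] (h : IsFormCompletion hM hμ inc J)
    (hbd : HasPiecewiseSmoothBoundary n M) {A : Set N} (hA : A ⊆ frontier M) :
    Dense (J '' (vanishingSubspace inc A : Set W)) := by
  have h1 : ((vanishingSubspace inc A).map (J : W →ₗ[ℝ] L2 n M)).topologicalClosure = ⊤ := by
    rw [Submodule.topologicalClosure_eq_top_iff, Submodule.eq_bot_iff]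
    intro u hu
    refine eq_zero_of_forall_integral_mul_eq_zero hM hbd u fun g hg => ?_
    have hmem : inc g ∈ vanishingSubspace inc A := by
      refine mem_traceKernel_of_tendsto (φ := fun _ => g) ?_ tendsto_const_nhds
      have h0 : traceSeminorm A g = 0 := by
        refine le_antisymm ((traceSeminorm_mono hA g).trans (le_of_eq ?_)) zero_le
        rw [traceSeminorm, eLpNorm_congr_ae (g := 0), eLpNorm_zero]
        rw [EventuallyEq, ae_restrict_iff' isClosed_frontier.measurableSet]
        exact Eventually.of_forall fun x hx =>
          image_eq_zero_of_notMem_tsupport fun hx' => hx.2 (hg hx')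
      rw [h0]
      exact tendsto_const_nhds
    have h2 := (Submodule.mem_orthogonal _ _).1 hu _ (Submodule.mem_map_of_mem hmem)
    change inner ℝ (J (inc g)) u = 0 at h2
    rw [h.map_inc, L2.inner_def] at h2
    rw [← h2]
    refine integral_congr_ae ?_
    filter_upwards [MemLp.coeFn_toLp (memLp_of_continuous hM hμ g.contMDiff.continuous)] with x hx
    change g x * u x = inner ℝ ((memLp_of_continuous hM hμ g.contMDiff.continuous).toLp g x) (u x)
    rw [hx, RCLike.inner_apply, conj_trivial, mul_comm]
  have h2 : Dense (((vanishingSubspace inc A).map (J : W →ₗ[ℝ] L2 n M) : Submodule ℝ (L2 n M)) :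
      Set (L2 n M)) := by
    rw [Submodule.dense_iff_topologicalClosure_eq_top]
    exact h1
  exact h2

end FormDomain

theorem exists_isFormCompletion.{u} {n : ℕ} {N : Type u} [EMetricSpace N]
    [ChartedSpace (EuclideanSpace ℝ (Fin n)) N] [IsManifold (𝓡 n) ∞ N]
    [RiemannianBundle (fun x : N => TangentSpace (𝓡 n) x)]
    [IsContMDiffRiemannianBundle (𝓡 n) ∞ (EuclideanSpace ℝ (Fin n))
      (fun x : N => TangentSpace (𝓡 n) x)]
    [IsRiemannianManifold (𝓡 n) N] [MeasurableSpace N] [BorelSpace N] {M : Set N}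
    (hM : IsCompact M) (hμ : (μHE[n] : Measure N) M < ⊤) :
    ∃ (W : Type u) (_ : NormedAddCommGroup W) (_ : InnerProductSpace ℝ W) (_ : CompleteSpace W)
      (inc : SmoothFunction n N →ₗ[ℝ] W) (J : W →L[ℝ] L2 n M), IsFormCompletion hM hμ inc J := by
  obtain ⟨W, h1, h2, h3, inc, J, hd, hin, hJ⟩ := exists_form_completion (smoothToL2 hM hμ)
    (dirichletForm M)
    (fun φ ψ => integral_congr_ae (Eventually.of_forall fun x => real_inner_comm _ _))
    (fun φ => integral_nonneg fun x => real_inner_self_nonneg)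
    (dirichletForm_add_left hM hμ) (dirichletForm_smul_left M)
  exact ⟨W, h1, h2, h3, inc, J, hd, hin, hJ⟩

end MixedSpectrum

namespace MixedSpectrum

set_option linter.unusedSectionVars false

section Cutoff

open scoped NNReal

variable {n : ℕ} {N : Type*} [EMetricSpace N]
    [ChartedSpace (EuclideanSpace ℝ (Fin n)) N] [IsManifold (𝓡 n) ∞ N]
    [RiemannianBundle (fun x : N => TangentSpace (𝓡 n) x)]
    [IsContMDiffRiemannianBundle (𝓡 n) ∞ (EuclideanSpace ℝ (Fin n))
      (fun x : N => TangentSpace (𝓡 n) x)]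
    [IsRiemannianManifold (𝓡 n) N] [MeasurableSpace N] [BorelSpace N]

/-! ### Cutoff functions around a point -/

/-- The derivatives of bump functions with radii `δ` and `2δ` are bounded by a multiple of `δ⁻¹`. -/
theorem exists_bound_fderiv_contDiffBump {E : Type*} [NormedAddCommGroup E] [NormedSpace ℝ E]
    [FiniteDimensional ℝ E] (c : E) : ∃ K : ℝ≥0, ∀ f : ContDiffBump c, f.rOut = 2 * f.rIn →
      ∀ y, ‖fderiv ℝ f y‖ ≤ K / f.rIn := by
  -- Every bump with radii in ratio two is a translated rescaling of this one, whose derivative is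
  -- bounded.
  let f₀ : ContDiffBump (0 : E) := ⟨1, 2, one_pos, one_lt_two⟩
  have hf₀ : ContDiff ℝ 1 f₀ := f₀.contDiff
  obtain ⟨K, hK⟩ := (f₀.hasCompactSupport.fderiv (𝕜 := ℝ)).exists_bound_of_continuous
    (hf₀.continuous_fderiv one_ne_zero)
  have hK0 : 0 ≤ K := (norm_nonneg _).trans (hK 0)
  refine ⟨⟨K, hK0⟩, fun f hf y => ?_⟩
  have hfun : (f : E → ℝ) = fun x => f₀ (f.rIn⁻¹ • (x - c)) := by
    funext x
    rw [f.apply, f₀.apply, hf, mul_div_assoc, div_self f.rIn_pos.ne']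
    simp [f₀]
  have hd : HasFDerivAt (fun x => f.rIn⁻¹ • (x - c)) (f.rIn⁻¹ • ContinuousLinearMap.id ℝ E) y :=
    ((hasFDerivAt_id y).sub_const c).const_smul f.rIn⁻¹
  have h1 : HasFDerivAt f ((fderiv ℝ f₀ (f.rIn⁻¹ • (y - c))) ∘L
      (f.rIn⁻¹ • ContinuousLinearMap.id ℝ E)) y := by
    rw [hfun]
    exact ((hf₀.differentiable one_ne_zero).differentiableAt.hasFDerivAt).comp y hd
  rw [h1.fderiv]
  refine ContinuousLinearMap.opNorm_le_bound _ (div_nonneg hK0 f.rIn_pos.le) fun v => ?_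
  change ‖fderiv ℝ f₀ (f.rIn⁻¹ • (y - c)) (f.rIn⁻¹ • v)‖ ≤ K / f.rIn * ‖v‖
  refine (ContinuousLinearMap.le_opNorm _ _).trans ?_
  rw [norm_smul, norm_inv, Real.norm_eq_abs, abs_of_pos f.rIn_pos, div_eq_mul_inv, mul_assoc]
  have := f.rIn_pos
  exact mul_le_mul_of_nonneg_right (hK _) (by positivity)

theorem riemannianGradient_eq_zero_of_eventuallyEq_const {φ : N → ℝ} {x : N} {c : ℝ}
    (h : φ =ᶠ[𝓝 x] fun _ => c) : riemannianGradient n φ x = 0 := by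
  refine riemannianGradient_eq_of_forall fun w => ?_
  rw [h.mfderiv_eq, mfderiv_const, inner_zero_left]
  rfl

/-- Points have vanishing capacity in the weak sense that there are cutoff functions with bounded
Dirichlet integral that vanish near the point and are equal to one outside of a small set. -/
theorem exists_cutoff (hn : 2 ≤ n) (p : N) : ∃ K : ℝ≥0, ∀ ε : ℝ≥0∞, 0 < ε →
    ∃ η : SmoothFunction n N, (∀ x, 0 ≤ η x ∧ η x ≤ 1) ∧ (∀ᶠ x in 𝓝 p, η x = 0) ∧
      (∫⁻ x, ‖riemannianGradient n η x‖ₑ ^ 2 ∂μHE[n] ≤ K) ∧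
      (μHE[n] : Measure N) {x | η x ≠ 1} ≤ ε := by
  obtain ⟨r, hr, C, h, hball, hgrad⟩ := exists_isPatch_interior (n := n) (x := p) (M := univ)
    univ_mem
  set c := extChartAt (𝓡 n) p p
  set s := (extChartAt (𝓡 n) p).symm
  obtain ⟨K, hK⟩ := exists_bound_fderiv_contDiffBump c
  set v : ℝ≥0∞ := volume (Metric.ball (0 : EuclideanSpace ℝ (Fin n)) 1)
  have hv : v ≠ ⊤ := measure_ball_lt_top.ne
  refine ⟨(C * K) ^ 2 * C ^ n * 2 ^ n * v.toNNReal, fun ε hε => ?_⟩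
  -- The ball of radius `2δ` must fit into the chart and have image of measure at most `ε`; `δ ≤ 1`
  -- bounds the factor `δ ^ (n - 2)` below.
  obtain ⟨δ, hδ0, hδ1, hδr, hδε⟩ : ∃ δ : ℝ, 0 < δ ∧ δ ≤ 1 ∧ 2 * δ < r ∧
      (C : ℝ≥0∞) ^ n * (ENNReal.ofReal ((2 * δ) ^ n) * v) ≤ ε := by
    have hlim : Tendsto (fun δ : ℝ => (C : ℝ≥0∞) ^ n * (ENNReal.ofReal ((2 * δ) ^ n) * v))
        (𝓝[>] 0) (𝓝 0) := by
      have h1 : Tendsto (fun δ : ℝ => ENNReal.ofReal ((2 * δ) ^ n)) (𝓝 0) (𝓝 0) := by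
        have : Continuous fun δ : ℝ => ENNReal.ofReal ((2 * δ) ^ n) :=
          ENNReal.continuous_ofReal.comp (by fun_prop)
        have h2 := this.tendsto 0
        rwa [mul_zero, zero_pow (by omega), ENNReal.ofReal_zero] at h2
      have h2 := ENNReal.Tendsto.const_mul (a := (C : ℝ≥0∞) ^ n)
        (ENNReal.Tendsto.mul_const (b := v) h1 (Or.inr hv)) (Or.inr (by finiteness))
      rw [zero_mul, mul_zero] at h2
      exact h2.mono_left nhdsWithin_le_nhds
    have hsmall : ∀ᶠ δ : ℝ in 𝓝[>] 0, δ < min 1 (r / 2) :=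
      nhdsWithin_le_nhds (gt_mem_nhds (by positivity))
    obtain ⟨δ, ⟨h1, h2⟩, h3⟩ := ((hlim.eventually (ge_mem_nhds hε)).and hsmall).and
      self_mem_nhdsWithin |>.exists
    exact ⟨δ, h3, (h2.trans_le (min_le_left _ _)).le, by linarith [h2.trans_le (min_le_right _ _)],
      h1⟩
  have hcb : Metric.closedBall c (2 * δ) ⊆ Metric.ball c r := Metric.closedBall_subset_ball hδr
  let f : SmoothBumpFunction (𝓡 n) p :=
    { rIn := δ, rOut := 2 * δ, rIn_pos := hδ0, rIn_lt_rOut := by linarith,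
      closedBall_subset := fun y hy => hball (hcb hy.1) }
  let η : SmoothFunction n N := ⟨fun x => 1 - f x, contMDiff_const.sub f.contMDiff⟩
  have hη : ∀ x, η x = 1 - f x := fun x => rfl
  set S := s '' Metric.closedBall c (2 * δ)
  have hts : tsupport f ⊆ S :=
    f.tsupport_subset_symm_image_closedBall.trans (image_mono inter_subset_left)
  have hμS : (μHE[n] : Measure N) S ≤ (C : ℝ≥0∞) ^ n * (ENNReal.ofReal ((2 * δ) ^ n) * v) := by
    refine (h.measure_image_le hcb).trans_eq ?_
    rw [Measure.addHaar_closedBall _ _ (by positivity), finrank_euclideanSpace_fin]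
  have hSc : IsClosed S := by
    refine IsCompact.isClosed ((isCompact_closedBall _ _).image_of_continuousOn ?_)
    exact h.lipschitz.continuousOn.mono hcb
  refine ⟨η, fun x => ⟨?_, ?_⟩, ?_, ?_, ?_⟩
  · rw [hη]
    linarith [f.le_one (x := x)]
  · rw [hη]
    linarith [f.nonneg (x := x)]
  · filter_upwards [f.eventuallyEq_one] with x hx
    rw [hη, hx, Pi.one_apply, sub_self]
  · have hin : ∀ x ∈ S, ‖riemannianGradient n η x‖ₑ ^ 2 ≤ ENNReal.ofReal ((C * (K / δ)) ^ 2) := by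
      rintro _ ⟨y, hy, rfl⟩
      have hyb := hcb hy
      have h1 := (hgrad η η.contMDiff y hyb).2
      have heq : (η ∘ s) =ᶠ[𝓝 y] fun z => 1 - f.toContDiffBump z := by
        filter_upwards [Metric.isOpen_ball.mem_nhds hyb] with z hz
        have hzs : s z ∈ (chartAt (EuclideanSpace ℝ (Fin n)) p).source := by
          have := (extChartAt (𝓡 n) p).map_target (hball hz)
          rwa [extChartAt_source] at this
        change 1 - f (s z) = _
        rw [f.eqOn_source hzs]
        simp only [Function.comp]
        rw [(extChartAt (𝓡 n) p).right_inv (hball hz)]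
      have h2 : ‖fderiv ℝ (η ∘ s) y‖ ≤ K / δ := by
        rw [heq.fderiv_eq, fderiv_const_sub, norm_neg]
        exact hK f.toContDiffBump rfl y
      rw [← ofReal_norm, ← ENNReal.ofReal_pow (norm_nonneg _)]
      refine ENNReal.ofReal_le_ofReal (pow_le_pow_left₀ (norm_nonneg _) (h1.trans ?_) 2)
      gcongr
    have hout : ∀ x ∉ S, ‖riemannianGradient n η x‖ₑ ^ 2 = 0 := by
      intro x hx
      have h0 : f =ᶠ[𝓝 x] 0 := notMem_tsupport_iff_eventuallyEq.1 fun hx' => hx (hts hx')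
      rw [riemannianGradient_eq_zero_of_eventuallyEq_const (c := 1)
        (h0.mono fun y hy => by rw [hη, hy, Pi.zero_apply, sub_zero]), enorm_zero,
        zero_pow two_ne_zero]
    calc ∫⁻ x, ‖riemannianGradient n η x‖ₑ ^ 2 ∂μHE[n]
        = ∫⁻ x in S, ‖riemannianGradient n η x‖ₑ ^ 2 ∂μHE[n] := by
          rw [← lintegral_indicator hSc.measurableSet]
          refine lintegral_congr fun x => ?_
          by_cases hx : x ∈ S
          · rw [indicator_of_mem hx]
          · rw [indicator_of_notMem hx, hout x hx]
      _ ≤ ∫⁻ x in S, ENNReal.ofReal ((C * (K / δ)) ^ 2) ∂μHE[n] :=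
          setLIntegral_mono' hSc.measurableSet hin
      _ ≤ ENNReal.ofReal ((C * (K / δ)) ^ 2) *
          ((C : ℝ≥0∞) ^ n * (ENNReal.ofReal ((2 * δ) ^ n) * v)) := by
          rw [setLIntegral_const]
          gcongr
      _ = ENNReal.ofReal ((C * (K / δ)) ^ 2 * C ^ n * (2 * δ) ^ n) * v := by
          rw [ENNReal.ofReal_mul (by positivity), ENNReal.ofReal_mul (by positivity),
            ENNReal.ofReal_pow (p := (C : ℝ)) C.coe_nonneg, ENNReal.ofReal_coe_nnreal]
          ring
      _ ≤ (((C * K) ^ 2 * C ^ n * 2 ^ n : ℝ≥0) : ℝ≥0∞) * v := by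
          gcongr ?_ * v
          rw [← ENNReal.ofReal_coe_nnreal]
          refine ENNReal.ofReal_le_ofReal ?_
          push_cast
          -- Dimension at least two enters here: the squared gradient has size `δ⁻²` on a set of
          -- volume `δ ^ n`, and `δ ^ (n - 2) ≤ 1`.
          obtain ⟨m, hm⟩ := Nat.exists_eq_add_of_le hn
          have hδ := hδ0.ne'
          have hδn : δ ^ n = δ ^ 2 * δ ^ m := by rw [hm, pow_add]
          calc ((C : ℝ) * (K / δ)) ^ 2 * (C : ℝ) ^ n * (2 * δ) ^ n
              = ((C : ℝ) * K) ^ 2 * (C : ℝ) ^ n * 2 ^ n * δ ^ m := by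
                rw [mul_pow 2 δ, hδn]
                field_simp
            _ ≤ ((C : ℝ) * K) ^ 2 * (C : ℝ) ^ n * 2 ^ n * 1 := by
                gcongr
                exact pow_le_one₀ hδ0.le hδ1
            _ = _ := mul_one _
      _ = _ := by
          rw [ENNReal.coe_mul _ v.toNNReal, ENNReal.coe_toNNReal hv]
  · refine (measure_mono fun x hx => ?_).trans (hμS.trans hδε)
    by_contra hxS
    refine hx ?_
    rw [hη, image_eq_zero_of_notMem_tsupport fun hx' => hxS (hts hx'), sub_zero]

end Cutoff

end MixedSpectrum

namespace MixedSpectrum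

set_option linter.unusedSectionVars false

open scoped NNReal

/-! ### Smooth truncation -/

/-- A smooth function with values in `[-k, k]`, close to the identity for large `k`. -/
noncomputable def sinTruncation (k t : ℝ) : ℝ := k * Real.sin (t / k)

theorem hasDerivAt_sinTruncation {k : ℝ} (hk : 0 < k) (t : ℝ) :
    HasDerivAt (sinTruncation k) (Real.cos (t / k)) t := by
  have h := ((Real.hasDerivAt_sin (t / k)).comp t ((hasDerivAt_id t).div_const k)).const_mul k
  refine h.congr_deriv ?_
  field_simp

theorem lipschitzWith_sinTruncation {k : ℝ} (hk : 0 < k) : LipschitzWith 1 (sinTruncation k) := by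
  refine lipschitzWith_of_nnnorm_deriv_le
    (fun t => (hasDerivAt_sinTruncation hk t).differentiableAt) fun t => ?_
  rw [(hasDerivAt_sinTruncation hk t).deriv, ← NNReal.coe_le_coe, coe_nnnorm]
  exact Real.abs_cos_le_one _

theorem sinTruncation_zero (k : ℝ) : sinTruncation k 0 = 0 := by simp [sinTruncation]

theorem enorm_sinTruncation_sub_le {k : ℝ} (hk : 0 < k) (s t : ℝ) :
    ‖sinTruncation k s - sinTruncation k t‖ₑ ≤ ‖s - t‖ₑ := by
  have := (lipschitzWith_sinTruncation hk).edist_le_mul s t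
  rwa [ENNReal.coe_one, one_mul, edist_eq_enorm_sub, edist_eq_enorm_sub] at this

theorem enorm_sinTruncation_le {k : ℝ} (hk : 0 < k) (t : ℝ) : ‖sinTruncation k t‖ₑ ≤ ‖t‖ₑ := by
  simpa [sinTruncation_zero] using enorm_sinTruncation_sub_le hk t 0

theorem enorm_sinTruncation_le_ofReal {k : ℝ} (hk : 0 < k) (t : ℝ) :
    ‖sinTruncation k t‖ₑ ≤ ENNReal.ofReal k := by
  rw [← ofReal_norm, sinTruncation, norm_mul, Real.norm_eq_abs, Real.norm_eq_abs, abs_of_pos hk]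
  exact ENNReal.ofReal_le_ofReal (mul_le_of_le_one_right hk.le (Real.abs_sin_le_one _))

theorem tendsto_sinTruncation (t : ℝ) :
    Tendsto (fun k => sinTruncation k t) atTop (𝓝 t) := by
  have h := ((Real.hasDerivAt_sin 0).comp_of_eq (0 : ℝ) ((hasDerivAt_id (0 : ℝ)).const_mul t)
    (mul_zero t).symm).tendsto_slope
  simp only [Real.cos_zero, one_mul, mul_one] at h
  have h2 : Tendsto (fun k : ℝ => k⁻¹) atTop (𝓝[≠] 0) :=
    tendsto_inv_atTop_nhdsGT_zero.mono_right (nhdsWithin_mono _ fun x hx => ne_of_gt hx)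
  refine (h.comp h2).congr fun k => ?_
  simp [slope_def_field, sinTruncation, div_eq_mul_inv, mul_comm]

theorem enorm_add_sq_le {F : Type*} [NormedAddCommGroup F] (a b : F) :
    ‖a + b‖ₑ ^ 2 ≤ 2 * ‖a‖ₑ ^ 2 + 2 * ‖b‖ₑ ^ 2 := by
  have := ENNReal.rpow_add_le_mul_rpow_add_rpow ‖a‖ₑ ‖b‖ₑ (p := 2) (by norm_num)
  norm_num [mul_add] at this
  refine le_trans ?_ this
  gcongr
  exact enorm_add_le a b

theorem norm_le_sqrt_of_enorm_sq_le {F : Type*} [SeminormedAddCommGroup F] {a : F} {L : ℝ≥0}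
    (h : ‖a‖ₑ ^ 2 ≤ L) : ‖a‖ ≤ √L := by
  rw [← ofReal_norm, ← ENNReal.ofReal_pow (norm_nonneg _), ← ENNReal.ofReal_coe_nnreal,
    ENNReal.ofReal_le_ofReal_iff L.coe_nonneg] at h
  exact Real.le_sqrt_of_sq_le h

section Truncation

variable {n : ℕ} {N : Type*} [EMetricSpace N]
    [ChartedSpace (EuclideanSpace ℝ (Fin n)) N] [IsManifold (𝓡 n) ∞ N]
    [RiemannianBundle (fun x : N => TangentSpace (𝓡 n) x)]
    [IsContMDiffRiemannianBundle (𝓡 n) ∞ (EuclideanSpace ℝ (Fin n))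
      (fun x : N => TangentSpace (𝓡 n) x)]
    [IsRiemannianManifold (𝓡 n) N] [MeasurableSpace N] [BorelSpace N]

theorem contDiff_sinTruncation (k : ℝ) : ContDiff ℝ ∞ (sinTruncation k) :=
  contDiff_const.mul (Real.contDiff_sin.comp (contDiff_id.div_const k))

/-- The product of a cutoff function `η` and the truncation of `φ`. -/
noncomputable def cutoffTruncation (k : ℝ) (η φ : SmoothFunction n N) : SmoothFunction n N :=
  ⟨fun x => η x * sinTruncation k (φ x), η.contMDiff.mul
    ((contDiff_sinTruncation k).contMDiff.comp φ.contMDiff)⟩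

theorem cutoffTruncation_apply (k : ℝ) (η φ : SmoothFunction n N) (x : N) :
    cutoffTruncation k η φ x = η x * sinTruncation k (φ x) := rfl

theorem enorm_le_one_of_mem {t : ℝ} (ht : 0 ≤ t ∧ t ≤ 1) : ‖t‖ₑ ≤ 1 := by
  rw [← ofReal_norm, Real.norm_eq_abs, abs_of_nonneg ht.1, ← ENNReal.ofReal_one]
  exact ENNReal.ofReal_le_ofReal ht.2

theorem enorm_cutoffTruncation_le {k : ℝ} (hk : 0 < k) {η : SmoothFunction n N}
    (hη : ∀ x, 0 ≤ η x ∧ η x ≤ 1) (φ : SmoothFunction n N) (x : N) :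
    ‖cutoffTruncation k η φ x‖ₑ ≤ ‖φ x‖ₑ := by
  rw [cutoffTruncation_apply, enorm_mul]
  calc _ ≤ 1 * ‖φ x‖ₑ := mul_le_mul' (enorm_le_one_of_mem (hη x)) (enorm_sinTruncation_le hk _)
    _ = _ := one_mul _

/-- Product rule. The sine truncation is smooth, 1-Lipschitz and bounded by `k`: the last property
controls the term containing the gradient of `η`, for which `φ` itself has no bound. -/
theorem enorm_riemannianGradient_cutoffTruncation_sq_le {k : ℝ} (hk : 0 < k)
    {η : SmoothFunction n N} (hη : ∀ x, 0 ≤ η x ∧ η x ≤ 1) (φ : SmoothFunction n N) (x : N) :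
    ‖riemannianGradient n (cutoffTruncation k η φ) x‖ₑ ^ 2 ≤
      2 * ‖riemannianGradient n φ x‖ₑ ^ 2 +
        2 * (ENNReal.ofReal k ^ 2 * ‖riemannianGradient n η x‖ₑ ^ 2) := by
  have hφ := φ.contMDiff.mdifferentiableAt_real (n := n) x
  have hη' := η.contMDiff.mdifferentiableAt_real (n := n) x
  have hd := hasDerivAt_sinTruncation hk (φ x)
  have hc : MDifferentiableAt (𝓡 n) 𝓘(ℝ, ℝ) (sinTruncation k ∘ φ) x :=
    MDifferentiableAt.comp x hd.differentiableAt.mdifferentiableAt hφ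
  change ‖riemannianGradient n (η * (sinTruncation k ∘ φ) : N → ℝ) x‖ₑ ^ 2 ≤ _
  rw [riemannianGradient_mul hη' hc, riemannianGradient_comp hφ hd]
  refine (enorm_add_sq_le _ _).trans ?_
  simp only [Function.comp]
  rw [enorm_smul, enorm_smul, enorm_smul, mul_pow, mul_pow, mul_pow]
  have h1 : ‖η x‖ₑ ^ 2 ≤ 1 := pow_le_one₀ zero_le (enorm_le_one_of_mem (hη x))
  have h2 : ‖Real.cos (φ x / k)‖ₑ ^ 2 ≤ 1 := by
    refine pow_le_one₀ zero_le ?_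
    rw [← ofReal_norm, ← ENNReal.ofReal_one]
    exact ENNReal.ofReal_le_ofReal (Real.abs_cos_le_one _)
  have h3 := enorm_sinTruncation_le_ofReal hk (φ x)
  gcongr
  calc _ ≤ 1 * (1 * ‖riemannianGradient n φ x‖ₑ ^ 2) := by gcongr
    _ = _ := by rw [one_mul, one_mul]

variable {M : Set N} {hM : IsCompact M} {hμ : (μHE[n] : Measure N) M < ⊤}
    {W : Type*} [NormedAddCommGroup W] [InnerProductSpace ℝ W]
    {inc : SmoothFunction n N →ₗ[ℝ] W} {J : W →L[ℝ] L2 n M}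

theorem IsFormCompletion.enorm_inc_cutoffTruncation_sq_le (h : IsFormCompletion hM hμ inc J)
    {k : ℝ} (hk : 0 < k) {η : SmoothFunction n N} (hη : ∀ x, 0 ≤ η x ∧ η x ≤ 1)
    (φ : SmoothFunction n N) :
    ‖inc (cutoffTruncation k η φ)‖ₑ ^ 2 ≤ 2 * ‖inc φ‖ₑ ^ 2 + 2 * (ENNReal.ofReal k ^ 2 *
      ∫⁻ x in M, ‖riemannianGradient n η x‖ₑ ^ 2 ∂μHE[n]) := by
  rw [h.enorm_sq, h.enorm_sq, mul_add, add_assoc]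
  refine add_le_add ?_ ?_
  · calc _ ≤ ∫⁻ x in M, ‖φ x‖ₑ ^ 2 ∂μHE[n] := lintegral_mono fun x => by
          gcongr
          exact enorm_cutoffTruncation_le hk hη φ x
      _ ≤ 2 * ∫⁻ x in M, ‖φ x‖ₑ ^ 2 ∂μHE[n] := le_mul_of_one_le_left zero_le one_le_two
  · have m1 := (measurable_enorm_riemannianGradient φ.contMDiff (n := n)).pow_const 2
    have m2 := (measurable_enorm_riemannianGradient η.contMDiff (n := n)).pow_const 2
    rw [← lintegral_const_mul _ m1, ← lintegral_const_mul _ m2,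
      ← lintegral_const_mul _ (m2.const_mul _), ← lintegral_add_left (m1.const_mul _)]
    exact lintegral_mono fun x => enorm_riemannianGradient_cutoffTruncation_sq_le hk hη φ x

theorem IsFormCompletion.tendsto_cutoffTruncation (h : IsFormCompletion hM hμ inc J)
    {k : ℝ} (hk : 0 < k) {η φ : ℕ → SmoothFunction n N} (hη : ∀ m x, 0 ≤ η m x ∧ η m x ≤ 1)
    (hη1 : Tendsto (fun m => (μHE[n] : Measure N) {x | η m x ≠ 1}) atTop (𝓝 0)) {w : W}
    (hφ : Tendsto (fun m => inc (φ m)) atTop (𝓝 w)) :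
    Tendsto (fun m => J (inc (cutoffTruncation k (η m) (φ m)))) atTop
      (𝓝 ((lipschitzWith_sinTruncation hk).compLp (sinTruncation_zero k) (J w))) := by
  set F := (lipschitzWith_sinTruncation hk).compLp (sinTruncation_zero k) (J w)
  have hF : F =ᵐ[(μHE[n] : Measure N).restrict M] sinTruncation k ∘ (J w : N → ℝ) :=
    (lipschitzWith_sinTruncation hk).coeFn_compLp (sinTruncation_zero k) (J w)
  have h1 : Tendsto (fun m => ∫⁻ x in M, ‖φ m x - J w x‖ₑ ^ 2 ∂μHE[n]) atTop (𝓝 0) :=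
    (h.isH1Approx hφ).tendsto_L2
  have h2 : ∀ m, ∫⁻ x in M, ‖cutoffTruncation k (η m) (φ m) x - F x‖ₑ ^ 2 ∂μHE[n] ≤
      2 * (∫⁻ x in M, ‖φ m x - J w x‖ₑ ^ 2 ∂μHE[n]) +
        2 * ENNReal.ofReal k ^ 2 * (μHE[n] : Measure N) {x | η m x ≠ 1} := by
    intro m
    have hs : MeasurableSet {x | η m x ≠ 1} :=
      ((isClosed_singleton.preimage (η m).contMDiff.continuous).isOpen_compl).measurableSet
    have hmeas : AEMeasurable (fun x => 2 * ‖φ m x - J w x‖ₑ ^ 2)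
        ((μHE[n] : Measure N).restrict M) :=
      ((((φ m).contMDiff.continuous.measurable.aemeasurable.sub
        (Lp.aestronglyMeasurable (J w)).aemeasurable).enorm).pow_const 2).const_mul 2
    calc _ ≤ ∫⁻ x in M, (2 * ‖φ m x - J w x‖ₑ ^ 2 +
          {x | η m x ≠ 1}.indicator (fun _ => 2 * ENNReal.ofReal k ^ 2) x) ∂μHE[n] := by
          refine lintegral_mono_ae ?_
          filter_upwards [hF] with x hx
          rw [hx, cutoffTruncation_apply, Function.comp]
          have h3 := enorm_sinTruncation_sub_le hk (φ m x) (J w x)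
          by_cases hx1 : η m x = 1
          · rw [indicator_of_notMem (by simpa using hx1), add_zero, hx1, one_mul]
            calc _ ≤ 1 * ‖φ m x - J w x‖ₑ ^ 2 := by
                  rw [one_mul]
                  gcongr
              _ ≤ _ := by
                  gcongr
                  exact one_le_two
          · rw [indicator_of_mem (by simpa using hx1)]
            -- The first summand is controlled by the convergence of `φ m`; the second is at most
            -- `k` and lives on the small set where `η m ≠ 1`.
            have heq : η m x * sinTruncation k (φ m x) - sinTruncation k (J w x) =
                (sinTruncation k (φ m x) - sinTruncation k (J w x)) +
                  (η m x - 1) * sinTruncation k (φ m x) := by ring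
            rw [heq]
            refine (enorm_add_sq_le _ _).trans ?_
            rw [enorm_mul]
            have h4 : ‖η m x - 1‖ₑ ≤ 1 := by
              rw [← enorm_neg, neg_sub]
              exact enorm_le_one_of_mem ⟨by linarith [(hη m x).2], by linarith [(hη m x).1]⟩
            have h5 := enorm_sinTruncation_le_ofReal hk (φ m x)
            gcongr
            calc _ ≤ 1 * ENNReal.ofReal k := by gcongr
              _ = _ := one_mul _
      _ = 2 * (∫⁻ x in M, ‖φ m x - J w x‖ₑ ^ 2 ∂μHE[n]) +
          2 * ENNReal.ofReal k ^ 2 * ((μHE[n] : Measure N).restrict M) {x | η m x ≠ 1} := by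
          rw [lintegral_add_left' hmeas, lintegral_const_mul' _ _ (by norm_num),
            lintegral_indicator_const hs]
      _ ≤ _ := by
          gcongr
          exact Measure.restrict_le_self
  have h3 := (ENNReal.Tendsto.const_mul h1 (Or.inr (by norm_num : (2 : ℝ≥0∞) ≠ ⊤))).add
    (ENNReal.Tendsto.const_mul hη1 (Or.inr (by finiteness : 2 * ENNReal.ofReal k ^ 2 ≠ ⊤)))
  rw [mul_zero, mul_zero, add_zero] at h3
  have h4 := tendsto_of_tendsto_of_tendsto_of_le_of_le tendsto_const_nhds h3
    (fun _ => zero_le) h2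
  simp_rw [← enorm_smoothToL2_sub_sq hM hμ, tendsto_enorm_sq_iff] at h4
  refine (tendsto_sub_nhds_zero_iff.1 h4).congr fun m => (h.map_inc _).symm

/-- Dominated convergence, since truncation never increases absolute values. The parameter `k + 1`
keeps the truncation level positive. -/
theorem tendsto_compLp_sinTruncation {μ : Measure N} (u : Lp ℝ 2 μ) :
    Tendsto (fun k : ℕ => (lipschitzWith_sinTruncation k.cast_add_one_pos).compLp
      (sinTruncation_zero ((k : ℝ) + 1)) u) atTop (𝓝 u) := by
  rw [← tendsto_sub_nhds_zero_iff, ← tendsto_enorm_sq_iff]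
  have hu : AEStronglyMeasurable u μ := Lp.aestronglyMeasurable u
  have h1 : Tendsto (fun k : ℕ => ∫⁻ x, ‖sinTruncation ((k : ℝ) + 1) (u x) - u x‖ₑ ^ 2 ∂μ) atTop
      (𝓝 (∫⁻ _, 0 ∂μ)) := by
    refine tendsto_lintegral_of_dominated_convergence' (fun x => 2 * ‖u x‖ₑ ^ 2 + 2 * ‖u x‖ₑ ^ 2)
      (fun k => ?_) (fun k => Eventually.of_forall fun x => ?_) ?_
      (Eventually.of_forall fun x => ?_)
    · exact ((((lipschitzWith_sinTruncation k.cast_add_one_pos).continuous.comp_aestronglyMeasurable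
        hu).sub hu).enorm).pow_const 2
    · beta_reduce
      rw [sub_eq_add_neg]
      refine (enorm_add_sq_le _ _).trans ?_
      rw [enorm_neg]
      gcongr
      exact enorm_sinTruncation_le k.cast_add_one_pos _
    · have h3 : ∫⁻ x, ‖u x‖ₑ ^ 2 ∂μ ≠ ⊤ := by
        rw [lintegral_enorm_sq_eq]
        exact ENNReal.pow_ne_top (Lp.memLp u).2.ne
      have hm : AEMeasurable (fun x => 2 * ‖u x‖ₑ ^ 2) μ := (hu.enorm.pow_const 2).const_mul 2
      rw [lintegral_add_left' hm, lintegral_const_mul' _ _ (by norm_num)]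
      finiteness
    · have h4 : Tendsto (fun k : ℕ => (k : ℝ) + 1) atTop atTop :=
        tendsto_atTop_add_const_right _ _ tendsto_natCast_atTop_atTop
      exact tendsto_enorm_sq_iff.2 (tendsto_sub_nhds_zero_iff.2 ((tendsto_sinTruncation _).comp h4))
  rw [lintegral_zero] at h1
  refine h1.congr fun k => ?_
  rw [Lp.enorm_def, ← lintegral_enorm_sq_eq]
  refine lintegral_congr_ae ?_
  filter_upwards [Lp.coeFn_sub ((lipschitzWith_sinTruncation k.cast_add_one_pos).compLp
    (sinTruncation_zero ((k : ℝ) + 1)) u) u, (lipschitzWith_sinTruncation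
    k.cast_add_one_pos).coeFn_compLp (sinTruncation_zero ((k : ℝ) + 1)) u] with x h5 h6
  rw [h5, Pi.sub_apply, h6, Function.comp]

end Truncation

end MixedSpectrum

namespace MixedSpectrum

set_option linter.unusedSectionVars false

open scoped NNReal

/-! ### Vanishing outside of all balls around a point -/

theorem edist_le_intrinsicEDist {N : Type*} [EMetricSpace N] (S : Set N) (p q : N) :
    edist p q ≤ intrinsicEDist S p q := by
  refine le_iInf₂ fun γ hγ => ?_
  rw [← hγ.2.2.1, ← hγ.2.2.2]
  exact eVariationOn.edist_le γ (by simp) (by simp)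

theorem boundaryBall_mono {N : Type*} [EMetricSpace N] (M : Set N) (p : N) {ε ε' : ℝ}
    (h : ε ≤ ε') : boundaryBall M p ε ⊆ boundaryBall M p ε' :=
  fun _ hq => ⟨hq.1, hq.2.trans_le (ENNReal.ofReal_le_ofReal h)⟩

theorem exists_boundaryBall_subset {N : Type*} [EMetricSpace N] (M : Set N) {p : N} {s : Set N}
    (hs : s ∈ 𝓝 p) : ∃ ε : ℝ, 0 < ε ∧ boundaryBall M p ε ⊆ s := by
  obtain ⟨r, hr, hrs⟩ := EMetric.mem_nhds_iff.1 hs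
  -- The radius `r` may be infinite; the minimum with `1` makes it a real number.
  have hr' : min r 1 ≠ ⊤ := ((min_le_right _ _).trans_lt ENNReal.one_lt_top).ne
  refine ⟨(min r 1).toReal, ENNReal.toReal_pos (lt_min hr one_pos).ne' hr', fun q hq => hrs ?_⟩
  have := (edist_le_intrinsicEDist _ _ _).trans_lt hq.2
  rw [ENNReal.ofReal_toReal hr'] at this
  rw [Metric.mem_eball, edist_comm]
  exact this.trans_le (min_le_left _ _)

section Intersection

variable {n : ℕ} {N : Type*} [EMetricSpace N]
    [ChartedSpace (EuclideanSpace ℝ (Fin n)) N] [IsManifold (𝓡 n) ∞ N]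
    [RiemannianBundle (fun x : N => TangentSpace (𝓡 n) x)]
    [IsContMDiffRiemannianBundle (𝓡 n) ∞ (EuclideanSpace ℝ (Fin n))
      (fun x : N => TangentSpace (𝓡 n) x)]
    [IsRiemannianManifold (𝓡 n) N] [MeasurableSpace N] [BorelSpace N]

/-- On the part of `A'` outside `A` the cutoff kills the function, and elsewhere cutoff and
truncation do not increase its absolute value. -/
theorem traceSeminorm_cutoffTruncation_le {k : ℝ} (hk : 0 < k) {η : SmoothFunction n N}
    (hη : ∀ x, 0 ≤ η x ∧ η x ≤ 1) {A A' : Set N} (hA : ∀ x ∈ A', x ∉ A → η x = 0)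
    (φ : SmoothFunction n N) :
    traceSeminorm A' (cutoffTruncation k η φ) ≤ traceSeminorm A φ := by
  set μ : Measure N := μHE[n - 1]
  have hZ : MeasurableSet {x | η x = 0} :=
    (isClosed_singleton.preimage η.contMDiff.continuous).measurableSet
  have h0 : ∫⁻ x in {x | η x = 0}, ‖cutoffTruncation k η φ x‖ₑ ^ 2 ∂μ = 0 := by
    rw [setLIntegral_congr_fun (g := fun _ => 0) hZ, lintegral_zero]
    intro x hx
    have hx' : η x = 0 := hx
    simp only [cutoffTruncation_apply, hx', zero_mul, enorm_zero, zero_pow two_ne_zero]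
  have h1 : ∫⁻ x in A', ‖cutoffTruncation k η φ x‖ₑ ^ 2 ∂μ ≤ ∫⁻ x in A, ‖φ x‖ₑ ^ 2 ∂μ := by
    calc _ ≤ ∫⁻ x in A ∪ {x | η x = 0}, ‖cutoffTruncation k η φ x‖ₑ ^ 2 ∂μ :=
          lintegral_mono_set fun x hx => or_iff_not_imp_left.2 (hA x hx)
      _ ≤ (∫⁻ x in A, ‖cutoffTruncation k η φ x‖ₑ ^ 2 ∂μ) +
          ∫⁻ x in {x | η x = 0}, ‖cutoffTruncation k η φ x‖ₑ ^ 2 ∂μ := lintegral_union_le _ _ _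
      _ ≤ _ := by
          rw [h0, add_zero]
          refine lintegral_mono fun x => ?_
          gcongr
          exact enorm_cutoffTruncation_le hk hη φ x
  rw [lintegral_enorm_sq_eq, lintegral_enorm_sq_eq] at h1
  exact (ENNReal.pow_le_pow_left_iff two_ne_zero).1 h1

variable {M : Set N} {hM : IsCompact M} {hμ : (μHE[n] : Measure N) M < ⊤}
    {W : Type*} [NormedAddCommGroup W] [InnerProductSpace ℝ W] [CompleteSpace W]
    {inc : SmoothFunction n N →ₗ[ℝ] W} {J : W →L[ℝ] L2 n M}

/-- The norm bound involves the truncation level only through its product with the bound `K` for the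
cutoffs. It thus becomes uniform in `k` for trivial cutoffs, where `K = 0`. -/
theorem IsFormCompletion.exists_norm_le_of_tendsto (h : IsFormCompletion hM hμ inc J)
    (hinj : Function.Injective J) {k : ℝ} (hk : 0 < k) {η φ : ℕ → SmoothFunction n N}
    (hη : ∀ m x, 0 ≤ η m x ∧ η m x ≤ 1)
    (hη1 : Tendsto (fun m => (μHE[n] : Measure N) {x | η m x ≠ 1}) atTop (𝓝 0))
    {K C : ℝ≥0} (hK : ∀ m, ∫⁻ x, ‖riemannianGradient n (η m) x‖ₑ ^ 2 ∂μHE[n] ≤ K)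
    (hC : ∀ m, ‖inc (φ m)‖ₑ ≤ C) {w : W} (hφ : Tendsto (fun m => inc (φ m)) atTop (𝓝 w)) :
    ∃ w' : W, J w' = (lipschitzWith_sinTruncation hk).compLp (sinTruncation_zero k) (J w) ∧
      ‖w'‖ ≤ √((2 * C ^ 2 + 2 * (k.toNNReal ^ 2 * K) : ℝ≥0)) ∧
      ∀ v, Tendsto (fun m => inner ℝ (inc (cutoffTruncation k (η m) (φ m))) v) atTop
        (𝓝 (inner ℝ w' v)) := by
  refine exists_weak_limit hinj (fun m => norm_le_sqrt_of_enorm_sq_le ?_)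
    (h.tendsto_cutoffTruncation hk hη hη1 hφ)
  refine (h.enorm_inc_cutoffTruncation_sq_le hk (hη m) (φ m)).trans ?_
  have h1 := (setLIntegral_le_lintegral M _).trans (hK m)
  have h2 := hC m
  push_cast
  unfold ENNReal.ofReal
  gcongr

/-- A function that vanishes outside of all balls around a point of the boundary vanishes on the
whole boundary. -/
theorem IsFormCompletion.mem_vanishingSubspace_frontier (h : IsFormCompletion hM hμ inc J)
    (hinj : Function.Injective J) (hn : 2 ≤ n) (p : N) {w : W}
    (hw : ∀ ε : ℝ, 0 < ε → w ∈ vanishingSubspace inc (frontier M \ boundaryBall M p ε)) :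
    w ∈ vanishingSubspace inc (frontier M) := by
  obtain ⟨K, hK⟩ := exists_cutoff hn p
  have hpos : ∀ m : ℕ, (0 : ℝ) < 1 / ((m : ℝ) + 1) := fun m => by positivity
  have hpos' : ∀ m : ℕ, 0 < ENNReal.ofReal (1 / ((m : ℝ) + 1)) := fun m =>
    ENNReal.ofReal_pos.2 (hpos m)
  have hlim : Tendsto (fun m : ℕ => ENNReal.ofReal (1 / ((m : ℝ) + 1))) atTop (𝓝 0) := by
    have := (ENNReal.continuous_ofReal.tendsto 0).comp
      (tendsto_one_div_add_atTop_nhds_zero_nat (𝕜 := ℝ))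
    rwa [ENNReal.ofReal_zero] at this
  choose η hη hηp hηK hη1 using fun m : ℕ => hK _ (hpos' m)
  -- The boundary ball of radius `ε m` lies where `η m` vanishes; the approximants `φ m` chosen next
  -- have small trace outside this ball.
  choose ε hε hεη using fun m => exists_boundaryBall_subset M (hηp m)
  have hseq : ∀ m : ℕ, ∃ φ, traceSeminorm (frontier M \ boundaryBall M p (ε m)) φ ≤
      ENNReal.ofReal (1 / ((m : ℝ) + 1)) ∧ dist w (inc φ) < 1 / ((m : ℝ) + 1) := by
    intro m
    obtain ⟨_, ⟨φ, hφ, rfl⟩, hd⟩ := Metric.mem_closure_iff.1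
      (mem_traceKernel.1 (hw (ε m) (hε m)) _ (hpos' m)) _ (hpos m)
    exact ⟨φ, hφ, hd⟩
  choose φ hφτ hφd using hseq
  have hφ : Tendsto (fun m => inc (φ m)) atTop (𝓝 w) := by
    rw [tendsto_iff_dist_tendsto_zero]
    refine squeeze_zero (fun _ => dist_nonneg) (fun m => ?_)
      (tendsto_one_div_add_atTop_nhds_zero_nat (𝕜 := ℝ))
    rw [dist_comm]
    exact (hφd m).le
  have hC : ∀ m, ‖inc (φ m)‖ₑ ≤ (‖w‖₊ + 1 : ℝ≥0) := by
    intro m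
    rw [enorm_eq_nnnorm, ENNReal.coe_le_coe, ← NNReal.coe_le_coe]
    push_cast
    have h1 : 1 / ((m : ℝ) + 1) ≤ 1 := by
      rw [div_le_one (by positivity)]
      linarith [m.cast_nonneg (α := ℝ)]
    have h2 := norm_sub_norm_le (inc (φ m)) w
    rw [← dist_eq_norm, dist_comm] at h2
    linarith [hφd m]
  have hη1' := tendsto_of_tendsto_of_tendsto_of_le_of_le tendsto_const_nhds hlim
    (fun _ => zero_le) hη1
  -- The constant cutoff `1` yields the same `L²` limit with a norm bound independent of `k`;
  -- injectivity of `J` transfers this bound to the weak limit obtained with the true cutoffs.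
  let one : SmoothFunction n N := ⟨fun _ => 1, contMDiff_const⟩
  have hone : ∀ x, riemannianGradient n one x = 0 := fun x =>
    riemannianGradient_eq_zero_of_eventuallyEq_const (c := 1) (Eventually.of_forall fun _ => rfl)
  have key : ∀ k : ℝ, ∀ hk : 0 < k, ∃ w' ∈ vanishingSubspace inc (frontier M),
      J w' = (lipschitzWith_sinTruncation hk).compLp (sinTruncation_zero k) (J w) ∧
      ‖w'‖ ≤ √(2 * (‖w‖ + 1) ^ 2) := by
    intro k hk
    obtain ⟨w₁, hw₁, -, hlim₁⟩ := h.exists_norm_le_of_tendsto hinj hk hη hη1' hηK hC hφ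
    obtain ⟨w₂, hw₂, hle, -⟩ := h.exists_norm_le_of_tendsto hinj hk (η := fun _ => one) (K := 0)
      (fun _ _ => ⟨zero_le_one, le_rfl⟩) (by
        have : {x : N | one x ≠ 1} = ∅ := by
          ext x
          simp [one]
        simp [this]) (fun _ => by simp [hone]) hC hφ
    obtain rfl : w₁ = w₂ := hinj (hw₁.trans hw₂.symm)
    refine ⟨w₁, ?_, hw₁, by simpa using hle⟩
    refine mem_traceKernel_of_weak_limit ?_ hlim₁
    refine tendsto_of_tendsto_of_tendsto_of_le_of_le tendsto_const_nhds hlim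
      (fun _ => zero_le) fun m => ?_
    refine (traceSeminorm_cutoffTruncation_le hk (hη m) (fun x hx hx' => ?_) (φ m)).trans (hφτ m)
    by_contra h0
    exact hx' ⟨hx, fun hb => h0 (hεη m hb)⟩
  choose w' hw'mem hw'J hw'le using fun k : ℕ => key _ k.cast_add_one_pos
  -- Second limit, with the truncation level tending to infinity: the uniform bound makes `w` the
  -- weak limit of elements of the weakly closed vanishing subspace.
  obtain ⟨w'', hJ, -, hlim'⟩ := exists_weak_limit hinj (u := w') (h := J w) hw'le
    ((tendsto_compLp_sinTruncation (J w)).congr fun k => (hw'J k).symm)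
  obtain rfl : w'' = w := hinj hJ
  exact mem_of_weak_limit isClosed_traceKernel (Submodule.convex _)
    (Eventually.of_forall hw'mem) hlim'

end Intersection

end MixedSpectrum

namespace MixedSpectrum

set_option linter.unusedSectionVars false

/-! ### Existence of the eigenvalues, and their limit. -/

section Eigenvalues

variable {n : ℕ} {N : Type*} [EMetricSpace N]
    [ChartedSpace (EuclideanSpace ℝ (Fin n)) N] [IsManifold (𝓡 n) ∞ N]
    [RiemannianBundle (fun x : N => TangentSpace (𝓡 n) x)]
    [IsContMDiffRiemannianBundle (𝓡 n) ∞ (EuclideanSpace ℝ (Fin n))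
      (fun x : N => TangentSpace (𝓡 n) x)]
    [IsRiemannianManifold (𝓡 n) N] [MeasurableSpace N] [BorelSpace N]

/-- The Laplacian with Dirichlet conditions on a part of the boundary has discrete spectrum. -/
theorem exists_isEigenvalueSequence (hn : n ≠ 0) {M A : Set N} (hM : IsCompact M)
    (hbd : HasPiecewiseSmoothBoundary n M) (hA : A ⊆ frontier M) (hne : (frontier M).Nonempty) :
    ∃ lam : ℕ → ℝ, IsEigenvalueSequence n M A lam := by
  obtain ⟨p, hp⟩ := hne
  obtain ⟨W, _, _, _, inc, J, h⟩ :=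
    exists_isFormCompletion hM (measure_lt_top_of_hasPiecewiseSmoothBoundary hM hbd)
  obtain ⟨θ, B, C, i, -, -, -, hint⟩ := exists_isPatch_frontier hM.isClosed hbd hp
  obtain ⟨b, μ, hb, hμ⟩ := exists_isFormBasis (h.isCompactOperator hbd)
    (V := vanishingSubspace inc A) isClosed_traceKernel (h.dense_image hbd hA)
    (not_finiteDimensional_L2 hn hM hbd (hint.mono inter_subset_right))
  refine ⟨fun k => μ k - 1, (h.isEigenvalueSequence_iff (h.injective hbd)).2
    ⟨tendsto_atTop_add_const_right _ (-1) hμ, b, ?_⟩⟩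
  simpa only [sub_add_cancel] using hb

/-- The eigenvalues with Neumann conditions on a geodesic ball of the boundary converge to the
Dirichlet eigenvalues as the radius of the ball tends to zero. -/
theorem tendsto_eigenvalue_boundaryBall (hn : 2 ≤ n) {M : Set N} (hM : IsCompact M)
    (hbd : HasPiecewiseSmoothBoundary n M) (p : N) {lamD : ℕ → ℝ} {lam : ℝ → ℕ → ℝ}
    (hD : IsEigenvalueSequence n M (frontier M) lamD)
    (hlam : ∀ ε : ℝ, 0 < ε →
      IsEigenvalueSequence n M (frontier M \ boundaryBall M p ε) (lam ε)) (k : ℕ) :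
    Tendsto (fun ε => lam ε k) (𝓝[>] 0) (𝓝 (lamD k)) := by
  obtain ⟨W, _, _, _, inc, J, h⟩ :=
    exists_isFormCompletion hM (measure_lt_top_of_hasPiecewiseSmoothBoundary hM hbd)
  have hinj := h.injective hbd
  obtain ⟨-, bD, hbD⟩ := (h.isEigenvalueSequence_iff hinj).1 hD
  -- Nothing is known for `ε ≤ 0`; the Dirichlet basis serves there as an arbitrary value.
  have hex : ∀ ε : ℝ, ∃ b : HilbertBasis ℕ ℝ (L2 n M), 0 < ε → IsFormBasis J
      (vanishingSubspace inc (frontier M \ boundaryBall M p ε)) b fun k => lam ε k + 1 := by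
    intro ε
    by_cases hε : 0 < ε
    · obtain ⟨-, b, hb⟩ := (h.isEigenvalueSequence_iff hinj).1 (hlam ε hε)
      exact ⟨b, fun _ => hb⟩
    · exact ⟨bD, fun hε' => absurd hε' hε⟩
  choose b hb using hex
  have hlim := tendsto_eigenvalue (h.isCompactOperator hbd) hinj
    (V := fun ε => vanishingSubspace inc (frontier M \ boundaryBall M p ε))
    (fun _ _ => isClosed_traceKernel)
    (fun _ _ _ hle => traceKernel_mono (traceSeminorm_mono
      (sdiff_subset_sdiff_right (boundaryBall_mono M p hle))))
    (fun _ _ => traceKernel_mono (traceSeminorm_mono sdiff_subset))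
    (fun _ hw => h.mem_vanishingSubspace_frontier hinj hn p hw) hbD hb k
  simpa using hlim.sub_const 1

end Eigenvalues

end MixedSpectrum

theorem lemma5p2 {n : ℕ} (hn : 2 ≤ n) {N : Type*} [EMetricSpace N] [MeasurableSpace N]
    [BorelSpace N] [ChartedSpace (EuclideanSpace ℝ (Fin n)) N] [IsManifold (𝓡 n) ∞ N]
    [RiemannianBundle (fun x : N => TangentSpace (𝓡 n) x)]
    [IsContMDiffRiemannianBundle (𝓡 n) ∞ (EuclideanSpace ℝ (Fin n))
      (fun x : N => TangentSpace (𝓡 n) x)]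
    [IsRiemannianManifold (𝓡 n) N]
    (M : Set N) (hM : IsCompact M) (hbd : MixedSpectrum.HasPiecewiseSmoothBoundary n M)
    (p : N) (hp : p ∈ frontier M) :
    -- the Dirichlet and the mixed eigenvalues exist
    (∃ lamD : ℕ → ℝ, MixedSpectrum.IsEigenvalueSequence n M (frontier M) lamD) ∧
    (∀ ε : ℝ, 0 < ε → ∃ lam : ℕ → ℝ, MixedSpectrum.IsEigenvalueSequence n M
      (frontier M \ MixedSpectrum.boundaryBall M p ε) lam) ∧
    -- the mixed eigenvalues converge to the Dirichlet eigenvalues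
    ∀ (lamD : ℕ → ℝ) (lam : ℝ → ℕ → ℝ),
      MixedSpectrum.IsEigenvalueSequence n M (frontier M) lamD →
      (∀ ε : ℝ, 0 < ε → MixedSpectrum.IsEigenvalueSequence n M
        (frontier M \ MixedSpectrum.boundaryBall M p ε) (lam ε)) →
      ∀ k : ℕ, 1 ≤ k →
        Tendsto (fun ε : ℝ => lam ε (k - 1)) (𝓝[>] 0) (𝓝 (lamD (k - 1))) := by
  have hn0 : n ≠ 0 := by omega
  refine ⟨MixedSpectrum.exists_isEigenvalueSequence hn0 hM hbd subset_rfl ⟨p, hp⟩,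
    fun ε _ => MixedSpectrum.exists_isEigenvalueSequence hn0 hM hbd sdiff_subset ⟨p, hp⟩,
    fun lamD lam hD hlam k _ => ?_⟩
  exact MixedSpectrum.tendsto_eigenvalue_boundaryBall hn hM hbd p hD hlam (k - 1)
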